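/- Let $k$ be a $p$-adic field of characteristic $0$ with ring of integers $R$, maximal ideal $\mathfrak p$, uniformizer $\pi$, normalized valuation $\mathrm{val}$ and residue field of characteristic $p>2$ with $q>3$ elements. Let $K=\mathrm{GL}(3,R)$. Let $\chi_2,\chi_3:R^\times\to\mathbb C^\times$ be (restrictions of) characters, of conductors $M=\mathrm{cond}(\chi_2)\le N=\mathrm{cond}(\chi_3)$, where $N>0$ and $\mathrm{cond}(\chi_2\chi_3^{-1})=N$. (The conductor of $\chi$ is the least $m\ge 0$ such that $\chi$ is trivial on $R^\times\cap(1+\mathfrak p^m)$.) **Notation.** Integer triples are ordered entrywise, and $\min\{\mathbf a\}$ is the least entry of $\mathbf a$; when a triple is listed inside a minimum, its three entries are meant. Put $\mathcal T=\{\mathbf c\in\mathbb Z^3: 0\le c_1,c_2\le c_3\le c_1+c_2\}$ and $\mathcal T_{\mathbf m}=\{\mathbf c\in\mathcal T:\mathbf c\succeq\mathbf m\}$ with $\mathbf m=(M,N,N)$. For $\mathbf c\in\mathcal T$ let $C_{\mathbf c}=\{g\in K: g_{21}\in\mathfrak p^{c_1},\ g_{32}\in\mathfrak p^{c_2},\ g_{31}\in\mathfrak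 p^{c_3}\}$. For $\mathbf c\in\mathcal T_{\mathbf m}$ let $\chi_{\mathbf c}(g)=\chi_2(g_{22})\chi_3(g_{33})$, a character of $C_{\mathbf c}$ (if $M=0$ the factor $\chi_2(g_{22})$ is read as $1$), and for $\mathbf c,\mathbf d\in\mathcal T_{\mathbf m}$ let $$\mathcal H(\chi_{\mathbf c},\chi_{\mathbf d})=\{f:K\to\mathbb C: f(gkg')=\chi_{\mathbf c}(g)f(k)\chi_{\mathbf d}(g')\ \ \forall g\in C_{\mathbf c},\,k\in K,\,g'\in C_{\mathbf d}\};$$ its dimension is that of the space of intertwining operators between $U_{\mathbf c}=\mathrm{Ind}_{C_{\mathbf c}}^K\chi_{\mathbf c}$ and $U_{\mathbf d}=\mathrm{Ind}_{C_{\mathbf d}}^K\chi_{\mathbf d}$. Let $\underline c_i=\max\{c_i,1\}$ and $\mathcal T^1=\{\mathbf a\in\mathbb Z^3:1\le a_1,a_2\le a_3\}$. For $\mathbf c,\mathbf d\in\mathcal T_{\mathbf m}$ let $\mathcal T_{\mathbf c,\mathbf d}$ be the set of all $\mathbf a\in\mathcal T^1$ with $\mathbf a\preceq\underline{\mathbf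 c}$, $\mathbf a\preceq\underline{\mathbf d}$ and $a_3\le\min\{a_1+\underline c_2,\underline d_1+a_2\}$, except that $\mathcal T_{\mathbf c,\mathbf d}=\{(1,a,a):1\le a\le\min\{c_2,d_2\}\}$ if $c_1=d_1=0$. For $\mathbf a\in\mathcal T_{\mathbf c,\mathbf d}$ let $$\mathbf a(\mathbf c,\mathbf d)=\max\{0,\min\{a_1,a_2,a_3-a_1,a_3-a_2,\mathbf c-\mathbf a,\mathbf d-\mathbf a,a_1+c_2-a_3,d_1+a_2-a_3\}\},$$ $$\mathbf a(\mathbf c,\mathbf d)'=\max\{0,\min\{d_3-a_3,c_3-a_3,c_1-a_1,d_2-a_2\}\},$$ and $\mathbf a^{\mathrm{op}}=(a_3-a_2,\,a_3-a_1,\,(a_3-a_1)+(a_3-a_2))$. Let $X^{\mathbf a}_{\mathbf c,\mathbf d}$ be the quotient of $R^\times$ by the following equivalence relation. If $a_1+a_2\ne a_3$, then $x\sim y$ iff $\mathrm{val}(x-y)\ge\mathbf a(\mathbf c,\mathbf d)$. If $a_1+a_2=a_3$, put $i(x)=\min\{\mathrm{val}(x-1),\mathbf a(\mathbf c,\mathbf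 d)'\}$; then $x\sim y$ iff $i(x)=i(y)$ and $\mathrm{val}(x-y)\ge\min\{i(x)+\mathbf a(\mathbf c,\mathbf d),\mathbf a(\mathbf c,\mathbf d)'\}$. Fix any choice of a unit in each class, and identify $X^{\mathbf a}_{\mathbf c,\mathbf d}$ with the set of chosen units. Let $W=\{1,s_1,s_2,s_1s_2,s_2s_1,w_0\}$ be the Weyl group. Let $W_{\mathbf c,\mathbf d}=W$ if $c_1d_1>0$; $W_{\mathbf c,\mathbf d}=\{1,s_2,w_0\}$ if exactly one of $c_1,d_1$ is $0$; $W_{\mathbf c,\mathbf d}=\{1,w_0\}$ if $c_1=d_1=0$. Consider the elements of $K$ $$t_{\mathbf a,x}=\begin{bmatrix}1&0&0\\ \pi^{a_1}&1&0\\ x\pi^{a_3}&\pi^{a_2}&1\end{bmatrix},\quad s_1^{(\alpha,\beta)}=\begin{bmatrix}0&1&0\\1&0&0\\ \pi^\beta&\pi^\alpha&1\end{bmatrix},\quad s_2^{(\alpha,\beta)}=\begin{bmatrix}1&0&0\\ \pi^\beta&0&1\\ \pi^\alpha&1&0\end{bmatrix},$$ $$s_1s_2^{(\alpha)}=\begin{bmatrix}0&0&1\\1&0&0\\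 \pi^\alpha&1&0\end{bmatrix},\quad s_2s_1^{(\alpha)}=\begin{bmatrix}0&1&0\\0&\pi^\alpha&1\\1&0&0\end{bmatrix},\quad w_0=\begin{bmatrix}0&0&1\\0&1&0\\1&0&0\end{bmatrix},$$ and the sets - $\mathtt R^1_{\mathbf c,\mathbf d}$ of all $t_{\mathbf a,x}$ with $\mathbf a\in\mathcal T_{\mathbf c,\mathbf d}$, $x\in X^{\mathbf a}_{\mathbf c,\mathbf d}$; - $\mathtt R^{s_1}_{\mathbf c,\mathbf d}$ of all $s_1^{(\alpha,\beta)}$ with $1\le\alpha\le\min\{\underline d_2,c_3\}$, $1\le\beta\le\min\{\underline c_2,d_3\}$, $-c_1\le\beta-\alpha\le d_1$; - $\mathtt R^{s_2}_{\mathbf c,\mathbf d}$ of all $s_2^{(\alpha,\beta)}$ with $1\le\alpha\le\min\{\underline d_1,c_3\}$, $1\le\beta\le\min\{\underline c_1,d_3\}$, $-c_2\le\beta-\alpha\le d_2$; - $\mathtt R^{s_1s_2}_{\mathbf c,\mathbf d}$ of all $s_1s_2^{(\alpha)}$ with $1\le\alpha\le\min\{d_1,c_2\}$, $\mathtt R^{s_2s_1}_{\mathbf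 c,\mathbf d}$ of all $s_2s_1^{(\alpha)}$ with $1\le\alpha\le\min\{c_1,d_2\}$, and $\mathtt R^{w_0}_{\mathbf c,\mathbf d}=\{w_0\}$. **Theorem.** Let $\mathbf c,\mathbf d\in\mathcal T_{\mathbf m}$. A set of representatives for those double cosets in $C_{\mathbf c}\backslash K/C_{\mathbf d}$ that support elements of $\mathcal H(\chi_{\mathbf c},\chi_{\mathbf d})$ (on which some $f\in\mathcal H(\chi_{\mathbf c},\chi_{\mathbf d})$ does not vanish) is $\mathtt S_{\mathbf c,\mathbf d}=\bigcup_{w\in W_{\mathbf c,\mathbf d}}\mathtt S^w_{\mathbf c,\mathbf d}$: each such double coset contains exactly one element of $\mathtt S_{\mathbf c,\mathbf d}$, and every element of $\mathtt S_{\mathbf c,\mathbf d}$ lies in such a double coset. Moreover, for each $w\in W_{\mathbf c,\mathbf d}$, $\mathtt S^w_{\mathbf c,\mathbf d}$ is exactly the set of $r\in\mathtt R^w_{\mathbf c,\mathbf d}$ for which $C_{\mathbf c}rC_{\mathbf d}$ supports an element of $\mathcal H(\chi_{\mathbf c},\chi_{\mathbf d})$. Here: (i) $\mathtt S^1_{\mathbf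 c,\mathbf d}$ is the set of all $t_{\mathbf a,x}$ with $\mathbf a\in\mathcal T_{\mathbf c,\mathbf d}$, $x\in X^{\mathbf a}_{\mathbf c,\mathbf d}$ such that one of the following holds: 1. $a_1\ge M$ and $a_2\ge N$; 2. $a_1<M$ and $a_2\ge N$, and one of (a) $a_1+a_2<a_3$ and $M\le\min\{\mathbf c-\mathbf a,\mathbf d-\mathbf a,c_2+a_1-a_3,d_1+a_2-a_3\}$; (b) $a_1+a_2>a_3$ and $M\le\min\{\mathbf c-\mathbf a^{\mathrm{op}},\mathbf d-\mathbf a^{\mathrm{op}}\}$; (c) $a_1+a_2=a_3$, $M\le\min\{\mathbf c-\mathbf a,\mathbf d-\mathbf a\}$ and $\mathrm{val}(x-1)\le\mathbf a(\mathbf c,\mathbf d)'-M$; 3. $a_1\ge N$ and $a_2<N$, and one of (a), (b), (c) with $M$ replaced by $N$. (ii) $\mathtt S^{s_1}_{\mathbf c,\mathbf d}$ is the set of all $s_1^{(\alpha,\beta)}$ with $N\le\alpha\le\min\{d_2,c_3\}-M$, $N\le\beta\le\min\{c_2,d_3\}-M$ and $M-c_1\le\beta-\alpha\le d_1-M$.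 (iii) $\mathtt S^{s_2}_{\mathbf c,\mathbf d}$ is the set of all $s_2^{(\alpha,\beta)}$ with $N\le\alpha\le\min\{d_1,c_3\}-N$, $N\le\beta\le\min\{c_1,d_3\}-N$ and $N-c_2\le\beta-\alpha\le d_2-N$. (iv) $\mathtt S^{s_1s_2}_{\mathbf c,\mathbf d}=\mathtt S^{s_2s_1}_{\mathbf c,\mathbf d}=\mathtt S^{w_0}_{\mathbf c,\mathbf d}=\emptyset$. -/

import Mathlib

open scoped ValuativeRel

namespace BranchGL3

/-! ### Triples of integers -/

/-- Triples `(a₁, a₂, a₃)`, with `a₁ = a 0`, `a₂ = a 1`, `a₃ = a 2`, ordered entrywise. -/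
abbrev Triple := Fin 3 → ℤ

/-- The least of the three entries. -/
def minEntry (a : Triple) : ℤ := min (a 0) (min (a 1) (a 2))

/-- The poset `𝒯` of all `c` with `0 ≤ c₁, c₂ ≤ c₃ ≤ c₁ + c₂`. -/
def posetT : Set Triple :=
  {c | 0 ≤ c 0 ∧ 0 ≤ c 1 ∧ c 0 ≤ c 2 ∧ c 1 ≤ c 2 ∧ c 2 ≤ c 0 + c 1}

/-- The subposet of all `c ∈ 𝒯` with `m ≤ c`. -/
def posetTAbove (m : Triple) : Set Triple := {c | c ∈ posetT ∧ m ≤ c}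

/-- The set `𝒯¹` of all `a` with `1 ≤ a₁, a₂ ≤ a₃`. -/
def posetT1 : Set Triple := {a | 1 ≤ a 0 ∧ 1 ≤ a 1 ∧ a 0 ≤ a 2 ∧ a 1 ≤ a 2}

/-- The triple with entries `max (cᵢ, 1)`. -/
def under (c : Triple) : Triple := fun i => max (c i) 1

/-- `aᵒᵖ = (a₃ - a₂, a₃ - a₁, (a₃ - a₁) + (a₃ - a₂))`. -/
def op (a : Triple) : Triple := ![a 2 - a 1, a 2 - a 0, (a 2 - a 0) + (a 2 - a 1)]

/-- The set `𝒯_{c,d}` of exponents of the representatives `t_{a,x}`. -/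
def tripleSet (c d : Triple) : Set Triple :=
  if c = 0 ∨ d = 0 then {![1, 1, 1]}
  else if 0 < c 1 * d 1 ∧ c 0 = 0 ∧ d 0 = 0 then
    {a | ∃ k : ℤ, 1 ≤ k ∧ k ≤ min (c 1) (d 1) ∧ a = ![1, k, k]}
  else if 0 < c 0 * d 0 ∧ c 1 = 0 ∧ d 1 = 0 then
    {a | ∃ k : ℤ, 1 ≤ k ∧ k ≤ min (c 0) (d 0) ∧ a = ![k, 1, k]}
  else
    {a | a ∈ posetT1 ∧ a ≤ under c ∧ a ≤ under d ∧
      a 2 ≤ min (a 0 + under c 1) (under d 0 + a 1)}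

/-- The number `a(c,d)`; `Int.toNat` is the maximum with `0`. -/
def level (c d a : Triple) : ℕ :=
  (min (min (min (a 0) (a 1)) (min (a 2 - a 0) (a 2 - a 1)))
    (min (min (minEntry (c - a)) (minEntry (d - a)))
      (min (a 0 + c 1 - a 2) (d 0 + a 1 - a 2)))).toNat

/-- The number `a(c,d)'`; `Int.toNat` is the maximum with `0`. -/
def level' (c d a : Triple) : ℕ :=
  (min (min (d 2 - a 2) (c 2 - a 2)) (min (c 0 - a 0) (d 1 - a 1))).toNat

/-- The elements of the Weyl group of `GL₃`. -/
inductive Weyl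
  | one | s1 | s2 | s1s2 | s2s1 | w0

/-- The subset `W_{c,d}` of the Weyl group. -/
def weylSet (c d : Triple) : Set Weyl :=
  if (∀ i, 1 ≤ c i) ∧ (∀ i, 1 ≤ d i) then Set.univ
  else if 0 < c 0 * d 0 * (c 1 + d 1) ∧ c 1 * d 1 = 0 then {Weyl.one, Weyl.s1, Weyl.w0}
  else if c 0 * d 0 = 0 ∧ 0 < (c 0 + d 0) * (c 1 * d 1) then {Weyl.one, Weyl.s2, Weyl.w0}
  else if c 0 * c 1 = 0 ∧ d 0 * d 1 = 0 ∧ 0 < (c 0 + c 1) * (d 0 + d 1) then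
    {Weyl.one, Weyl.w0}
  else {Weyl.one}

section Ring

variable {O : Type*} [CommRing O] [IsDomain O] [IsDiscreteValuationRing O]

/-! ### Characters, the groups `C_c` and the spaces `ℋ(χ_c, χ_d)` -/

/-- The conductor of `χ` is `m`: it is the least `m ≥ 0` such that `χ` is trivial on the units in
`1 + 𝔭ᵐ`. For `m = 0` these are all units. -/
def HasConductor (χ : Oˣ →* ℂˣ) (m : ℕ) : Prop :=
  IsLeast {n : ℕ | ∀ u : Oˣ, (u : O) - 1 ∈ IsLocalRing.maximalIdeal O ^ n → χ u = 1} m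

/-- The set of all `g ∈ GL₃(O)` with `g₂₁ ∈ 𝔭^{c₁}`, `g₃₂ ∈ 𝔭^{c₂}`, `g₃₁ ∈ 𝔭^{c₃}`.
It is a subgroup for `c ∈ 𝒯`. -/
def groupC (O : Type*) [CommRing O] [IsDomain O] [IsDiscreteValuationRing O] (c : Triple) :
    Set (GL (Fin 3) O) :=
  {g | g 1 0 ∈ IsLocalRing.maximalIdeal O ^ (c 0).toNat ∧
    g 2 1 ∈ IsLocalRing.maximalIdeal O ^ (c 1).toNat ∧
    g 2 0 ∈ IsLocalRing.maximalIdeal O ^ (c 2).toNat}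

open Classical in
/-- The value of a character of `Oˣ` at an element of `O`, with value `1` at nonunits. A diagonal
entry `g₂₂` of an element of `C_c` can be a nonunit only if `c₁ = 0` or `c₂ = 0`. -/
noncomputable def evalChar (χ : Oˣ →* ℂˣ) (x : O) : ℂ :=
  if h : IsUnit x then (χ h.unit : ℂ) else 1

/-- `χ_c(g) = χ₂(g₂₂) χ₃(g₃₃)`. The formula does not depend on `c`. If `c ≥ (M, N, N)`, where
`M`, `N` are the conductors and `N ≥ 1`, then `g₃₃` is a unit for `g ∈ C_c`, and `g₂₂` is a unit
or `M = 0`, in which case `χ₂` is trivial. -/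
noncomputable def chi (χ₂ χ₃ : Oˣ →* ℂˣ) (g : GL (Fin 3) O) : ℂ :=
  evalChar χ₂ (g 1 1) * evalChar χ₃ (g 2 2)

/-- The space `ℋ(χ_c, χ_d)` of all `f : GL₃(O) → ℂ` with `f(g k g') = χ_c(g) f(k) χ_d(g')` for all
`g ∈ C_c`, `g' ∈ C_d`. -/
noncomputable def heckeSpace (χ₂ χ₃ : Oˣ →* ℂˣ) (c d : Triple) :
    Submodule ℂ (GL (Fin 3) O → ℂ) where
  carrier := {f | ∀ g ∈ groupC O c, ∀ k : GL (Fin 3) O, ∀ g' ∈ groupC O d,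
    f (g * k * g') = chi χ₂ χ₃ g * f k * chi χ₂ χ₃ g'}
  add_mem' := by
    intro f h hf hh g hg k g' hg'
    simp only [Pi.add_apply, hf g hg k g' hg', hh g hg k g' hg']
    ring
  zero_mem' := by
    intro g _ k g' _
    simp
  smul_mem' := by
    intro z f hf g hg k g' hg'
    simp only [Pi.smul_apply, smul_eq_mul, hf g hg k g' hg']
    ring

/-- The double cosets in `C_c \ GL₃(O) / C_d` on which some element of `ℋ(χ_c, χ_d)` does not
vanish. -/
def supportingCosets (χ₂ χ₃ : Oˣ →* ℂˣ) (c d : Triple) : Set (Set (GL (Fin 3) O)) :=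
  {D | (∃ k : GL (Fin 3) O, D = DoubleCoset.doubleCoset k (groupC O c) (groupC O d)) ∧
    ∃ f ∈ heckeSpace χ₂ χ₃ c d, ∃ k ∈ D, f k ≠ 0}

/-! ### The parameter sets `X^a_{c,d}` -/

/-- The normalized valuation of `O`, with `val 0 = ⊤`. -/
noncomputable def val (x : O) : ℕ∞ := IsDiscreteValuationRing.addVal O x

/-- When two units `x` and `y` represent the same element of `X^a_{c,d}`. If `a₁ + a₂ ≠ a₃`, this
means that they agree modulo `𝔭^{a(c,d)}`. If `a₁ + a₂ = a₃`, then the units are first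
sorted by `i = min (val (x - 1), a(c,d)')`, and those with the same `i` are taken modulo
`𝔭^{min (i + a(c,d), a(c,d)')}`. -/
def SameParam (c d a : Triple) (x y : Oˣ) : Prop :=
  if a 0 + a 1 = a 2 then
    min (val ((x : O) - 1)) (level' c d a) = min (val ((y : O) - 1)) (level' c d a) ∧
      min (min (val ((x : O) - 1)) (level' c d a) + level c d a) (level' c d a)
        ≤ val ((x : O) - y)
  else (level c d a : ℕ∞) ≤ val ((x : O) - y)

theorem val_sub_comm (x y : O) : val (x - y) = val (y - x) := by
  unfold val
  exact (IsDiscreteValuationRing.addVal O).map_sub_swap x y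

theorem le_val_sub_trans {n : ℕ∞} {x y z : O} (h : n ≤ val (x - y)) (h' : n ≤ val (y - z)) :
    n ≤ val (x - z) := by
  have := (IsDiscreteValuationRing.addVal O).map_add (x - y) (y - z)
  rw [sub_add_sub_cancel] at this
  exact le_trans (le_min h h') this

/-- `SameParam` as an equivalence relation on the units. -/
def paramSetoid (O : Type*) [CommRing O] [IsDomain O] [IsDiscreteValuationRing O]
    (c d a : Triple) : Setoid Oˣ where
  r := SameParam c d a
  iseqv :=
    { refl := by
        intro x
        unfold SameParam
        have h0 : val ((x : O) - x) = ⊤ := by simp [val]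
        rw [h0]
        split_ifs <;> simp
      symm := by
        intro x y h
        unfold SameParam at h ⊢
        rw [val_sub_comm (y : O) (x : O)]
        split_ifs at h ⊢ with ha
        · exact ⟨h.1.symm, h.1 ▸ h.2⟩
        · exact h
      trans := by
        intro x y z h h'
        unfold SameParam at h h' ⊢
        split_ifs at h h' ⊢ with ha
        · refine ⟨h.1.trans h'.1, le_val_sub_trans h.2 ?_⟩
          rw [h.1]
          exact h'.2
        · exact le_val_sub_trans h h' }

/-- The set `X^a_{c,d}`. -/
def Param (O : Type*) [CommRing O] [IsDomain O] [IsDiscreteValuationRing O]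
    (c d a : Triple) : Type _ := Quotient (paramSetoid O c d a)

/-! ### The double coset representatives -/

/-- `t_{a,x}` -/
noncomputable def tRep (ϖ : O) (a : Triple) (x : Oˣ) : GL (Fin 3) O :=
  Matrix.GeneralLinearGroup.mk''
    !![1, 0, 0; ϖ ^ (a 0).toNat, 1, 0; (x : O) * ϖ ^ (a 2).toNat, ϖ ^ (a 1).toNat, 1]
    (by simp [Matrix.det_fin_three])

/-- `s₁^{(α,β)}` -/
noncomputable def s1Rep (ϖ : O) (α β : ℕ) : GL (Fin 3) O :=
  Matrix.GeneralLinearGroup.mk'' !![0, 1, 0; 1, 0, 0; ϖ ^ β, ϖ ^ α, 1]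
    (by simp [Matrix.det_fin_three])

/-- `s₂^{(α,β)}` -/
noncomputable def s2Rep (ϖ : O) (α β : ℕ) : GL (Fin 3) O :=
  Matrix.GeneralLinearGroup.mk'' !![1, 0, 0; ϖ ^ β, 0, 1; ϖ ^ α, 1, 0]
    (by simp [Matrix.det_fin_three])

/-- `s₁s₂^{(α)}` -/
noncomputable def s1s2Rep (ϖ : O) (α : ℕ) : GL (Fin 3) O :=
  Matrix.GeneralLinearGroup.mk'' !![0, 0, 1; 1, 0, 0; ϖ ^ α, 1, 0]
    (by simp [Matrix.det_fin_three])

/-- `s₂s₁^{(α)}` -/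
noncomputable def s2s1Rep (ϖ : O) (α : ℕ) : GL (Fin 3) O :=
  Matrix.GeneralLinearGroup.mk'' !![0, 1, 0; 0, ϖ ^ α, 1; 1, 0, 0]
    (by simp [Matrix.det_fin_three])

/-- `w₀` -/
noncomputable def w0Rep (O : Type*) [CommRing O] : GL (Fin 3) O :=
  Matrix.GeneralLinearGroup.mk'' !![0, 0, 1; 0, 1, 0; 1, 0, 0]
    (by simp [Matrix.det_fin_three])

/-- The sets `R^w_{c,d}`. Here `σ` chooses a unit in each class of `X^a_{c,d}`. -/
def repSet (ϖ : O) (c d : Triple) (σ : ∀ a : Triple, Param O c d a → Oˣ) :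
    Weyl → Set (GL (Fin 3) O)
  | .one => {g | ∃ a ∈ tripleSet c d, ∃ ξ : Param O c d a, g = tRep ϖ a (σ a ξ)}
  | .s1 => {g | ∃ α β : ℕ,
      (1 ≤ α ∧ (α : ℤ) ≤ min (under d 1) (c 2)) ∧
      (1 ≤ β ∧ (β : ℤ) ≤ min (under c 1) (d 2)) ∧
      (-c 0 ≤ (β : ℤ) - α ∧ (β : ℤ) - α ≤ d 0) ∧ g = s1Rep ϖ α β}
  | .s2 => {g | ∃ α β : ℕ,
      (1 ≤ α ∧ (α : ℤ) ≤ min (under d 0) (c 2)) ∧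
      (1 ≤ β ∧ (β : ℤ) ≤ min (under c 0) (d 2)) ∧
      (-c 1 ≤ (β : ℤ) - α ∧ (β : ℤ) - α ≤ d 1) ∧ g = s2Rep ϖ α β}
  | .s1s2 => {g | ∃ α : ℕ, 1 ≤ α ∧ (α : ℤ) ≤ min (d 0) (c 1) ∧ g = s1s2Rep ϖ α}
  | .s2s1 => {g | ∃ α : ℕ, 1 ≤ α ∧ (α : ℤ) ≤ min (c 0) (d 1) ∧ g = s2s1Rep ϖ α}
  | .w0 => {w0Rep O}

/-- The conditions (a), (b), (c), with `L` in place of `M` or `N`. -/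
def MixedCond (c d a : Triple) (x : Oˣ) (L : ℕ) : Prop :=
  (a 0 + a 1 < a 2 ∧
    (L : ℤ) ≤ min (min (minEntry (c - a)) (minEntry (d - a)))
      (min (c 1 + a 0 - a 2) (d 0 + a 1 - a 2))) ∨
  (a 2 < a 0 + a 1 ∧ (L : ℤ) ≤ min (minEntry (c - op a)) (minEntry (d - op a))) ∨
  (a 0 + a 1 = a 2 ∧ (L : ℤ) ≤ min (minEntry (c - a)) (minEntry (d - a)) ∧
    val ((x : O) - 1) + L ≤ level' c d a)

/-- The conditions (1), (2), (3) on `t_{a,x}`. -/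
def TCond (M N : ℕ) (c d a : Triple) (x : Oˣ) : Prop :=
  ((M : ℤ) ≤ a 0 ∧ (N : ℤ) ≤ a 1) ∨
  (a 0 < M ∧ (N : ℤ) ≤ a 1 ∧ MixedCond c d a x M) ∨
  ((N : ℤ) ≤ a 0 ∧ a 1 < N ∧ MixedCond c d a x N)

/-- The sets `S^w_{c,d}`, for `w ∈ W_{c,d}`. -/
def suppSet (ϖ : O) (M N : ℕ) (c d : Triple) (σ : ∀ a : Triple, Param O c d a → Oˣ) :
    Weyl → Set (GL (Fin 3) O)
  | .one => {g | ∃ a ∈ tripleSet c d, ∃ ξ : Param O c d a,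
      TCond M N c d a (σ a ξ) ∧ g = tRep ϖ a (σ a ξ)}
  | .s1 => {g | ∃ α β : ℕ,
      (N ≤ α ∧ (α : ℤ) ≤ min (d 1) (c 2) - M) ∧
      (N ≤ β ∧ (β : ℤ) ≤ min (c 1) (d 2) - M) ∧
      (M - c 0 ≤ (β : ℤ) - α ∧ (β : ℤ) - α ≤ d 0 - M) ∧ g = s1Rep ϖ α β}
  | .s2 => {g | ∃ α β : ℕ,
      (N ≤ α ∧ (α : ℤ) ≤ min (d 0) (c 2) - N) ∧
      (N ≤ β ∧ (β : ℤ) ≤ min (c 0) (d 2) - N) ∧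
      (N - c 1 ≤ (β : ℤ) - α ∧ (β : ℤ) - α ≤ d 1 - N) ∧ g = s2Rep ϖ α β}
  | .s1s2 => ∅
  | .s2s1 => ∅
  | .w0 => ∅

end Ring

end BranchGL3

open BranchGL3

/-!
By Mackey's criterion (`mem_supportingCosets_iff`), the double coset of `k` supports an element of
`ℋ(χ_c, χ_d)` if and only if `χ_c(g) = χ_d(h)` for all `g ∈ C_c` and `h ∈ C_d` with `g k = k h`; such
a `k` is called `Admissible`. The theorem then splits into three parts.

*Which representatives are admissible.* For necessity, every inequality in the description of `S^w`
comes with an explicit family of stabilizing pairs `(g, h)`. If the inequality fails, the pairs force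
`χ₂`, `χ₃` or `χ₂ χ₃⁻¹` to be trivial on a group `1 + 𝔭ᵐ` with `m` below its conductor. For
sufficiency, one writes out the nine entries of `g k = k h`; under the stated inequalities, they give
the congruences between the diagonal entries of `g` and `h` that make the character values agree
(`admissible_t_iff`, `admissible_s1_iff`, `admissible_s2_iff`). In the cells of `s₁s₂`, `s₂s₁` and
`w₀`, diagonal stabilizing pairs move `χ₃` to a place where it is not matched, so nothing is
admissible.

*The representatives cover.* The Bruhat decomposition modulo `𝔭` brings every matrix to one of six
shapes with few parameters. Elementary matrices of `C_c` and `C_d` change these parameters, and a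
descent on the valuations (`exists_rel_lt`, `exists_rel_of_moves`) stops exactly when the exponents
satisfy the inequalities that define `R^w`. For `t_{a,x}`, the remaining unit `x` can be changed by the
moves belonging to the terms of the minimum `a(c,d)`, which makes equivalent units give the same
double coset (`rel_of_sameParam`). If `c₁ = 0` or `d₁ = 0`, the group contains the reflection `s₁`, and
the cell of `s₁` merges with that of `1`, and the cell of `s₂` with one that supports nothing.

*The representatives are distinct.* For suitable `n`, divisibility by `ϖ ^ n` of the entries `21`,
`32`, `31` of `k`, and of the entry `31` of `k⁻¹`, is an invariant of the double coset. This separates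
the cells and recovers the exponents. The class of `x` is recovered from the equations `g t = t' h`,
as the diagonal entries of `g` and `h` are congruent modulo the level (`SameCoset.sameParam`).

The only property of the ring of integers that is used, besides being a discrete valuation ring, is
that `2` is a unit.
-/

set_option linter.unusedSectionVars false

namespace BranchGL3

variable {O : Type*} [CommRing O]

/-! ### The groups `C_c` and their double cosets -/

/-- The equations `ϖ^{cᵢ} ∣ gᵢⱼ` that cut out `C_c`, for a matrix and a triple of exponents in `ℕ`. -/
def InC (ϖ : O) (c : Fin 3 → ℕ) (g : Matrix (Fin 3) (Fin 3) O) : Prop :=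
  ϖ ^ c 0 ∣ g 1 0 ∧ ϖ ^ c 1 ∣ g 2 1 ∧ ϖ ^ c 2 ∣ g 2 0

/-- The inequalities defining the poset `𝒯`, for exponents in `ℕ`. -/
def InT (c : Fin 3 → ℕ) : Prop := c 0 ≤ c 2 ∧ c 1 ≤ c 2 ∧ c 2 ≤ c 0 + c 1

/-- Two matrices are `Rel`-related if they lie in the same double coset of `C_c` and `C_d`. -/
def Rel (ϖ : O) (c d : Fin 3 → ℕ) (K K' : Matrix (Fin 3) (Fin 3) O) : Prop :=
  ∃ G H : Matrix (Fin 3) (Fin 3) O, IsUnit G.det ∧ IsUnit H.det ∧ InC ϖ c G ∧ InC ϖ d H ∧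
    G * K = K' * H

theorem mat3_ext {a b c d e f g h i a' b' c' d' e' f' g' h' i' : O}
    (h₁ : a = a') (h₂ : b = b') (h₃ : c = c') (h₄ : d = d') (h₅ : e = e') (h₆ : f = f')
    (h₇ : g = g') (h₈ : h = h') (h₉ : i = i') :
    !![a, b, c; d, e, f; g, h, i] = !![a', b', c'; d', e', f'; g', h', i'] := by
  subst_vars; rfl

theorem det_lit (a b c d e f g h i : O) :
    (!![a, b, c; d, e, f; g, h, i]).det =
      a * e * i - a * f * h - b * d * i + b * f * g + c * d * h - c * e * g := by
  simp [Matrix.det_fin_three]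

theorem InC.mul {ϖ : O} {c : Fin 3 → ℕ} (hc : InT c) {g h : Matrix (Fin 3) (Fin 3) O}
    (hg : InC ϖ c g) (hh : InC ϖ c h) : InC ϖ c (g * h) := by
  obtain ⟨g1, g2, g3⟩ := hg
  obtain ⟨h1, h2, h3⟩ := hh
  obtain ⟨c1, c2, c3⟩ := hc
  have e1 := pow_dvd_pow ϖ c1
  have e2 := pow_dvd_pow ϖ c2
  have e3 : ϖ ^ c 2 ∣ ϖ ^ c 1 * ϖ ^ c 0 := by
    rw [← pow_add]; exact pow_dvd_pow ϖ (by omega)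
  refine ⟨?_, ?_, ?_⟩ <;> simp only [Matrix.mul_apply, Fin.sum_univ_three]
  · exact dvd_add (dvd_add (g1.mul_right _) (h1.mul_left _)) ((e1.trans h3).mul_left _)
  · exact dvd_add (dvd_add ((e2.trans g3).mul_right _) (g2.mul_right _)) (h2.mul_left _)
  · exact dvd_add (dvd_add (g3.mul_right _) (e3.trans (mul_dvd_mul g2 h1))) (h3.mul_left _)

theorem InC.one (ϖ : O) (c : Fin 3 → ℕ) : InC ϖ c 1 := by
  simp [InC]

theorem Rel.refl (ϖ : O) (c d : Fin 3 → ℕ) (K : Matrix (Fin 3) (Fin 3) O) : Rel ϖ c d K K :=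
  ⟨1, 1, by simp, by simp, InC.one _ _, InC.one _ _, by simp⟩

theorem Rel.trans {ϖ : O} {c d : Fin 3 → ℕ} (hc : InT c) (hd : InT d)
    {K K' K'' : Matrix (Fin 3) (Fin 3) O} (h : Rel ϖ c d K K') (h' : Rel ϖ c d K' K'') :
    Rel ϖ c d K K'' := by
  obtain ⟨G, H, uG, uH, iG, iH, e⟩ := h
  obtain ⟨G', H', uG', uH', iG', iH', e'⟩ := h'
  refine ⟨G' * G, H' * H, ?_, ?_, iG'.mul hc iG, iH'.mul hd iH, ?_⟩
  · rw [Matrix.det_mul]; exact uG'.mul uG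
  · rw [Matrix.det_mul]; exact uH'.mul uH
  · rw [mul_assoc, e, ← mul_assoc, e', mul_assoc]

variable [IsDomain O] [IsDiscreteValuationRing O] {ϖ : O}

theorem mem_max_pow_iff (hϖ : Irreducible ϖ) {n : ℕ} {x : O} :
    x ∈ IsLocalRing.maximalIdeal O ^ n ↔ ϖ ^ n ∣ x := by
  rw [hϖ.maximalIdeal_eq, Ideal.span_singleton_pow, Ideal.mem_span_singleton]

theorem mem_groupC_iff (hϖ : Irreducible ϖ) {c : Fin 3 → ℕ} {g : GL (Fin 3) O} :
    g ∈ groupC O (fun i => (c i : ℤ)) ↔ InC ϖ c g.val := by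
  simp only [groupC, Set.mem_ofPred_eq, mem_max_pow_iff hϖ, Int.toNat_natCast]
  rfl

theorem InC.inv {c : Fin 3 → ℕ} (hc : InT c) {g : GL (Fin 3) O}
    (hg : InC ϖ c g.val) : InC ϖ c (g⁻¹ : GL (Fin 3) O).val := by
  obtain ⟨g1, g2, g3⟩ := hg
  obtain ⟨c1, c2, c3⟩ := hc
  have e1 := pow_dvd_pow ϖ c1
  have e2 := pow_dvd_pow ϖ c2
  have e3 : ϖ ^ c 2 ∣ ϖ ^ c 0 * ϖ ^ c 1 := by
    rw [← pow_add]; exact pow_dvd_pow ϖ (by omega)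
  have hadj : (g⁻¹ : GL (Fin 3) O).val = Ring.inverse g.val.det • g.val.adjugate := by
    rw [Matrix.coe_units_inv, Matrix.inv_def]
  rw [hadj]
  refine ⟨?_, ?_, ?_⟩ <;>
    simp only [Matrix.smul_apply, smul_eq_mul, Matrix.adjugate_fin_three, Matrix.of_apply,
      Matrix.cons_val] <;> refine Dvd.dvd.mul_left ?_ _
  · exact dvd_add ((dvd_neg.2 (g1.mul_right _))) ((e1.trans g3).mul_left _)
  · exact dvd_add ((dvd_neg.2 (g2.mul_left _))) ((e2.trans g3).mul_left _)
  · exact dvd_sub (e3.trans (mul_dvd_mul g1 g2)) (g3.mul_left _)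

/-- `C_c` as a subgroup of `GL₃(O)`, for `c ∈ 𝒯`. -/
def subgroupC (hϖ : Irreducible ϖ) (c : Fin 3 → ℕ) (hc : InT c) : Subgroup (GL (Fin 3) O) where
  carrier := groupC O (fun i => (c i : ℤ))
  mul_mem' := by
    intro g h hg hh
    rw [mem_groupC_iff hϖ] at *
    exact hg.mul hc hh
  one_mem' := (mem_groupC_iff hϖ).2 (InC.one ϖ c)
  inv_mem' := by
    intro g hg
    rw [mem_groupC_iff hϖ] at *
    exact hg.inv hc

theorem coe_subgroupC (hϖ : Irreducible ϖ) (c : Fin 3 → ℕ) (hc : InT c) :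
    (subgroupC hϖ c hc : Set (GL (Fin 3) O)) = groupC O (fun i => (c i : ℤ)) := rfl

theorem doubleCoset_eq_of_rel (hϖ : Irreducible ϖ) {c d : Fin 3 → ℕ} (hc : InT c) (hd : InT d)
    {k k' : GL (Fin 3) O} (h : Rel ϖ c d k.val k'.val) :
    DoubleCoset.doubleCoset k (groupC O (fun i => (c i : ℤ))) (groupC O (fun i => (d i : ℤ))) =
    DoubleCoset.doubleCoset k' (groupC O (fun i => (c i : ℤ))) (groupC O (fun i => (d i : ℤ))) := by
  obtain ⟨G, H, uG, uH, iG, iH, e⟩ := h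
  rw [← coe_subgroupC hϖ c hc, ← coe_subgroupC hϖ d hd]
  symm
  apply DoubleCoset.doubleCoset_eq_of_mem
  rw [DoubleCoset.mem_doubleCoset]
  have hG : Matrix.GeneralLinearGroup.mk'' G uG ∈ subgroupC hϖ c hc := (mem_groupC_iff hϖ).2 iG
  have hH : Matrix.GeneralLinearGroup.mk'' H uH ∈ subgroupC hϖ d hd := (mem_groupC_iff hϖ).2 iH
  refine ⟨_, hG, _, inv_mem hH, ?_⟩
  rw [eq_mul_inv_iff_mul_eq]
  exact Units.ext e.symm

theorem rel_of_doubleCoset_eq (hϖ : Irreducible ϖ) {c d : Fin 3 → ℕ} (hc : InT c) (hd : InT d)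
    {k k' : GL (Fin 3) O} (h :
    DoubleCoset.doubleCoset k (groupC O (fun i => (c i : ℤ))) (groupC O (fun i => (d i : ℤ))) =
    DoubleCoset.doubleCoset k' (groupC O (fun i => (c i : ℤ))) (groupC O (fun i => (d i : ℤ)))) :
    ∃ g h : GL (Fin 3) O, InC ϖ c g.val ∧ InC ϖ d h.val ∧ g * k = k' * h := by
  rw [← coe_subgroupC hϖ c hc, ← coe_subgroupC hϖ d hd] at h
  have := DoubleCoset.mem_doubleCoset_self (subgroupC hϖ c hc) (subgroupC hϖ d hd) k'
  rw [← h, DoubleCoset.mem_doubleCoset] at this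
  obtain ⟨x, hx, y, hy, e⟩ := this
  refine ⟨x, y⁻¹, (mem_groupC_iff hϖ).1 hx, (mem_groupC_iff hϖ).1 (inv_mem hy), ?_⟩
  rw [e]; group

/-! ### Units and powers of the uniformizer -/

theorem isUnit_iff_not_dvd (hϖ : Irreducible ϖ) {x : O} : IsUnit x ↔ ¬ ϖ ∣ x := by
  rw [← Ideal.mem_span_singleton, ← hϖ.maximalIdeal_eq, IsLocalRing.mem_maximalIdeal,
    mem_nonunits_iff, not_not]

theorem IsUnit.add_dvd (hϖ : Irreducible ϖ) {x y : O} (hx : IsUnit x) (hy : ϖ ∣ y) :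
    IsUnit (x + y) := by
  rw [isUnit_iff_not_dvd hϖ] at *
  exact fun h => hx ((dvd_add_left hy).1 h)

theorem IsUnit.sub_dvd (hϖ : Irreducible ϖ) {x y : O} (hx : IsUnit x) (hy : ϖ ∣ y) :
    IsUnit (x - y) := by
  rw [isUnit_iff_not_dvd hϖ] at *
  exact fun h => hx ((dvd_sub_left hy).1 h)

theorem isUnit_one_add (hϖ : Irreducible ϖ) {y : O} (hy : ϖ ∣ y) : IsUnit (1 + y) :=
  IsUnit.add_dvd hϖ isUnit_one hy

theorem isUnit_one_sub (hϖ : Irreducible ϖ) {y : O} (hy : ϖ ∣ y) : IsUnit (1 - y) :=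
  IsUnit.sub_dvd hϖ isUnit_one hy

theorem pow_dvd_cancel (hϖ : Irreducible ϖ) {a b : ℕ} {x : O} (h : ϖ ^ (a + b) ∣ ϖ ^ a * x) :
    ϖ ^ b ∣ x := by
  rw [pow_add] at h
  exact (mul_dvd_mul_iff_left (pow_ne_zero _ hϖ.ne_zero)).1 h

theorem dvd_of_dvd_mul_unit {n x u : O} (hu : IsUnit u) (h : n ∣ x * u) : n ∣ x :=
  (hu.dvd_mul_right).1 h

/-! ### Characters -/

theorem evalChar_coe (χ : Oˣ →* ℂˣ) (u : Oˣ) : evalChar χ (u : O) = χ u := by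
  have h : IsUnit (u : O) := u.isUnit
  have e : h.unit = u := Units.ext rfl
  rw [evalChar, dif_pos h, e]

theorem evalChar_one (χ : Oˣ →* ℂˣ) : evalChar χ (1 : O) = 1 := by
  simpa using evalChar_coe χ 1

theorem evalChar_ne_zero (χ : Oˣ →* ℂˣ) (x : O) : evalChar χ x ≠ 0 := by
  unfold evalChar
  split_ifs <;> simp

theorem evalChar_mul (χ : Oˣ →* ℂˣ) {x y : O} (hx : IsUnit x) (hy : IsUnit y) :
    evalChar χ (x * y) = evalChar χ x * evalChar χ y := by
  obtain ⟨u, rfl⟩ := hx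
  obtain ⟨v, rfl⟩ := hy
  rw [← Units.val_mul, evalChar_coe, evalChar_coe, evalChar_coe, map_mul, Units.val_mul]

theorem HasConductor.eq_one (hϖ : Irreducible ϖ) {χ : Oˣ →* ℂˣ} {m : ℕ} (h : HasConductor χ m)
    {u : Oˣ} (hu : ϖ ^ m ∣ (u : O) - 1) : χ u = 1 :=
  h.1 u ((mem_max_pow_iff hϖ).2 hu)

theorem HasConductor.le_of_forall (hϖ : Irreducible ϖ) {χ : Oˣ →* ℂˣ} {m : ℕ}
    (h : HasConductor χ m) {n : ℕ} (hn : ∀ u : Oˣ, ϖ ^ n ∣ (u : O) - 1 → χ u = 1) : m ≤ n :=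
  h.2 fun u hu => hn u ((mem_max_pow_iff hϖ).1 hu)

/-- The values at `1 + s` for `s ∈ 𝔭ⁿ` detect the conductor. -/
theorem HasConductor.le_of_eval (hϖ : Irreducible ϖ) {χ : Oˣ →* ℂˣ} {m : ℕ}
    (h : HasConductor χ m) {n : ℕ}
    (hn : ∀ s : O, ϖ ^ n ∣ s → IsUnit (1 + s) → evalChar χ (1 + s) = 1) : m ≤ n := by
  refine h.le_of_forall hϖ fun u hu => ?_
  have := hn ((u : O) - 1) hu (by simp)
  rw [add_sub_cancel, evalChar_coe] at this
  exact Units.ext this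

theorem evalChar_eq_one_of_zero {χ : Oˣ →* ℂˣ} (h : HasConductor χ 0) (x : O) :
    evalChar χ x = 1 := by
  unfold evalChar
  split_ifs with hx
  · rw [h.1 hx.unit (by simp)]; simp
  · rfl

/-- `χ` takes the same value at units that agree modulo the conductor. -/
theorem HasConductor.congr (hϖ : Irreducible ϖ) {χ : Oˣ →* ℂˣ} {m : ℕ} (h : HasConductor χ m)
    {x y : O} (hx : IsUnit x) (hy : IsUnit y) (hxy : ϖ ^ m ∣ x - y) :
    evalChar χ x = evalChar χ y := by
  obtain ⟨u, rfl⟩ := hx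
  obtain ⟨v, rfl⟩ := hy
  have e : χ (u * v⁻¹) = 1 := by
    apply h.eq_one hϖ
    have : ((u * v⁻¹ : Oˣ) : O) - 1 = ((u : O) - v) * ((v⁻¹ : Oˣ) : O) := by
      rw [sub_mul, Units.mul_inv, Units.val_mul]
    rw [this]
    exact hxy.mul_right _
  rw [map_mul, map_inv, mul_inv_eq_one] at e
  rw [evalChar_coe, evalChar_coe, e]

theorem evalChar_mul_inv {χ₂ χ₃ : Oˣ →* ℂˣ} {x : O} (hx : IsUnit x) :
    evalChar (χ₂ * χ₃⁻¹) x = evalChar χ₂ x * (evalChar χ₃ x)⁻¹ := by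
  obtain ⟨u, rfl⟩ := hx
  simp [evalChar_coe]

/-! ### Diagonal entries of elements of `C_c` -/

theorem det_expand (g : Matrix (Fin 3) (Fin 3) O) : g.det =
    g 2 2 * (g 0 0 * g 1 1 - g 0 1 * g 1 0) + (g 2 1 * (g 0 2 * g 1 0 - g 0 0 * g 1 2)
      + g 2 0 * (g 0 1 * g 1 2 - g 0 2 * g 1 1)) := by
  rw [Matrix.det_fin_three]; ring

theorem dvd_of_pow_dvd_pos {n : ℕ} (hn : 1 ≤ n) {x : O} (h : ϖ ^ n ∣ x) : ϖ ∣ x :=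
  (dvd_pow_self ϖ (by omega)).trans h

theorem isUnit_corner (hϖ : Irreducible ϖ) {c : Fin 3 → ℕ} (h1 : 1 ≤ c 1) (h2 : 1 ≤ c 2)
    {g : Matrix (Fin 3) (Fin 3) O} (hg : InC ϖ c g) (hu : IsUnit g.det) : IsUnit (g 2 2) := by
  rw [det_expand] at hu
  have h : ϖ ∣ (g 2 1 * (g 0 2 * g 1 0 - g 0 0 * g 1 2)
      + g 2 0 * (g 0 1 * g 1 2 - g 0 2 * g 1 1)) :=
    dvd_add ((dvd_of_pow_dvd_pos h1 hg.2.1).mul_right _)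
      ((dvd_of_pow_dvd_pos h2 hg.2.2).mul_right _)
  have := IsUnit.sub_dvd hϖ hu h
  rw [add_sub_cancel_right] at this
  exact isUnit_of_mul_isUnit_left this

theorem isUnit_diag (hϖ : Irreducible ϖ) {c : Fin 3 → ℕ} (h0 : 1 ≤ c 0) (h1 : 1 ≤ c 1)
    (h2 : 1 ≤ c 2) {g : Matrix (Fin 3) (Fin 3) O} (hg : InC ϖ c g) (hu : IsUnit g.det) :
    IsUnit (g 0 0) ∧ IsUnit (g 1 1) ∧ IsUnit (g 2 2) := by
  refine ⟨?_, ?_, isUnit_corner hϖ h1 h2 hg hu⟩ <;>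
  · have e : g.det = g 0 0 * g 1 1 * g 2 2 + (g 1 0 * (- g 0 1 * g 2 2) +
        (g 2 1 * (g 0 2 * g 1 0 - g 0 0 * g 1 2)
        + g 2 0 * (g 0 1 * g 1 2 - g 0 2 * g 1 1))) := by
      rw [Matrix.det_fin_three]; ring
    rw [e] at hu
    have h := IsUnit.sub_dvd hϖ hu (dvd_add ((dvd_of_pow_dvd_pos h0 hg.1).mul_right (- g 0 1 * g 2 2))
      (dvd_add ((dvd_of_pow_dvd_pos h1 hg.2.1).mul_right (g 0 2 * g 1 0 - g 0 0 * g 1 2))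
      ((dvd_of_pow_dvd_pos h2 hg.2.2).mul_right (g 0 1 * g 1 2 - g 0 2 * g 1 1))))
    rw [add_sub_cancel_right] at h
    have h' := isUnit_of_mul_isUnit_left h
    first
    | exact isUnit_of_mul_isUnit_left h'
    | exact isUnit_of_mul_isUnit_right h'

/-! ### The characters of `C_c` and the supporting double cosets -/

/-- The conditions on `c` that make `χ_c` a character of `C_c`. -/
structure Good (M N : ℕ) (c : Fin 3 → ℕ) : Prop where
  inT : InT c
  one_le : 1 ≤ N
  le0 : M ≤ c 0
  le1 : N ≤ c 1

theorem chi_mul (hϖ : Irreducible ϖ) {χ₂ χ₃ : Oˣ →* ℂˣ} {M N : ℕ} (hMN : M ≤ N)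
    (h₂ : HasConductor χ₂ M) (h₃ : HasConductor χ₃ N) {c : Fin 3 → ℕ} (hc : Good M N c)
    {g h : GL (Fin 3) O} (hg : InC ϖ c g.val) (hh : InC ϖ c h.val) :
    chi χ₂ χ₃ (g * h) = chi χ₂ χ₃ g * chi χ₂ χ₃ h := by
  obtain ⟨⟨t0, t1, t2⟩, hN, hM0, hN1⟩ := hc
  have ug : IsUnit g.val.det := (Matrix.isUnit_iff_isUnit_det _).1 g.isUnit
  have uh : IsUnit h.val.det := (Matrix.isUnit_iff_isUnit_det _).1 h.isUnit
  have ugh : IsUnit (g * h).val.det := (Matrix.isUnit_iff_isUnit_det _).1 (g * h).isUnit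
  have hgh : InC ϖ c (g * h).val := InC.mul ⟨t0, t1, t2⟩ hg hh
  have e3 : evalChar χ₃ ((g * h) 2 2) = evalChar χ₃ (g 2 2) * evalChar χ₃ (h 2 2) := by
    have u1 := isUnit_corner hϖ (by omega) (by omega) hg ug
    have u2 := isUnit_corner hϖ (by omega) (by omega) hh uh
    rw [← evalChar_mul χ₃ u1 u2]
    refine h₃.congr hϖ (isUnit_corner hϖ (by omega) (by omega) hgh ugh) (u1.mul u2) ?_
    rw [show (g * h) 2 2 - g.val 2 2 * h.val 2 2 = g.val 2 0 * h.val 0 2 + g.val 2 1 * h.val 1 2 by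
      rw [Units.val_mul, Matrix.mul_apply, Fin.sum_univ_three]; ring]
    exact dvd_add (((pow_dvd_pow ϖ (by omega)).trans hg.2.2).mul_right _)
      (((pow_dvd_pow ϖ hN1).trans hg.2.1).mul_right _)
  have e2 : evalChar χ₂ ((g * h) 1 1) = evalChar χ₂ (g 1 1) * evalChar χ₂ (h 1 1) := by
    rcases Nat.eq_zero_or_pos M with rfl | hM
    · simp only [evalChar_eq_one_of_zero h₂, mul_one]
    have u1 := (isUnit_diag hϖ (by omega) (by omega) (by omega) hg ug).2.1
    have u2 := (isUnit_diag hϖ (by omega) (by omega) (by omega) hh uh).2.1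
    rw [← evalChar_mul χ₂ u1 u2]
    refine h₂.congr hϖ (isUnit_diag hϖ (by omega) (by omega) (by omega) hgh ugh).2.1
      (u1.mul u2) ?_
    rw [show (g * h) 1 1 - g.val 1 1 * h.val 1 1 = g.val 1 0 * h.val 0 1 + g.val 1 2 * h.val 2 1 by
      rw [Units.val_mul, Matrix.mul_apply, Fin.sum_univ_three]; ring]
    exact dvd_add (((pow_dvd_pow ϖ hM0).trans hg.1).mul_right _)
      (((pow_dvd_pow ϖ (hMN.trans hN1)).trans hh.2.1).mul_left _)
  unfold chi
  rw [e2, e3]; ring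

theorem chi_ne_zero (χ₂ χ₃ : Oˣ →* ℂˣ) (g : GL (Fin 3) O) : chi χ₂ χ₃ g ≠ 0 :=
  mul_ne_zero (evalChar_ne_zero _ _) (evalChar_ne_zero _ _)

/-- The characters `χ_c` and `χ_d` are compatible on the stabilizer of `k` in `C_c × C_d`. -/
def Admissible (χ₂ χ₃ : Oˣ →* ℂˣ) (ϖ : O) (c d : Fin 3 → ℕ) (k : GL (Fin 3) O) : Prop :=
  ∀ g h : GL (Fin 3) O, InC ϖ c g.val → InC ϖ d h.val → g * k = k * h →
    chi χ₂ χ₃ g = chi χ₂ χ₃ h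

/-- Mackey's criterion: a double coset supports an element of `ℋ(χ_c, χ_d)` if and only if the two
characters agree on the stabilizer of a representative. -/
theorem mem_supportingCosets_iff (hϖ : Irreducible ϖ) {χ₂ χ₃ : Oˣ →* ℂˣ} {M N : ℕ} (hMN : M ≤ N)
    (h₂ : HasConductor χ₂ M) (h₃ : HasConductor χ₃ N) {c d : Fin 3 → ℕ} (hc : Good M N c)
    (hd : Good M N d) (k : GL (Fin 3) O) :
    DoubleCoset.doubleCoset k (groupC O (fun i => (c i : ℤ))) (groupC O (fun i => (d i : ℤ))) ∈
      supportingCosets χ₂ χ₃ (fun i => (c i : ℤ)) (fun i => (d i : ℤ)) ↔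
    Admissible χ₂ χ₃ ϖ c d k := by
  classical
  constructor
  · rintro ⟨-, f, hf, k', hk', hne⟩ g h hg hh e
    obtain ⟨x, hx, y, hy, rfl⟩ := DoubleCoset.mem_doubleCoset.1 hk'
    have hfk : f k ≠ 0 := by
      intro h0
      exact hne (by rw [hf x hx k y hy, h0]; simp)
    have one_mem : ∀ c : Fin 3 → ℕ, (1 : GL (Fin 3) O) ∈ groupC O (fun i => (c i : ℤ)) :=
      fun c => (mem_groupC_iff hϖ).2 (InC.one ϖ c)
    have chi_one : chi χ₂ χ₃ (1 : GL (Fin 3) O) = 1 := by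
      simp [chi, evalChar_one]
    have e1 := hf g ((mem_groupC_iff hϖ).2 hg) k 1 (one_mem d)
    have e2 := hf 1 (one_mem c) k h ((mem_groupC_iff hϖ).2 hh)
    rw [mul_one, chi_one, mul_one] at e1
    rw [one_mul, chi_one, one_mul, ← e, e1, mul_comm] at e2
    exact mul_left_cancel₀ hfk e2
  · intro hk
    refine ⟨⟨k, rfl⟩, ?_⟩
    set C := groupC O (fun i => (c i : ℤ)) with hC
    set D := groupC O (fun i => (d i : ℤ)) with hD
    -- the function supported on the double coset with `f (x k y) = χ_c(x) χ_d(y)`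
    let P : GL (Fin 3) O → ℂ → Prop := fun z v =>
      ∃ x ∈ C, ∃ y ∈ D, z = x * k * y ∧ v = chi χ₂ χ₃ x * chi χ₂ χ₃ y
    have huniq : ∀ z v v', P z v → P z v' → v = v' := by
      rintro z v v' ⟨x, hx, y, hy, rfl, rfl⟩ ⟨x', hx', y', hy', e, rfl⟩
      rw [hC, mem_groupC_iff hϖ] at hx hx'
      rw [hD, mem_groupC_iff hϖ] at hy hy'
      have hg : InC ϖ c (x'⁻¹ * x).val := (hx'.inv hc.inT).mul hc.inT hx
      have hh : InC ϖ d (y' * y⁻¹).val := hy'.mul hd.inT (hy.inv hd.inT)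
      have key := hk (x'⁻¹ * x) (y' * y⁻¹) hg hh (by
        rw [mul_assoc, inv_mul_eq_iff_eq_mul, ← mul_assoc, ← mul_assoc, ← e]; group)
      have a1 := chi_mul hϖ hMN h₂ h₃ hc hx' hg
      have a2 := chi_mul hϖ hMN h₂ h₃ hd hh hy
      rw [mul_inv_cancel_left] at a1
      rw [inv_mul_cancel_right] at a2
      rw [a1, a2, key]; ring
    let f : GL (Fin 3) O → ℂ := fun z => if h : ∃ v, P z v then h.choose else 0
    have hfP : ∀ z v, P z v → f z = v := by
      intro z v hv
      have h : ∃ v, P z v := ⟨v, hv⟩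
      simp only [f, dif_pos h]
      exact huniq z _ _ h.choose_spec hv
    have hP : ∀ g ∈ C, ∀ z, ∀ h ∈ D, ∀ v, P z v →
        P (g * z * h) (chi χ₂ χ₃ g * v * chi χ₂ χ₃ h) := by
      rintro g hg z h hh v ⟨x, hx, y, hy, rfl, rfl⟩
      refine ⟨g * x, (subgroupC hϖ c hc.inT).mul_mem hg hx, y * h,
        (subgroupC hϖ d hd.inT).mul_mem hy hh, by group, ?_⟩
      rw [hC, mem_groupC_iff hϖ] at hg hx
      rw [hD, mem_groupC_iff hϖ] at hh hy
      rw [chi_mul hϖ hMN h₂ h₃ hc hg hx, chi_mul hϖ hMN h₂ h₃ hd hy hh]; ring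
    have one_C : (1 : GL (Fin 3) O) ∈ C := (mem_groupC_iff hϖ).2 (InC.one ϖ c)
    have one_D : (1 : GL (Fin 3) O) ∈ D := (mem_groupC_iff hϖ).2 (InC.one ϖ d)
    have hPk : P k (chi χ₂ χ₃ (1 : GL (Fin 3) O) * chi χ₂ χ₃ (1 : GL (Fin 3) O)) :=
      ⟨1, one_C, 1, one_D, by simp, rfl⟩
    refine ⟨f, ?_, k, DoubleCoset.mem_doubleCoset.2 ⟨1, one_C, 1, one_D, by simp⟩, ?_⟩
    · intro g hg z h hh
      by_cases hz : ∃ v, P z v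
      · obtain ⟨v, hv⟩ := hz
        rw [hfP z v hv, hfP _ _ (hP g hg z h hh v hv)]
      · have hz' : ¬ ∃ v, P (g * z * h) v := by
          rintro ⟨v, hv⟩
          apply hz
          have := hP g⁻¹ ((subgroupC hϖ c hc.inT).inv_mem hg) _ h⁻¹
            ((subgroupC hϖ d hd.inT).inv_mem hh) v hv
          rw [show g⁻¹ * (g * z * h) * h⁻¹ = z by group] at this
          exact ⟨_, this⟩
        simp only [f, dif_neg hz, dif_neg hz']
        simp
    · rw [hfP _ _ hPk]
      exact mul_ne_zero (chi_ne_zero _ _ _) (chi_ne_zero _ _ _)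

/-! ### Stabilizers and explicit matrices -/

theorem inC_lit {c : Fin 3 → ℕ} {x₁ x₂ x₃ x₄ x₅ x₆ x₇ x₈ x₉ : O} (h₄ : ϖ ^ c 0 ∣ x₄)
    (h₈ : ϖ ^ c 1 ∣ x₈) (h₇ : ϖ ^ c 2 ∣ x₇) :
    InC ϖ c !![x₁, x₂, x₃; x₄, x₅, x₆; x₇, x₈, x₉] := ⟨h₄, h₈, h₇⟩

theorem entries_of_mul_eq {G K K' H : Matrix (Fin 3) (Fin 3) O} (e : G * K = K' * H)
    (i j : Fin 3) : G i 0 * K 0 j + G i 1 * K 1 j + G i 2 * K 2 j =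
      K' i 0 * H 0 j + K' i 1 * H 1 j + K' i 2 * H 2 j := by
  have := congrFun (congrFun e i) j
  simpa only [Matrix.mul_apply, Fin.sum_univ_three] using this

/-- Admissibility tested on a pair of matrices; `det H` is a unit because `det G` is one. -/
theorem Admissible.eval_eq {χ₂ χ₃ : Oˣ →* ℂˣ} {c d : Fin 3 → ℕ} {k : GL (Fin 3) O}
    (hk : Admissible χ₂ χ₃ ϖ c d k) {K G H : Matrix (Fin 3) (Fin 3) O} (hK : k.val = K)
    (hG : IsUnit G.det) (hGc : InC ϖ c G) (hHd : InC ϖ d H) (e : G * K = K * H) :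
    evalChar χ₂ (G 1 1) * evalChar χ₃ (G 2 2) = evalChar χ₂ (H 1 1) * evalChar χ₃ (H 2 2) := by
  subst hK
  have uk : IsUnit k.val.det := (Matrix.isUnit_iff_isUnit_det _).1 k.isUnit
  have hH : IsUnit H.det := by
    have := congrArg Matrix.det e
    rw [Matrix.det_mul, Matrix.det_mul] at this
    have h2 := hG.mul uk
    rw [this] at h2
    exact isUnit_of_mul_isUnit_right h2
  exact hk (Matrix.GeneralLinearGroup.mk'' G hG) (Matrix.GeneralLinearGroup.mk'' H hH) hGc hHd
    (Units.ext e)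

theorem pow_dvd_of_le {m n : ℕ} {x : O} (h : ϖ ^ m ∣ x) (hn : n ≤ m) : ϖ ^ n ∣ x :=
  (pow_dvd_pow ϖ hn).trans h

theorem pow_dvd_pow_mul {m n a : ℕ} {x : O} (h : ϖ ^ m ∣ x) (hn : n ≤ a + m) :
    ϖ ^ n ∣ ϖ ^ a * x :=
  (pow_dvd_pow ϖ hn).trans (pow_add ϖ a m ▸ mul_dvd_mul_left _ h)

theorem pow_dvd_pow_mul_left {n a : ℕ} {x : O} (hn : n ≤ a) : ϖ ^ n ∣ ϖ ^ a * x :=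
  (pow_dvd_pow ϖ hn).mul_right x

/-! ### The representatives attached to the reflections -/

/-- Representatives of the matrices that reduce to the Bruhat cell of `s₁` modulo `𝔭`, when `Z` and
`Y` lie in `𝔭`. The elements `s₁^{(α,β)}` are the case of powers of `ϖ`. -/
noncomputable def s1Form (Z Y : O) : GL (Fin 3) O :=
  Matrix.GeneralLinearGroup.mk'' !![0, 1, 0; 1, 0, 0; Z, Y, 1] (by simp [Matrix.det_fin_three])

theorem val_s1Form (Z Y : O) : (s1Form Z Y).val = !![0, 1, 0; 1, 0, 0; Z, Y, 1] := rfl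

theorem s1Rep_eq (ϖ : O) (α β : ℕ) : s1Rep ϖ α β = s1Form (ϖ ^ β) (ϖ ^ α) := rfl

/-- Representatives of the matrices that reduce to the Bruhat cell of `s₂` modulo `𝔭`, when `Z` and
`Y` lie in `𝔭`. The elements `s₂^{(α,β)}` are the case of powers of `ϖ`. -/
noncomputable def s2Form (Z Y : O) : GL (Fin 3) O :=
  Matrix.GeneralLinearGroup.mk'' !![1, 0, 0; Z, 0, 1; Y, 1, 0] (by simp [Matrix.det_fin_three])

theorem val_s2Form (Z Y : O) : (s2Form Z Y).val = !![1, 0, 0; Z, 0, 1; Y, 1, 0] := rfl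

theorem s2Rep_eq (ϖ : O) (α β : ℕ) : s2Rep ϖ α β = s2Form (ϖ ^ β) (ϖ ^ α) := rfl

/-- Each inequality is forced by one explicit family of stabilizing pairs. Conversely, the stabilizer
equations divided by `ϖ ^ α` and `ϖ ^ β` give the congruences of diagonal entries that the
conductors ask for. -/
theorem admissible_s1_iff (hϖ : Irreducible ϖ) {χ₂ χ₃ : Oˣ →* ℂˣ} {M N : ℕ} (hMN : M ≤ N)
    (h₂ : HasConductor χ₂ M) (h₃ : HasConductor χ₃ N) {c d : Fin 3 → ℕ} (hc : Good M N c)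
    (hd : Good M N d) (hc0 : 1 ≤ c 0) (hd0 : 1 ≤ d 0) {α β : ℕ}
    (hαd : α ≤ d 1) (hαc : α ≤ c 2) (hβc : β ≤ c 1) (hβd : β ≤ d 2) (hαβ : α ≤ β + c 0)
    (hβα : β ≤ α + d 0) :
    Admissible χ₂ χ₃ ϖ c d (s1Rep ϖ α β) ↔
      (N ≤ α ∧ N ≤ β) ∧ (α + M ≤ d 1 ∧ α + M ≤ c 2) ∧ (β + M ≤ c 1 ∧ β + M ≤ d 2) ∧
        (α + M ≤ β + c 0 ∧ β + M ≤ α + d 0) := by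
  obtain ⟨⟨c1, c2, c3⟩, hN, hcM, hcN⟩ := hc
  obtain ⟨⟨d1, d2, d3⟩, -, hdM, hdN⟩ := hd
  rw [s1Rep_eq]
  constructor
  · intro hk
    -- a family of stabilizers on which only the values of `χ₂` differ, at `1` and `1 + s`
    have key₂ : ∀ e : ℕ, (∀ s : O, ϖ ^ e ∣ s → IsUnit (1 + s) →
        ∃ G H : Matrix (Fin 3) (Fin 3) O, IsUnit G.det ∧ InC ϖ c G ∧ InC ϖ d H ∧
          G * !![0, 1, 0; 1, 0, 0; ϖ ^ β, ϖ ^ α, 1] = !![0, 1, 0; 1, 0, 0; ϖ ^ β, ϖ ^ α, 1] * H ∧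
          G 2 2 = 1 ∧ H 2 2 = 1 ∧ ((G 1 1 = 1 ∧ H 1 1 = 1 + s) ∨ (G 1 1 = 1 + s ∧ H 1 1 = 1))) →
        M ≤ e := by
      intro e he
      refine h₂.le_of_eval hϖ fun s hs hu => ?_
      obtain ⟨G, H, g1, g2, g3, g4, g5, g6, g7⟩ := he s hs hu
      have := hk.eval_eq (val_s1Form _ _) g1 g2 g3 g4
      rcases g7 with ⟨g7, g8⟩ | ⟨g7, g8⟩
      · rw [g5, g6, g7, g8, evalChar_one, evalChar_one, mul_one, mul_one] at this
        exact this.symm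
      · rw [g5, g6, g7, g8, evalChar_one, evalChar_one, mul_one, mul_one] at this
        exact this
    have key₃ : ∀ e : ℕ, (∀ s : O, ϖ ^ e ∣ s → IsUnit (1 + s) →
        ∃ G H : Matrix (Fin 3) (Fin 3) O, IsUnit G.det ∧ InC ϖ c G ∧ InC ϖ d H ∧
          G * !![0, 1, 0; 1, 0, 0; ϖ ^ β, ϖ ^ α, 1] = !![0, 1, 0; 1, 0, 0; ϖ ^ β, ϖ ^ α, 1] * H ∧
          (∃ w, G 1 1 = w ∧ H 1 1 = w) ∧ H 2 2 = 1 + s ∧ G 2 2 = 1) →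
        N ≤ e := by
      intro e he
      refine h₃.le_of_eval hϖ fun s hs hu => ?_
      obtain ⟨G, H, g1, g2, g3, g4, ⟨w, g5, g5'⟩, g6, g7⟩ := he s hs hu
      have := hk.eval_eq (val_s1Form _ _) g1 g2 g3 g4
      rw [g5, g5', g6, g7, evalChar_one] at this
      exact (mul_left_cancel₀ (evalChar_ne_zero _ _) this).symm
    refine ⟨⟨?_, ?_⟩, ⟨?_, ?_⟩, ⟨?_, ?_⟩, ?_, ?_⟩
    · apply key₃
      rintro _ ⟨t, rfl⟩ hu
      refine ⟨!![1 + ϖ ^ α * t, ϖ ^ β * t, -t; 0, 1, 0; 0, 0, 1],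
        !![1, 0, 0; 0, 1, -t; 0, 0, 1 + ϖ ^ α * t], by simpa [det_lit] using hu,
        inC_lit (by simp) (by simp) (by simp), inC_lit (by simp) (by simp) (by simp), ?_,
        ⟨1, rfl, rfl⟩, rfl, rfl⟩
      rw [Matrix.mul_fin_three, Matrix.mul_fin_three]
      apply mat3_ext <;> ring
    · apply key₃
      rintro _ ⟨t, rfl⟩ hu
      refine ⟨!![1 + ϖ ^ β * t, 0, 0; 0, 1 + ϖ ^ β * t, -t; 0, 0, 1],
        !![1, -(ϖ ^ α * t), -t; 0, 1 + ϖ ^ β * t, 0; 0, 0, 1 + ϖ ^ β * t],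
        by simpa [det_lit] using hu,
        inC_lit (by simp) (by simp) (by simp), inC_lit (by simp) (by simp) (by simp), ?_,
        ⟨1 + ϖ ^ β * t, rfl, rfl⟩, rfl, rfl⟩
      rw [Matrix.mul_fin_three, Matrix.mul_fin_three]
      apply mat3_ext <;> ring
    · suffices M ≤ d 1 - α by omega
      apply key₂
      intro s hs hu
      refine ⟨!![1 + s, 0, 0; 0, 1, 0; 0, 0, 1], !![1, 0, 0; 0, 1 + s, 0; 0, -(ϖ ^ α * s), 1],
        by simpa [det_lit] using hu, inC_lit (by simp) (by simp) (by simp),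
        inC_lit (by simp) (dvd_neg.2 (pow_dvd_pow_mul hs (by omega))) (by simp), ?_,
        rfl, rfl, Or.inl ⟨rfl, rfl⟩⟩
      rw [Matrix.mul_fin_three, Matrix.mul_fin_three]
      apply mat3_ext <;> ring
    · suffices M ≤ c 2 - α by omega
      apply key₂
      intro s hs hu
      refine ⟨!![1 + s, 0, 0; 0, 1, 0; ϖ ^ α * s, 0, 1], !![1, 0, 0; 0, 1 + s, 0; 0, 0, 1],
        by simpa [det_lit] using hu,
        inC_lit (by simp) (by simp) (pow_dvd_pow_mul hs (by omega)),
        inC_lit (by simp) (by simp) (by simp), ?_, rfl, rfl, Or.inl ⟨rfl, rfl⟩⟩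
      rw [Matrix.mul_fin_three, Matrix.mul_fin_three]
      apply mat3_ext <;> ring
    · suffices M ≤ c 1 - β by omega
      apply key₂
      intro s hs hu
      refine ⟨!![1, 0, 0; 0, 1 + s, 0; 0, ϖ ^ β * s, 1], !![1 + s, 0, 0; 0, 1, 0; 0, 0, 1],
        by simpa [det_lit] using hu,
        inC_lit (by simp) (pow_dvd_pow_mul hs (by omega)) (by simp),
        inC_lit (by simp) (by simp) (by simp), ?_, rfl, rfl, Or.inr ⟨rfl, rfl⟩⟩
      rw [Matrix.mul_fin_three, Matrix.mul_fin_three]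
      apply mat3_ext <;> ring
    · suffices M ≤ d 2 - β by omega
      apply key₂
      intro s hs hu
      refine ⟨!![1, 0, 0; 0, 1 + s, 0; 0, 0, 1], !![1 + s, 0, 0; 0, 1, 0; -(ϖ ^ β * s), 0, 1],
        by simpa [det_lit] using hu, inC_lit (by simp) (by simp) (by simp),
        inC_lit (by simp) (by simp) (dvd_neg.2 (pow_dvd_pow_mul hs (by omega))), ?_,
        rfl, rfl, Or.inr ⟨rfl, rfl⟩⟩
      rw [Matrix.mul_fin_three, Matrix.mul_fin_three]
      apply mat3_ext <;> ring
    · suffices M ≤ β + c 0 - α by omega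
      apply key₂
      rintro _ ⟨t, rfl⟩ hu
      have hp : ϖ ^ α * ϖ ^ (β + c 0 - α) = ϖ ^ β * ϖ ^ c 0 := by
        rw [← pow_add, ← pow_add]; congr 1; omega
      set e := β + c 0 - α
      refine ⟨!![1 + ϖ ^ e * t, 0, 0; -(ϖ ^ c 0 * t), 1, 0; 0, 0, 1],
        !![1, -(ϖ ^ c 0 * t), 0; 0, 1 + ϖ ^ e * t, 0; 0, 0, 1],
        by simpa [det_lit] using hu,
        inC_lit (by simp) (by simp) (by simp),
        inC_lit (by simp) (by simp) (by simp), ?_, rfl, rfl, Or.inl ⟨rfl, rfl⟩⟩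
      rw [Matrix.mul_fin_three, Matrix.mul_fin_three]
      apply mat3_ext <;> first | ring1 | linear_combination t * hp | linear_combination -t * hp
    · suffices M ≤ α + d 0 - β by omega
      apply key₂
      rintro _ ⟨t, rfl⟩ hu
      have hp : ϖ ^ β * ϖ ^ (α + d 0 - β) = ϖ ^ α * ϖ ^ d 0 := by
        rw [← pow_add, ← pow_add]; congr 1; omega
      set e := α + d 0 - β
      refine ⟨!![1, -(ϖ ^ d 0 * t), 0; 0, 1 + ϖ ^ e * t, 0; 0, 0, 1],
        !![1 + ϖ ^ e * t, 0, 0; -(ϖ ^ d 0 * t), 1, 0; 0, 0, 1],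
        by simpa [det_lit] using hu,
        inC_lit (by simp) (by simp) (by simp),
        inC_lit (by simp) (by simp) (by simp), ?_, rfl, rfl, Or.inr ⟨rfl, rfl⟩⟩
      rw [Matrix.mul_fin_three, Matrix.mul_fin_three]
      apply mat3_ext <;> first | ring1 | linear_combination -t * hp
  · rintro ⟨⟨hNα, hNβ⟩, ⟨b1, b2⟩, ⟨b3, b4⟩, b5, b6⟩ g h hg hh e
    have ug := isUnit_diag hϖ hc0 (by omega) (by omega) hg
      ((Matrix.isUnit_iff_isUnit_det _).1 g.isUnit)
    have uh := isUnit_diag hϖ hd0 (by omega) (by omega) hh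
      ((Matrix.isUnit_iff_isUnit_det _).1 h.isUnit)
    have E := entries_of_mul_eq (congrArg Units.val e)
    simp only [val_s1Form] at E
    have E00 := E 0 0
    have E01 := E 0 1
    have E02 := E 0 2
    have E10 := E 1 0
    have E11 := E 1 1
    have E12 := E 1 2
    have E20 := E 2 0
    have E21 := E 2 1
    have E22 := E 2 2
    simp at E00 E01 E02 E10 E11 E12 E20 E21 E22
    obtain ⟨g10, g21, g20⟩ := hg
    obtain ⟨h10, h21, h20⟩ := hh
    have q1 : ϖ ^ M ∣ g.val 2 2 - g.val 1 1 := by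
      apply pow_dvd_cancel hϖ (a := β)
      rw [show ϖ ^ β * (g.val 2 2 - g.val 1 1) = h.val 2 0 - g.val 2 1 + ϖ ^ α * h.val 1 0
        + ϖ ^ β * (ϖ ^ β * g.val 1 2) by linear_combination E20 - ϖ ^ β * E10]
      exact dvd_add (dvd_add (dvd_sub (pow_dvd_of_le h20 b4) (pow_dvd_of_le g21 b3))
        (pow_dvd_pow_mul h10 b6))
        (pow_dvd_pow_mul (pow_dvd_pow_mul_left (n := M) (by omega)) le_rfl)
    have q2 : ϖ ^ M ∣ g.val 2 2 - g.val 0 0 := by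
      apply pow_dvd_cancel hϖ (a := α)
      rw [show ϖ ^ α * (g.val 2 2 - g.val 0 0) = h.val 2 1 - g.val 2 0 + ϖ ^ β * g.val 1 0
        + ϖ ^ α * (ϖ ^ α * g.val 0 2) + ϖ ^ α * (ϖ ^ β * g.val 1 2) by
          linear_combination E21 - ϖ ^ β * E11 - ϖ ^ α * E01]
      exact dvd_add (dvd_add (dvd_add (dvd_sub (pow_dvd_of_le h21 b1) (pow_dvd_of_le g20 b2))
        (pow_dvd_pow_mul g10 b5))
        (pow_dvd_pow_mul (pow_dvd_pow_mul_left (n := M) (by omega)) le_rfl))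
        (pow_dvd_pow_mul (pow_dvd_pow_mul_left (n := M) (by omega)) le_rfl)
    have r2 : evalChar χ₂ (g.val 1 1) = evalChar χ₂ (h.val 1 1) := by
      refine h₂.congr hϖ ug.2.1 uh.2.1 ?_
      rw [show g.val 1 1 - h.val 1 1 = (g.val 2 2 - g.val 0 0) - (g.val 2 2 - g.val 1 1)
        - ϖ ^ α * g.val 0 2 by linear_combination E01]
      exact dvd_sub (dvd_sub q2 q1) (pow_dvd_pow_mul_left (by omega))
    have r3 : evalChar χ₃ (g.val 2 2) = evalChar χ₃ (h.val 2 2) := by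
      refine h₃.congr hϖ ug.2.2 uh.2.2 ?_
      rw [show g.val 2 2 - h.val 2 2 = ϖ ^ β * h.val 0 2 + ϖ ^ α * h.val 1 2 by
        linear_combination E22]
      exact dvd_add (pow_dvd_pow_mul_left hNβ) (pow_dvd_pow_mul_left hNα)
    unfold chi
    rw [r2, r3]

/-- The analogue of `admissible_s1_iff`. Here `s₂` exchanges the last two diagonal entries, so that
the inequalities involve the conductor `N` of `χ₂ χ₃⁻¹`. -/
theorem admissible_s2_iff (hϖ : Irreducible ϖ) {χ₂ χ₃ : Oˣ →* ℂˣ} {M N : ℕ} (hMN : M ≤ N)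
    (h₂ : HasConductor χ₂ M) (h₃ : HasConductor χ₃ N) (h₂₃ : HasConductor (χ₂ * χ₃⁻¹) N)
    {c d : Fin 3 → ℕ} (hc : Good M N c) (hd : Good M N d) {α β : ℕ}
    (hαβ : α ≤ β + c 1) (hβα : β ≤ α + d 1) :
    Admissible χ₂ χ₃ ϖ c d (s2Rep ϖ α β) ↔
      (N ≤ α ∧ N ≤ β) ∧ (α + N ≤ d 0 ∧ α + N ≤ c 2) ∧ (β + N ≤ c 0 ∧ β + N ≤ d 2) ∧
        (α + N ≤ β + c 1 ∧ β + N ≤ α + d 1) := by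
  obtain ⟨⟨c1, c2, c3⟩, hN, hcM, hcN⟩ := hc
  obtain ⟨⟨d1, d2, d3⟩, -, hdM, hdN⟩ := hd
  rw [s2Rep_eq]
  constructor
  · intro hk
    -- a family of stabilizers that exchange the values `1` and `1 + s` of `χ₂` and `χ₃`
    have key : ∀ e : ℕ, (∀ s : O, ϖ ^ e ∣ s → IsUnit (1 + s) →
        ∃ G H : Matrix (Fin 3) (Fin 3) O, IsUnit G.det ∧ InC ϖ c G ∧ InC ϖ d H ∧
          G * !![1, 0, 0; ϖ ^ β, 0, 1; ϖ ^ α, 1, 0] = !![1, 0, 0; ϖ ^ β, 0, 1; ϖ ^ α, 1, 0] * H ∧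
          ((G 1 1 = 1 ∧ G 2 2 = 1 + s ∧ H 1 1 = 1 + s ∧ H 2 2 = 1) ∨
            (G 1 1 = 1 + s ∧ G 2 2 = 1 ∧ H 1 1 = 1 ∧ H 2 2 = 1 + s))) → N ≤ e := by
      intro e he
      refine h₂₃.le_of_eval hϖ fun s hs hu => ?_
      obtain ⟨G, H, g1, g2, g3, g4, g5⟩ := he s hs hu
      have := hk.eval_eq (val_s2Form _ _) g1 g2 g3 g4
      rw [evalChar_mul_inv hu, mul_inv_eq_one₀ (evalChar_ne_zero _ _)]
      rcases g5 with ⟨g5, g6, g7, g8⟩ | ⟨g5, g6, g7, g8⟩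
      · rw [g5, g6, g7, g8, evalChar_one, evalChar_one, mul_one, one_mul] at this
        exact this.symm
      · rw [g5, g6, g7, g8, evalChar_one, evalChar_one, mul_one, one_mul] at this
        exact this
    have key₃ : ∀ e : ℕ, (∀ s : O, ϖ ^ e ∣ s → IsUnit (1 + s) →
        ∃ G H : Matrix (Fin 3) (Fin 3) O, IsUnit G.det ∧ InC ϖ c G ∧ InC ϖ d H ∧
          G * !![1, 0, 0; ϖ ^ β, 0, 1; ϖ ^ α, 1, 0] = !![1, 0, 0; ϖ ^ β, 0, 1; ϖ ^ α, 1, 0] * H ∧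
          (∃ w, G 1 1 = w ∧ H 1 1 = w) ∧ H 2 2 = 1 + s ∧ G 2 2 = 1) →
        N ≤ e := by
      intro e he
      refine h₃.le_of_eval hϖ fun s hs hu => ?_
      obtain ⟨G, H, g1, g2, g3, g4, ⟨w, g5, g5'⟩, g6, g7⟩ := he s hs hu
      have := hk.eval_eq (val_s2Form _ _) g1 g2 g3 g4
      rw [g5, g5', g6, g7, evalChar_one] at this
      exact (mul_left_cancel₀ (evalChar_ne_zero _ _) this).symm
    refine ⟨⟨?_, ?_⟩, ⟨?_, ?_⟩, ⟨?_, ?_⟩, ?_, ?_⟩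
    · apply key₃
      rintro _ ⟨t, rfl⟩ hu
      refine ⟨!![1 + ϖ ^ α * t, 0, -t; 0, 1 + ϖ ^ α * t, -(ϖ ^ β * t); 0, 0, 1],
        !![1, -t, 0; 0, 1 + ϖ ^ α * t, 0; 0, 0, 1 + ϖ ^ α * t], by simpa [det_lit] using hu,
        inC_lit (by simp) (by simp) (by simp), inC_lit (by simp) (by simp) (by simp), ?_,
        ⟨1 + ϖ ^ α * t, rfl, rfl⟩, rfl, rfl⟩
      rw [Matrix.mul_fin_three, Matrix.mul_fin_three]
      apply mat3_ext <;> ring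
    · apply key₃
      rintro _ ⟨t, rfl⟩ hu
      refine ⟨!![1 + ϖ ^ β * t, -t, 0; 0, 1, 0; 0, 0, 1],
        !![1, 0, -t; 0, 1, ϖ ^ α * t; 0, 0, 1 + ϖ ^ β * t],
        by simpa [det_lit] using hu,
        inC_lit (by simp) (by simp) (by simp), inC_lit (by simp) (by simp) (by simp), ?_,
        ⟨1, rfl, rfl⟩, rfl, rfl⟩
      rw [Matrix.mul_fin_three, Matrix.mul_fin_three]
      apply mat3_ext <;> ring
    · suffices N ≤ d 0 - α by omega
      apply key
      intro s hs hu
      refine ⟨!![1, 0, 0; 0, 1, 0; 0, 0, 1 + s], !![1, 0, 0; ϖ ^ α * s, 1 + s, 0; 0, 0, 1],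
        by simpa [det_lit] using hu, inC_lit (by simp) (by simp) (by simp),
        inC_lit (pow_dvd_pow_mul hs (by omega)) (by simp) (by simp), ?_,
        Or.inl ⟨rfl, rfl, rfl, rfl⟩⟩
      rw [Matrix.mul_fin_three, Matrix.mul_fin_three]
      apply mat3_ext <;> ring
    · suffices N ≤ c 2 - α by omega
      apply key
      intro s hs hu
      refine ⟨!![1, 0, 0; 0, 1, 0; -(ϖ ^ α * s), 0, 1 + s], !![1, 0, 0; 0, 1 + s, 0; 0, 0, 1],
        by simpa [det_lit] using hu,
        inC_lit (by simp) (by simp) (dvd_neg.2 (pow_dvd_pow_mul hs (by omega))),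
        inC_lit (by simp) (by simp) (by simp), ?_, Or.inl ⟨rfl, rfl, rfl, rfl⟩⟩
      rw [Matrix.mul_fin_three, Matrix.mul_fin_three]
      apply mat3_ext <;> ring
    · suffices N ≤ c 0 - β by omega
      apply key
      intro s hs hu
      refine ⟨!![1, 0, 0; -(ϖ ^ β * s), 1 + s, 0; 0, 0, 1], !![1, 0, 0; 0, 1, 0; 0, 0, 1 + s],
        by simpa [det_lit] using hu,
        inC_lit (dvd_neg.2 (pow_dvd_pow_mul hs (by omega))) (by simp) (by simp),
        inC_lit (by simp) (by simp) (by simp), ?_, Or.inr ⟨rfl, rfl, rfl, rfl⟩⟩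
      rw [Matrix.mul_fin_three, Matrix.mul_fin_three]
      apply mat3_ext <;> ring
    · suffices N ≤ d 2 - β by omega
      apply key
      intro s hs hu
      refine ⟨!![1, 0, 0; 0, 1 + s, 0; 0, 0, 1], !![1, 0, 0; 0, 1, 0; ϖ ^ β * s, 0, 1 + s],
        by simpa [det_lit] using hu, inC_lit (by simp) (by simp) (by simp),
        inC_lit (by simp) (by simp) (pow_dvd_pow_mul hs (by omega)), ?_,
        Or.inr ⟨rfl, rfl, rfl, rfl⟩⟩
      rw [Matrix.mul_fin_three, Matrix.mul_fin_three]
      apply mat3_ext <;> ring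
    · suffices N ≤ β + c 1 - α by omega
      apply key
      rintro _ ⟨t, rfl⟩ hu
      have hp : ϖ ^ α * ϖ ^ (β + c 1 - α) = ϖ ^ β * ϖ ^ c 1 := by
        rw [← pow_add, ← pow_add]; congr 1; omega
      set e := β + c 1 - α
      refine ⟨!![1, 0, 0; 0, 1, 0; 0, -(ϖ ^ c 1 * t), 1 + ϖ ^ e * t],
        !![1, 0, 0; 0, 1 + ϖ ^ e * t, -(ϖ ^ c 1 * t); 0, 0, 1],
        by simpa [det_lit] using hu,
        inC_lit (by simp) (by simp) (by simp),
        inC_lit (by simp) (by simp) (by simp), ?_, Or.inl ⟨rfl, rfl, rfl, rfl⟩⟩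
      rw [Matrix.mul_fin_three, Matrix.mul_fin_three]
      apply mat3_ext <;> first | ring1 | linear_combination t * hp
    · suffices N ≤ α + d 1 - β by omega
      apply key
      rintro _ ⟨t, rfl⟩ hu
      have hp : ϖ ^ β * ϖ ^ (α + d 1 - β) = ϖ ^ α * ϖ ^ d 1 := by
        rw [← pow_add, ← pow_add]; congr 1; omega
      set e := α + d 1 - β
      refine ⟨!![1, 0, 0; 0, 1 + ϖ ^ e * t, -(ϖ ^ d 1 * t); 0, 0, 1],
        !![1, 0, 0; 0, 1, 0; 0, -(ϖ ^ d 1 * t), 1 + ϖ ^ e * t],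
        by simpa [det_lit] using hu,
        inC_lit (by simp) (by simp) (by simp),
        inC_lit (by simp) (by simp) (by simp), ?_, Or.inr ⟨rfl, rfl, rfl, rfl⟩⟩
      rw [Matrix.mul_fin_three, Matrix.mul_fin_three]
      apply mat3_ext <;> first | ring1 | linear_combination t * hp
  · rintro ⟨⟨hNα, hNβ⟩, ⟨b1, b2⟩, ⟨b3, b4⟩, b5, b6⟩ g h hg hh e
    have ug := isUnit_diag hϖ (by omega) (by omega) (by omega) hg
      ((Matrix.isUnit_iff_isUnit_det _).1 g.isUnit)
    have uh := isUnit_diag hϖ (by omega) (by omega) (by omega) hh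
      ((Matrix.isUnit_iff_isUnit_det _).1 h.isUnit)
    have E := entries_of_mul_eq (congrArg Units.val e)
    simp only [val_s2Form] at E
    have E00 := E 0 0
    have E01 := E 0 1
    have E02 := E 0 2
    have E10 := E 1 0
    have E11 := E 1 1
    have E12 := E 1 2
    have E20 := E 2 0
    have E21 := E 2 1
    have E22 := E 2 2
    simp at E00 E01 E02 E10 E11 E12 E20 E21 E22
    obtain ⟨g10, g21, g20⟩ := hg
    obtain ⟨h10, h21, h20⟩ := hh
    have q1 : ϖ ^ N ∣ g.val 2 2 - g.val 0 0 := by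
      apply pow_dvd_cancel hϖ (a := α)
      rw [show ϖ ^ α * (g.val 2 2 - g.val 0 0) = h.val 1 0 - g.val 2 0 - ϖ ^ β * g.val 2 1
        + ϖ ^ α * (ϖ ^ β * g.val 0 1) + ϖ ^ α * (ϖ ^ α * g.val 0 2) by
          linear_combination E20 - ϖ ^ α * E00]
      exact dvd_add (dvd_add (dvd_sub (dvd_sub (pow_dvd_of_le h10 b1) (pow_dvd_of_le g20 b2))
        (pow_dvd_pow_mul g21 b5))
        (pow_dvd_pow_mul (pow_dvd_pow_mul_left (n := N) (by omega)) le_rfl))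
        (pow_dvd_pow_mul (pow_dvd_pow_mul_left (n := N) (by omega)) le_rfl)
    have q2 : ϖ ^ N ∣ g.val 1 1 - g.val 0 0 := by
      apply pow_dvd_cancel hϖ (a := β)
      rw [show ϖ ^ β * (g.val 1 1 - g.val 0 0) = h.val 2 0 - g.val 1 0 - ϖ ^ α * h.val 2 1
        + ϖ ^ β * (ϖ ^ β * g.val 0 1) by
          linear_combination E10 - ϖ ^ β * E00 - ϖ ^ α * E11 + ϖ ^ α * ϖ ^ β * E01]
      exact dvd_add (dvd_sub (dvd_sub (pow_dvd_of_le h20 b4) (pow_dvd_of_le g10 b3))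
        (pow_dvd_pow_mul h21 b6))
        (pow_dvd_pow_mul (pow_dvd_pow_mul_left (n := N) (by omega)) le_rfl)
    have r2 : evalChar χ₂ (g.val 1 1) = evalChar χ₂ (h.val 1 1) := by
      refine h₂.congr hϖ ug.2.1 uh.2.1 ?_
      rw [show g.val 1 1 - h.val 1 1 = (g.val 1 1 - g.val 0 0) - (g.val 2 2 - g.val 0 0)
        + ϖ ^ α * h.val 0 1 by linear_combination E21]
      exact pow_dvd_of_le (dvd_add (dvd_sub q2 q1) (pow_dvd_pow_mul_left (by omega))) hMN
    have r3 : evalChar χ₃ (g.val 2 2) = evalChar χ₃ (h.val 2 2) := by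
      refine h₃.congr hϖ ug.2.2 uh.2.2 ?_
      rw [show g.val 2 2 - h.val 2 2 = (g.val 2 2 - g.val 0 0) - (g.val 1 1 - g.val 0 0)
        + ϖ ^ β * h.val 0 2 by linear_combination E12]
      exact dvd_add (dvd_sub q1 q2) (pow_dvd_pow_mul_left hNβ)
    unfold chi
    rw [r2, r3]

/-! ### The cells that support nothing -/

theorem exists_unit_char_ne {χ : Oˣ →* ℂˣ} {N : ℕ} (hN : 1 ≤ N) (h : HasConductor χ N) :
    ∃ u : Oˣ, χ u ≠ 1 := by
  by_contra! hall
  have : N ≤ 0 := h.2 fun u _ => hall u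
  omega

/-- In the cells of `s₁s₂`, `s₂s₁` and `w₀` the stabilizer contains torus elements that move `χ₃`
to the first diagonal entry, on which the characters do not depend. -/
theorem not_admissible_of_torus {χ₂ χ₃ : Oˣ →* ℂˣ} {N : ℕ} (hN : 1 ≤ N)
    (h₃ : HasConductor χ₃ N) {c d : Fin 3 → ℕ} {k : GL (Fin 3) O}
    (hk : ∀ u : Oˣ, ∃ G H : Matrix (Fin 3) (Fin 3) O, IsUnit G.det ∧ InC ϖ c G ∧ InC ϖ d H ∧
      G * k.val = k.val * H ∧ G 1 1 = 1 ∧ H 1 1 = 1 ∧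
      ((G 2 2 = u ∧ H 2 2 = 1) ∨ (G 2 2 = 1 ∧ H 2 2 = u))) :
    ¬ Admissible χ₂ χ₃ ϖ c d k := by
  intro ha
  obtain ⟨u, hu⟩ := exists_unit_char_ne hN h₃
  obtain ⟨G, H, g1, g2, g3, g4, g5, g6, g7⟩ := hk u
  have := ha.eval_eq rfl g1 g2 g3 g4
  apply hu
  apply Units.ext
  rcases g7 with ⟨g7, g8⟩ | ⟨g7, g8⟩ <;>
  · rw [g5, g6, g7, g8] at this
    simpa [evalChar_one, evalChar_coe, eq_comm] using this

/-- Representatives for the Bruhat cell of `s₁s₂`; `s₁s₂^{(α)}` is the case `z = ϖ ^ α`. -/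
noncomputable def s1s2Form (z : O) : GL (Fin 3) O :=
  Matrix.GeneralLinearGroup.mk'' !![0, 0, 1; 1, 0, 0; z, 1, 0] (by simp [Matrix.det_fin_three])

/-- Representatives for the Bruhat cell of `s₂s₁`; `s₂s₁^{(α)}` is the case `z = ϖ ^ α`. -/
noncomputable def s2s1Form (z : O) : GL (Fin 3) O :=
  Matrix.GeneralLinearGroup.mk'' !![0, 1, 0; 0, z, 1; 1, 0, 0] (by simp [Matrix.det_fin_three])

theorem not_admissible_s1s2 {χ₂ χ₃ : Oˣ →* ℂˣ} {N : ℕ} (hN : 1 ≤ N)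
    (h₃ : HasConductor χ₃ N) {c d : Fin 3 → ℕ} (z : O) :
    ¬ Admissible χ₂ χ₃ ϖ c d (s1s2Form z) := by
  refine not_admissible_of_torus hN h₃ fun u => ⟨!![(u : O), 0, 0; 0, 1, 0; 0, 0, 1],
    !![1, 0, 0; 0, 1, 0; 0, 0, (u : O)], by simp [det_lit], inC_lit (by simp) (by simp) (by simp),
    inC_lit (by simp) (by simp) (by simp), ?_, rfl, rfl, Or.inr ⟨rfl, rfl⟩⟩
  change _ * !![0, 0, 1; 1, 0, 0; z, 1, 0] = !![0, 0, 1; 1, 0, 0; z, 1, 0] * _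
  rw [Matrix.mul_fin_three, Matrix.mul_fin_three]
  apply mat3_ext <;> ring

theorem not_admissible_s2s1 {χ₂ χ₃ : Oˣ →* ℂˣ} {N : ℕ} (hN : 1 ≤ N)
    (h₃ : HasConductor χ₃ N) {c d : Fin 3 → ℕ} (z : O) :
    ¬ Admissible χ₂ χ₃ ϖ c d (s2s1Form z) := by
  refine not_admissible_of_torus hN h₃ fun u => ⟨!![1, 0, 0; 0, 1, 0; 0, 0, (u : O)],
    !![(u : O), 0, 0; 0, 1, 0; 0, 0, 1], by simp [det_lit], inC_lit (by simp) (by simp) (by simp),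
    inC_lit (by simp) (by simp) (by simp), ?_, rfl, rfl, Or.inl ⟨rfl, rfl⟩⟩
  change _ * !![0, 1, 0; 0, z, 1; 1, 0, 0] = !![0, 1, 0; 0, z, 1; 1, 0, 0] * _
  rw [Matrix.mul_fin_three, Matrix.mul_fin_three]
  apply mat3_ext <;> ring

theorem not_admissible_w0 {χ₂ χ₃ : Oˣ →* ℂˣ} {N : ℕ} (hN : 1 ≤ N)
    (h₃ : HasConductor χ₃ N) {c d : Fin 3 → ℕ} :
    ¬ Admissible χ₂ χ₃ ϖ c d (w0Rep O) := by
  refine not_admissible_of_torus hN h₃ fun u => ⟨!![1, 0, 0; 0, 1, 0; 0, 0, (u : O)],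
    !![(u : O), 0, 0; 0, 1, 0; 0, 0, 1], by simp [det_lit], inC_lit (by simp) (by simp) (by simp),
    inC_lit (by simp) (by simp) (by simp), ?_, rfl, rfl, Or.inl ⟨rfl, rfl⟩⟩
  change _ * !![0, 0, 1; 0, 1, 0; 1, 0, 0] = !![0, 0, 1; 0, 1, 0; 1, 0, 0] * _
  rw [Matrix.mul_fin_three, Matrix.mul_fin_three]
  apply mat3_ext <;> ring

/-! ### Admissibility of the lower unipotent representatives -/

/-- The lower unipotent matrix with entries `A`, `B`, `X` at the places `21`, `32`, `31`. -/
noncomputable def lowerForm (A B X : O) : GL (Fin 3) O :=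
  Matrix.GeneralLinearGroup.mk'' !![1, 0, 0; A, 1, 0; X, B, 1] (by simp [Matrix.det_fin_three])

theorem val_lowerForm (A B X : O) : (lowerForm A B X).val = !![1, 0, 0; A, 1, 0; X, B, 1] := rfl

theorem tRep_eq (ϖ : O) (a : Fin 3 → ℕ) (x : Oˣ) :
    tRep ϖ (fun i => (a i : ℤ)) x = lowerForm (ϖ ^ a 0) (ϖ ^ a 1) (x * ϖ ^ a 2) := rfl

theorem natCast_le_val_iff (hϖ : Irreducible ϖ) {n : ℕ} {z : O} :
    (n : ℕ∞) ≤ val z ↔ ϖ ^ n ∣ z := by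
  rw [← IsDiscreteValuationRing.addVal_le_iff_dvd, IsDiscreteValuationRing.addVal_pow,
    IsDiscreteValuationRing.addVal_uniformizer hϖ]
  simp [val]

theorem val_add_le_iff (hϖ : Irreducible ϖ) {L n : ℕ} {z : O} :
    val z + L ≤ n ↔ ∃ v w, z = ϖ ^ v * w ∧ IsUnit w ∧ v + L ≤ n := by
  constructor
  · intro h
    have hz : z ≠ 0 := by
      rintro rfl
      simp [val] at h
    obtain ⟨v, u, rfl⟩ := IsDiscreteValuationRing.eq_unit_mul_pow_irreducible hz hϖ
    refine ⟨v, u, mul_comm _ _, u.isUnit, ?_⟩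
    rw [val, IsDiscreteValuationRing.addVal_def' u hϖ] at h
    exact_mod_cast h
  · rintro ⟨v, _, rfl, ⟨w, rfl⟩, h⟩
    rw [val, mul_comm, IsDiscreteValuationRing.addVal_def' w hϖ]
    exact_mod_cast h

theorem dvd_of_not_val_add_le (hϖ : Irreducible ϖ) {L n : ℕ} {z : O} (h : ¬ (val z + L ≤ n)) :
    ϖ ^ (n + 1 - L) ∣ z := by
  rcases eq_or_ne z 0 with rfl | hz
  · exact dvd_zero _
  obtain ⟨v, u, rfl⟩ := IsDiscreteValuationRing.eq_unit_mul_pow_irreducible hz hϖ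
  rw [val_add_le_iff hϖ] at h
  refine (pow_dvd_pow ϖ ?_).mul_left _
  by_contra hv
  exact h ⟨v, u, mul_comm _ _, u.isUnit, by omega⟩

/-- The conditions (a), (b), (c) with exponents in `ℕ` and without subtractions. -/
theorem mixedCond_iff (c d a : Fin 3 → ℕ) (x : Oˣ) (L : ℕ) :
    MixedCond (fun i => (c i : ℤ)) (fun i => (d i : ℤ)) (fun i => (a i : ℤ)) x L ↔
    (a 0 + a 1 < a 2 ∧ ((a 0 + L ≤ c 0 ∧ a 1 + L ≤ c 1 ∧ a 2 + L ≤ c 2) ∧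
      (a 0 + L ≤ d 0 ∧ a 1 + L ≤ d 1 ∧ a 2 + L ≤ d 2)) ∧
      (a 2 + L ≤ c 1 + a 0 ∧ a 2 + L ≤ d 0 + a 1)) ∨
    (a 2 < a 0 + a 1 ∧ (a 2 + L ≤ c 0 + a 1 ∧ a 2 + L ≤ c 1 + a 0 ∧
        2 * a 2 + L ≤ c 2 + a 0 + a 1) ∧
      (a 2 + L ≤ d 0 + a 1 ∧ a 2 + L ≤ d 1 + a 0 ∧ 2 * a 2 + L ≤ d 2 + a 0 + a 1)) ∨
    (a 0 + a 1 = a 2 ∧ ((a 0 + L ≤ c 0 ∧ a 1 + L ≤ c 1 ∧ a 2 + L ≤ c 2) ∧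
      (a 0 + L ≤ d 0 ∧ a 1 + L ≤ d 1 ∧ a 2 + L ≤ d 2)) ∧
      val ((x : O) - 1) + L ≤ level' (fun i => (c i : ℤ)) (fun i => (d i : ℤ))
        (fun i => (a i : ℤ))) := by
  unfold MixedCond
  refine or_congr ?_ (or_congr ?_ ?_)
  · simp only [minEntry, Pi.sub_apply, le_min_iff]
    constructor <;> rintro ⟨h, h', h''⟩ <;> refine ⟨by omega, ?_⟩ <;> omega
  · simp only [minEntry, Pi.sub_apply, op, Matrix.cons_val, le_min_iff]
    constructor <;> rintro ⟨h, h', h''⟩ <;> refine ⟨by omega, ?_⟩ <;> omega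
  · simp only [minEntry, Pi.sub_apply, le_min_iff]
    refine and_congr (by omega) (and_congr ?_ Iff.rfl)
    constructor <;> rintro ⟨h, h'⟩ <;> omega

theorem level'_natCast (c d a : Fin 3 → ℕ) :
    level' (fun i => (c i : ℤ)) (fun i => (d i : ℤ)) (fun i => (a i : ℤ)) =
      min (min (d 2 - a 2) (c 2 - a 2)) (min (c 0 - a 0) (d 1 - a 1)) := by
  unfold level'; beta_reduce; omega

/-- Under the mixed condition of level `L`, the middle diagonal entries of every stabilizing pair
agree modulo `𝔭ᴸ`: three of the nine stabilizer equations, divided by suitable powers of `ϖ`, add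
up to a unit multiple of the difference. -/
theorem dvd_sub_of_mixedCond (hϖ : Irreducible ϖ) {c d a : Fin 3 → ℕ} {x : Oˣ} {L : ℕ}
    (hL : MixedCond (fun i => (c i : ℤ)) (fun i => (d i : ℤ)) (fun i => (a i : ℤ)) x L)
    (ha02 : a 0 ≤ a 2) (ha12 : a 1 ≤ a 2)
    {g h : Matrix (Fin 3) (Fin 3) O} (hg : InC ϖ c g) (hh : InC ϖ d h)
    (e : g * (lowerForm (ϖ ^ a 0) (ϖ ^ a 1) (x * ϖ ^ a 2)).val =
      (lowerForm (ϖ ^ a 0) (ϖ ^ a 1) (x * ϖ ^ a 2)).val * h) :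
    ϖ ^ L ∣ h 1 1 - g 1 1 := by
  rw [mixedCond_iff, level'_natCast] at hL
  have E := entries_of_mul_eq e
  simp only [val_lowerForm] at E
  have E00 := E 0 0
  have E01 := E 0 1
  have E02 := E 0 2
  have E10 := E 1 0
  have E11 := E 1 1
  have E20 := E 2 0
  have E21 := E 2 1
  simp at E00 E01 E02 E10 E11 E20 E21
  clear E e
  obtain ⟨g10, g21, g20⟩ := hg
  obtain ⟨h10, h21, h20⟩ := hh
  generalize a 0 = p at *
  generalize a 1 = q at *
  generalize hr : a 2 = r at *
  obtain ⟨u, rfl⟩ : ∃ u, r = p + u := ⟨r - p, by omega⟩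
  obtain ⟨v, hv⟩ : ∃ v, p + u = q + v := ⟨p + u - q, by omega⟩
  have hpow : ϖ ^ p * ϖ ^ u = ϖ ^ q * ϖ ^ v := by rw [← pow_add, ← pow_add, hv]
  rw [pow_add] at *
  have hne := hϖ.ne_zero
  rcases hL with ⟨hlt, ⟨⟨c0, c1, c2⟩, d0, d1, d2⟩, b1, b2⟩ | ⟨hlt, ⟨c0, c1, c2⟩, d0, d1, d2⟩ |
    ⟨heq, ⟨⟨c0, c1, c2⟩, d0, d1, d2⟩, hval⟩
  · obtain ⟨w, rfl⟩ : ∃ w, v = p + w := ⟨v - p, by omega⟩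
    have hw : u = q + w := by omega
    subst hw
    have D1 : ϖ ^ L ∣ g 1 1 - g 0 0 - ϖ ^ p * g 0 1 + x * ϖ ^ (q + w) * g 1 2
        - x * (ϖ ^ p * ϖ ^ (q + w)) * g 0 2 := by
      apply pow_dvd_cancel hϖ (a := p)
      rw [show ϖ ^ p * (g 1 1 - g 0 0 - ϖ ^ p * g 0 1 + x * ϖ ^ (q + w) * g 1 2
        - x * (ϖ ^ p * ϖ ^ (q + w)) * g 0 2) = h 1 0 - g 1 0 by
          linear_combination E10 - ϖ ^ p * E00]
      exact dvd_sub (pow_dvd_of_le h10 d0) (pow_dvd_of_le g10 c0)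
    have D2 : ϖ ^ L ∣ g 2 2 - g 1 1 + (ϖ ^ p - x * ϖ ^ (p + w)) * h 0 1 - ϖ ^ q * g 1 2 := by
      apply pow_dvd_cancel hϖ (a := q)
      rw [show ϖ ^ q * (g 2 2 - g 1 1 + (ϖ ^ p - x * ϖ ^ (p + w)) * h 0 1 - ϖ ^ q * g 1 2)
        = h 2 1 - g 2 1 by linear_combination E21 - ϖ ^ q * E11 + x * h 0 1 * hpow]
      exact dvd_sub (pow_dvd_of_le h21 d1) (pow_dvd_of_le g21 c1)
    have D3 : ϖ ^ L ∣ x * (g 2 2 - g 0 0 - ϖ ^ p * g 0 1 - x * (ϖ ^ p * ϖ ^ (q + w)) * g 0 2) := by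
      apply pow_dvd_cancel hϖ (a := p + (q + w))
      rw [show ϖ ^ (p + (q + w)) *
        (x * (g 2 2 - g 0 0 - ϖ ^ p * g 0 1 - x * (ϖ ^ p * ϖ ^ (q + w)) * g 0 2)) =
          h 2 0 - g 2 0 - ϖ ^ p * g 2 1 + ϖ ^ q * h 1 0 by
            rw [pow_add]; linear_combination E20 - x * (ϖ ^ p * ϖ ^ (q + w)) * E00]
      exact dvd_add (dvd_sub (dvd_sub (pow_dvd_of_le h20 d2) (pow_dvd_of_le g20 c2))
        (pow_dvd_pow_mul g21 (by omega))) (pow_dvd_pow_mul h10 (by omega))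
    rw [x.isUnit.dvd_mul_left] at D3
    have hu : IsUnit (-(1 - x * ϖ ^ w)) :=
      (isUnit_one_sub hϖ ((dvd_pow_self ϖ (by omega)).mul_left _)).neg
    apply dvd_of_dvd_mul_unit hu
    have := dvd_sub (dvd_add D1 D2) D3
    convert this using 1
    rw [pow_add, pow_add]
    linear_combination (1 - x * ϖ ^ w) * E11
  · obtain ⟨w, rfl⟩ : ∃ w, p = v + w := ⟨p - v, by omega⟩
    have hw : q = u + w := by omega
    subst hw
    have D1 : ϖ ^ L ∣ ϖ ^ w * (g 1 1 - g 0 0 - ϖ ^ (v + w) * g 0 1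
        - x * (ϖ ^ (v + w) * ϖ ^ u) * g 0 2) + x * ϖ ^ (u + w) * g 1 2 := by
      apply pow_dvd_cancel hϖ (a := v)
      rw [show ϖ ^ v * (ϖ ^ w * (g 1 1 - g 0 0 - ϖ ^ (v + w) * g 0 1
        - x * (ϖ ^ (v + w) * ϖ ^ u) * g 0 2) + x * ϖ ^ (u + w) * g 1 2) = h 1 0 - g 1 0 by
          rw [pow_add] at *; rw [pow_add] at *; linear_combination E10 - ϖ ^ v * ϖ ^ w * E00]
      exact dvd_sub (pow_dvd_of_le h10 (by omega)) (pow_dvd_of_le g10 (by omega))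
    have D2 : ϖ ^ L ∣ ϖ ^ w * (g 2 2 - g 1 1) + (ϖ ^ w - x) * ϖ ^ (v + w) * h 0 1
        - ϖ ^ w * ϖ ^ (u + w) * g 1 2 := by
      apply pow_dvd_cancel hϖ (a := u)
      rw [show ϖ ^ u * (ϖ ^ w * (g 2 2 - g 1 1) + (ϖ ^ w - x) * ϖ ^ (v + w) * h 0 1
        - ϖ ^ w * ϖ ^ (u + w) * g 1 2) = h 2 1 - g 2 1 by
          rw [pow_add] at *; rw [pow_add] at *; linear_combination E21 - ϖ ^ u * ϖ ^ w * E11]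
      exact dvd_sub (pow_dvd_of_le h21 (by omega)) (pow_dvd_of_le g21 (by omega))
    have D3 : ϖ ^ L ∣ x * (ϖ ^ w * (g 2 2 - g 0 0 - ϖ ^ (v + w) * g 0 1
        - x * (ϖ ^ (v + w) * ϖ ^ u) * g 0 2)) := by
      apply pow_dvd_cancel hϖ (a := u + v)
      rw [show ϖ ^ (u + v) * (x * (ϖ ^ w * (g 2 2 - g 0 0 - ϖ ^ (v + w) * g 0 1
        - x * (ϖ ^ (v + w) * ϖ ^ u) * g 0 2))) =
          h 2 0 - g 2 0 - ϖ ^ (v + w) * g 2 1 + ϖ ^ (u + w) * h 1 0 by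
            rw [pow_add] at *; rw [pow_add] at *; rw [pow_add] at *
            linear_combination E20 - x * (ϖ ^ v * ϖ ^ w * ϖ ^ u) * E00]
      exact dvd_add (dvd_sub (dvd_sub (pow_dvd_of_le h20 (by omega)) (pow_dvd_of_le g20 (by omega)))
        (pow_dvd_pow_mul g21 (by omega))) (pow_dvd_pow_mul h10 (by omega))
    rw [x.isUnit.dvd_mul_left] at D3
    have hu : IsUnit ((x : O) - ϖ ^ w) := IsUnit.sub_dvd hϖ x.isUnit (dvd_pow_self ϖ (by omega))
    apply dvd_of_dvd_mul_unit hu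
    have := dvd_sub (dvd_add D1 D2) D3
    convert this using 1
    rw [pow_add, pow_add] at *
    linear_combination (ϖ ^ w - x) * E11
  · rw [val_add_le_iff hϖ] at hval
    obtain ⟨k, w, hx, hw, hk⟩ := hval
    obtain rfl : u = q := by omega
    have D3 : ϖ ^ L ∣ x * (g 2 2 - g 0 0 - ϖ ^ p * g 0 1 - x * (ϖ ^ p * ϖ ^ u) * g 0 2) := by
      apply pow_dvd_cancel hϖ (a := p + u)
      rw [show ϖ ^ (p + u) *
        (x * (g 2 2 - g 0 0 - ϖ ^ p * g 0 1 - x * (ϖ ^ p * ϖ ^ u) * g 0 2)) =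
          h 2 0 - g 2 0 - ϖ ^ p * g 2 1 + ϖ ^ u * h 1 0 by
            rw [pow_add]; linear_combination E20 - x * (ϖ ^ p * ϖ ^ u) * E00]
      exact dvd_add (dvd_sub (dvd_sub (pow_dvd_of_le h20 d2) (pow_dvd_of_le g20 c2))
        (pow_dvd_pow_mul g21 (by omega))) (pow_dvd_pow_mul h10 (by omega))
    rw [x.isUnit.dvd_mul_left] at D3
    have D4 : ϖ ^ L ∣ w * (g 2 2 - g 0 0 - ϖ ^ u * g 1 2 - ϖ ^ p * ϖ ^ u * (x - 1) * g 0 2) := by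
      apply pow_dvd_cancel hϖ (a := p + u + k)
      rw [show ϖ ^ (p + u + k) *
        (w * (g 2 2 - g 0 0 - ϖ ^ u * g 1 2 - ϖ ^ p * ϖ ^ u * (x - 1) * g 0 2)) =
          h 2 0 - g 2 0 - ϖ ^ p * h 2 1 + ϖ ^ u * g 1 0 by
            rw [pow_add, pow_add]
            linear_combination E20 - ϖ ^ u * E10 - ϖ ^ p * E21 + ϖ ^ p * ϖ ^ u * E11
              - ϖ ^ p * ϖ ^ u * (x - 1) * E00 + ϖ ^ p * ϖ ^ p * ϖ ^ u * (x - 1) * E01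
              - ϖ ^ p * ϖ ^ u * (g 2 2 - g 0 0 - ϖ ^ u * g 1 2
                - ϖ ^ p * ϖ ^ u * (x - 1) * g 0 2) * hx]
      exact dvd_add (dvd_sub (dvd_sub (pow_dvd_of_le h20 (by omega)) (pow_dvd_of_le g20 (by omega)))
        (pow_dvd_pow_mul h21 (by omega))) (pow_dvd_pow_mul g10 (by omega))
    rw [hw.dvd_mul_left] at D4
    have := dvd_sub D3 D4
    convert this using 1
    linear_combination ϖ ^ p * E01 - E11

/-- Stabilizing pairs of `lowerForm A B (B * V)` with `g₁₂ = t` and middle diagonal entries `1` and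
`1 - A t`. In terms of `τ = -A t` and `θ = -V t`, each of the six divisibilities lets one entry
below the diagonal absorb the defect of the torus part. -/
theorem Admissible.evalChar_row_one (hϖ : Irreducible ϖ) {χ₂ χ₃ : Oˣ →* ℂˣ} {c d : Fin 3 → ℕ}
    {A B V t τ θ : O} (hk : Admissible χ₂ χ₃ ϖ c d (lowerForm A B (B * V)))
    (hτ : τ = -(A * t)) (hθ : θ = -(V * t)) (hA : ϖ ∣ A)
    (h : (ϖ ^ c 1 ∣ B * θ ∨ ϖ ^ d 1 ∣ B * (τ - θ)) ∨
      ϖ ∣ θ ∧ (ϖ ^ c 0 ∣ A * (τ - θ) ∨ ϖ ^ d 0 ∣ A * θ ∨ ϖ ^ c 2 ∣ B * V * (τ - θ) ∨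
        ϖ ^ d 2 ∣ B * V * (τ - θ))) :
    evalChar χ₂ (1 + τ) = 1 := by
  have hτd : ϖ ∣ τ := hτ ▸ dvd_neg.2 (hA.mul_right _)
  have uτ : IsUnit (1 + τ) := isUnit_one_add hϖ hτd
  have conclude : ∀ {G H : Matrix (Fin 3) (Fin 3) O} (w : O), IsUnit G.det → InC ϖ c G →
      InC ϖ d H → G * !![1, 0, 0; A, 1, 0; B * V, B, 1] = !![1, 0, 0; A, 1, 0; B * V, B, 1] * H →
      G 1 1 = 1 → H 1 1 = 1 + τ → G 2 2 = w → H 2 2 = w → evalChar χ₂ (1 + τ) = 1 := by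
    intro G H w h1 h2 h3 h4 h5 h6 h7 h8
    have := hk.eval_eq (val_lowerForm _ _ _) h1 h2 h3 h4
    rw [h5, h6, h7, h8, evalChar_one] at this
    exact (mul_right_cancel₀ (evalChar_ne_zero _ _) this).symm
  rcases h with (h | h) | ⟨hθd, h | h | h | h⟩
  · refine conclude (1 + τ) (G := !![1 + τ, t, 0; 0, 1, 0; 0, -(B * θ), 1 + τ])
      (H := !![1, t, 0; 0, 1 + τ, 0; 0, 0, 1 + τ]) ?_
      (inC_lit (by simp) (dvd_neg.2 h) (by simp)) (inC_lit (by simp) (by simp) (by simp)) ?_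
      rfl rfl rfl rfl
    · simpa [det_lit] using uτ
    · rw [Matrix.mul_fin_three, Matrix.mul_fin_three, hτ, hθ]; apply mat3_ext <;> ring
  · refine conclude 1 (G := !![1 + τ, t, 0; 0, 1, 0; 0, 0, 1])
      (H := !![1, t, 0; 0, 1 + τ, 0; 0, -(B * (τ - θ)), 1]) ?_
      (inC_lit (by simp) (by simp) (by simp)) (inC_lit (by simp) (dvd_neg.2 h) (by simp)) ?_
      rfl rfl rfl rfl
    · simpa [det_lit] using uτ
    · rw [Matrix.mul_fin_three, Matrix.mul_fin_three, hτ, hθ]; apply mat3_ext <;> ring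
  all_goals
    have u3 : IsUnit (1 + τ - θ) := by
      rw [add_sub_assoc]; exact isUnit_one_add hϖ (dvd_sub hτd hθd)
  · have u4 : IsUnit (1 + 2 * τ - θ - t * (A * (τ - θ))) := by
      have := IsUnit.add_dvd hϖ u3 (dvd_sub hτd ((hA.mul_right (τ - θ)).mul_left t))
      convert this using 1; ring
    refine conclude (1 + τ - θ) (G := !![1 + 2 * τ - θ, t, 0; A * (τ - θ), 1, 0; 0, 0, 1 + τ - θ])
      (H := !![1 + τ - θ, t, 0; 0, 1 + τ, 0; 0, 0, 1 + τ - θ]) ?_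
      (inC_lit h (by simp) (by simp)) (inC_lit (by simp) (by simp) (by simp)) ?_
      rfl rfl rfl rfl
    · rw [det_lit]; convert u4.mul u3 using 1; ring
    · rw [Matrix.mul_fin_three, Matrix.mul_fin_three, hτ, hθ]; apply mat3_ext <;> ring
  · refine conclude (1 + τ - θ) (G := !![1 + τ - θ, t, 0; 0, 1, 0; 0, 0, 1 + τ - θ])
      (H := !![1 - θ, t, 0; A * θ, 1 + τ, 0; 0, 0, 1 + τ - θ]) ?_
      (inC_lit (by simp) (by simp) (by simp)) (inC_lit h (by simp) (by simp)) ?_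
      rfl rfl rfl rfl
    · rw [det_lit]; convert u3.mul u3 using 1; ring
    · rw [Matrix.mul_fin_three, Matrix.mul_fin_three, hτ, hθ]; apply mat3_ext <;> ring
  · refine conclude (1 + τ - θ) (G := !![1 + τ, t, 0; 0, 1, 0; -(B * V * (τ - θ)), 0, 1 + τ - θ])
      (H := !![1, t, 0; 0, 1 + τ, 0; 0, 0, 1 + τ - θ]) ?_
      (inC_lit (by simp) (by simp) (dvd_neg.2 h)) (inC_lit (by simp) (by simp) (by simp)) ?_
      rfl rfl rfl rfl
    · rw [det_lit]; convert uτ.mul u3 using 1; ring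
    · rw [Matrix.mul_fin_three, Matrix.mul_fin_three, hτ, hθ]; apply mat3_ext <;> ring
  · refine conclude (1 + τ - θ) (G := !![1 + τ, t, 0; 0, 1, 0; 0, 0, 1 + τ - θ])
      (H := !![1, t, 0; 0, 1 + τ, 0; B * V * (τ - θ), 0, 1 + τ - θ]) ?_
      (inC_lit (by simp) (by simp) (by simp)) (inC_lit (by simp) (by simp) h) ?_
      rfl rfl rfl rfl
    · rw [det_lit]; convert uτ.mul u3 using 1; ring
    · rw [Matrix.mul_fin_three, Matrix.mul_fin_three, hτ, hθ]; apply mat3_ext <;> ring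

/-- Stabilizing pairs of `lowerForm A B (A * U)` with `g₂₃ = t`. Here `τ = B t` and `θ = U t`, and
`g₃₃ / h₃₃` equals `1 + τ` up to the products `τ²` and `τ θ`. -/
theorem Admissible.evalChar_row_two (hϖ : Irreducible ϖ) {χ₂ χ₃ : Oˣ →* ℂˣ} {N : ℕ}
    (h₃ : HasConductor χ₃ N) {c d : Fin 3 → ℕ}
    {A B U t τ θ : O} (hk : Admissible χ₂ χ₃ ϖ c d (lowerForm A B (A * U)))
    (hτ : τ = B * t) (hθ : θ = U * t) (hB : ϖ ∣ B)
    (hττ : ϖ ^ N ∣ τ * τ) (hτθ : ϖ ∣ θ → ϖ ^ N ∣ τ * θ)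
    (h : (ϖ ^ c 0 ∣ A * (τ - θ) ∨ ϖ ^ d 0 ∣ A * θ) ∨
      ϖ ∣ θ ∧ (ϖ ^ c 1 ∣ B * θ ∨ ϖ ^ d 1 ∣ B * (τ - θ) ∨ ϖ ^ c 2 ∣ A * U * (τ - θ) ∨
        ϖ ^ d 2 ∣ A * U * (τ - θ))) :
    evalChar χ₂ (1 + τ) = evalChar χ₃ (1 + τ) := by
  have hτd : ϖ ∣ τ := hτ ▸ hB.mul_right _
  have uτ : IsUnit (1 + τ) := isUnit_one_add hϖ hτd
  have conclude : ∀ {G H : Matrix (Fin 3) (Fin 3) O} (w : O), IsUnit G.det → InC ϖ c G →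
      InC ϖ d H → G * !![1, 0, 0; A, 1, 0; A * U, B, 1] = !![1, 0, 0; A, 1, 0; A * U, B, 1] * H →
      G 1 1 = 1 → H 1 1 = 1 + τ → G 2 2 = w → H 2 2 = w - τ → IsUnit w →
      ϖ ^ N ∣ τ * (w - 1 - τ) → evalChar χ₂ (1 + τ) = evalChar χ₃ (1 + τ) := by
    intro G H w h1 h2 h3 h4 h5 h6 h7 h8 hw hd
    have := hk.eval_eq (val_lowerForm _ _ _) h1 h2 h3 h4
    have uw : IsUnit (w - τ) := IsUnit.sub_dvd hϖ hw hτd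
    have e3 : evalChar χ₃ w = evalChar χ₃ (1 + τ) * evalChar χ₃ (w - τ) := by
      rw [← evalChar_mul _ uτ uw]
      refine h₃.congr hϖ hw (uτ.mul uw) ?_
      rw [← dvd_neg]
      convert hd using 1; ring
    rw [h5, h6, h7, h8, evalChar_one, one_mul, e3] at this
    exact (mul_right_cancel₀ (evalChar_ne_zero _ _) this).symm
  rcases h with (h | h) | ⟨hθd, h | h | h | h⟩
  · refine conclude (1 + τ) (G := !![1 + τ, 0, 0; A * (τ - θ), 1, t; 0, 0, 1 + τ])
      (H := !![1 + τ, 0, 0; 0, 1 + τ, t; 0, 0, 1 + τ - τ]) ?_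
      (inC_lit h (by simp) (by simp)) (inC_lit (by simp) (by simp) (by simp)) ?_
      rfl rfl rfl rfl uτ (by simp)
    · rw [det_lit]; convert uτ.mul uτ using 1; ring
    · rw [Matrix.mul_fin_three, Matrix.mul_fin_three, hτ, hθ]; apply mat3_ext <;> ring
  · refine conclude (1 + τ) (G := !![1, 0, 0; 0, 1, t; 0, 0, 1 + τ])
      (H := !![1, 0, 0; A * θ, 1 + τ, t; 0, 0, 1 + τ - τ]) ?_
      (inC_lit (by simp) (by simp) (by simp)) (inC_lit h (by simp) (by simp)) ?_
      rfl rfl rfl rfl uτ (by simp)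
    · rw [det_lit]; convert uτ using 1; ring
    · rw [Matrix.mul_fin_three, Matrix.mul_fin_three, hτ, hθ]; apply mat3_ext <;> ring
  all_goals
    have uθ : IsUnit (1 + θ) := isUnit_one_add hϖ hθd
    have hτθ' := hτθ hθd
  · have u3 : IsUnit (1 + τ + θ) := IsUnit.add_dvd hϖ uτ hθd
    have u4 : IsUnit (1 + τ + θ + t * (B * θ)) :=
      IsUnit.add_dvd hϖ u3 ((hB.mul_right _).mul_left _)
    refine conclude (1 + τ + θ) (G := !![1 + θ, 0, 0; 0, 1, t; 0, -(B * θ), 1 + τ + θ])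
      (H := !![1 + θ, 0, 0; 0, 1 + τ, t; 0, 0, 1 + τ + θ - τ]) ?_
      (inC_lit (by simp) (dvd_neg.2 h) (by simp)) (inC_lit (by simp) (by simp) (by simp)) ?_
      rfl rfl rfl rfl u3 (by convert hτθ' using 1; ring)
    · rw [det_lit]; convert uθ.mul u4 using 1; ring
    · rw [Matrix.mul_fin_three, Matrix.mul_fin_three, hτ, hθ]; apply mat3_ext <;> ring
  · refine conclude (1 + θ) (G := !![1 + θ, 0, 0; 0, 1, t; 0, 0, 1 + θ])
      (H := !![1 + θ, 0, 0; 0, 1 + τ, t; 0, -(B * (τ - θ)), 1 + θ - τ]) ?_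
      (inC_lit (by simp) (by simp) (by simp)) (inC_lit (by simp) (dvd_neg.2 h) (by simp)) ?_
      rfl rfl rfl rfl uθ (by convert dvd_sub hτθ' hττ using 1; ring)
    · rw [det_lit]; convert uθ.mul uθ using 1; ring
    · rw [Matrix.mul_fin_three, Matrix.mul_fin_three, hτ, hθ]; apply mat3_ext <;> ring
  · refine conclude (1 + τ) (G := !![1 + θ, 0, 0; 0, 1, t; -(A * U * (τ - θ)), 0, 1 + τ])
      (H := !![1 + θ, 0, 0; 0, 1 + τ, t; 0, 0, 1 + τ - τ]) ?_
      (inC_lit (by simp) (by simp) (dvd_neg.2 h)) (inC_lit (by simp) (by simp) (by simp)) ?_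
      rfl rfl rfl rfl uτ (by simp)
    · rw [det_lit]; convert uθ.mul uτ using 1; ring
    · rw [Matrix.mul_fin_three, Matrix.mul_fin_three, hτ, hθ]; apply mat3_ext <;> ring
  · refine conclude (1 + τ) (G := !![1 + θ, 0, 0; 0, 1, t; 0, 0, 1 + τ])
      (H := !![1 + θ, 0, 0; 0, 1 + τ, t; A * U * (τ - θ), 0, 1 + τ - τ]) ?_
      (inC_lit (by simp) (by simp) (by simp)) (inC_lit (by simp) (by simp) h) ?_
      rfl rfl rfl rfl uτ (by simp)
    · rw [det_lit]; convert uθ.mul uτ using 1; ring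
    · rw [Matrix.mul_fin_three, Matrix.mul_fin_three, hτ, hθ]; apply mat3_ext <;> ring

/-- The upper triangular stabilizing pairs `(g, h)` with `g₃₃ = 1` and `h₃₃ = 1 - s`, where `s` is
any multiple of both `A` and `B`. They show that `max (a₁, a₂) ≥ N` is necessary. -/
theorem Admissible.evalChar_upper {χ₂ χ₃ : Oˣ →* ℂˣ} {c d : Fin 3 → ℕ}
    {A B X s t v y : O} (hk : Admissible χ₂ χ₃ ϖ c d (lowerForm A B X))
    (hs : s = A * t) (hs' : s = B * v) (hy : X * t = B * y) (hy' : X * v = A * y)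
    (us : IsUnit (1 - s)) (uy : IsUnit (1 - y)) :
    evalChar χ₃ (1 - s) = 1 := by
  have := hk.eval_eq (val_lowerForm _ _ _) (G := !![1 - s, t, 0; 0, 1 - y, v; 0, 0, 1])
    (H := !![1, t, 0; 0, 1 - y, v; 0, 0, 1 - s])
    (by rw [det_lit]; convert us.mul uy using 1; ring)
    (inC_lit (by simp) (by simp) (by simp)) (inC_lit (by simp) (by simp) (by simp)) (by
      rw [Matrix.mul_fin_three, Matrix.mul_fin_three]
      apply mat3_ext
      · rw [hs]; ring
      · ring
      · ring
      · linear_combination hy'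
      · linear_combination hs - hs'
      · ring
      · ring
      · linear_combination -hy
      · linear_combination hs')
  have e : evalChar χ₂ (1 - y) * evalChar χ₃ 1 = evalChar χ₂ (1 - y) * evalChar χ₃ (1 - s) := this
  rw [evalChar_one] at e
  exact (mul_left_cancel₀ (evalChar_ne_zero _ _) e).symm

theorem mul_pow_eq_mul {x : O} {r q : ℕ} (h : q ≤ r) :
    x * ϖ ^ r = ϖ ^ q * (x * ϖ ^ (r - q)) := by
  rw [mul_left_comm, ← pow_add, Nat.add_sub_cancel' h]

/-- If one of the inequalities of the mixed condition fails, then a stabilizing pair of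
`Admissible.evalChar_row_one` shows that `χ₂` is trivial on `1 + 𝔭^{M-1}`. -/
theorem mixedCond_of_row_one (hϖ : Irreducible ϖ) {χ₂ χ₃ : Oˣ →* ℂˣ} {M N : ℕ}
    (h₂ : HasConductor χ₂ M) {c d a : Fin 3 → ℕ}
    (hc : Good M N c) (hd : Good M N d) {x : Oˣ} (h0 : 1 ≤ a 0)
    (h12 : a 1 ≤ a 2) (hk : Admissible χ₂ χ₃ ϖ c d (tRep ϖ (fun i => (a i : ℤ)) x))
    (hM : a 0 < M) :
    MixedCond (fun i => (c i : ℤ)) (fun i => (d i : ℤ)) (fun i => (a i : ℤ)) x M := by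
  rw [tRep_eq, mul_pow_eq_mul h12] at hk
  rw [mixedCond_iff]
  obtain ⟨⟨c1, c2, c3⟩, hN, hcM, hcN⟩ := hc
  obtain ⟨⟨d1, d2, d3⟩, -, hdM, hdN⟩ := hd
  -- violating one of the inequalities makes `χ₂` trivial on `1 + 𝔭^{M-1}`
  have key : ∀ e j : ℕ, e = a 2 - a 1 + (M - 1 - a 0) → ϖ ^ j ∣ ϖ ^ (M - 1) - x * ϖ ^ e →
      ((c 1 ≤ a 1 + e ∨ d 1 ≤ a 1 + j) ∨ 1 ≤ e ∧ (c 0 ≤ a 0 + j ∨ d 0 ≤ a 0 + e ∨ c 2 ≤ a 2 + j ∨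
        d 2 ≤ a 2 + j)) → False := by
    intro e j he hj h
    have : M ≤ M - 1 := by
      refine h₂.le_of_eval hϖ fun s hs _ => ?_
      obtain ⟨y, rfl⟩ := hs
      have hτ : ϖ ^ (M - 1) * y = -(ϖ ^ a 0 * -(ϖ ^ (M - 1 - a 0) * y)) := by
        rw [mul_neg, neg_neg, ← mul_assoc, ← pow_add]; congr 2; omega
      have hθ : x * ϖ ^ e * y = -(x * ϖ ^ (a 2 - a 1) * -(ϖ ^ (M - 1 - a 0) * y)) := by
        rw [he, pow_add]; ring
      have hj' : ϖ ^ j ∣ ϖ ^ (M - 1) * y - x * ϖ ^ e * y := by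
        rw [← sub_mul]; exact hj.mul_right _
      have he' : ϖ ^ e ∣ x * ϖ ^ e * y := Dvd.intro_left _ (by ring : x * y * ϖ ^ e = _)
      have hA : ϖ ∣ ϖ ^ a 0 := dvd_pow_self ϖ (by omega)
      refine hk.evalChar_row_one hϖ hτ hθ hA ?_
      rw [← mul_pow_eq_mul h12, mul_assoc (x : O) (ϖ ^ a 2)]
      refine h.imp (Or.imp ?_ ?_) (And.imp ?_ (Or.imp ?_ (Or.imp ?_ (Or.imp ?_ ?_)))) <;> intro h
      · exact pow_dvd_pow_mul he' h
      · exact pow_dvd_pow_mul hj' h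
      · exact dvd_of_pow_dvd_pos h he'
      · exact pow_dvd_pow_mul hj' h
      · exact pow_dvd_pow_mul he' h
      · exact (pow_dvd_pow_mul hj' h).mul_left _
      · exact (pow_dvd_pow_mul hj' h).mul_left _
    omega
  rcases lt_trichotomy (a 0 + a 1) (a 2) with h | h | h
  · refine Or.inl ⟨h, ?_⟩
    by_contra hn
    refine key _ (M - 1) rfl (dvd_sub dvd_rfl ((pow_dvd_pow ϖ (by omega)).mul_left _)) ?_
    omega
  · refine Or.inr (Or.inr ⟨h, ?_⟩)
    have he : a 2 - a 1 + (M - 1 - a 0) = M - 1 := by omega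
    refine ⟨?_, ?_⟩
    · by_contra hn
      refine key (M - 1) (M - 1) he.symm (dvd_sub dvd_rfl (dvd_rfl.mul_left _)) ?_
      omega
    · by_contra hn
      have hx := dvd_of_not_val_add_le hϖ hn
      rw [level'_natCast] at hx
      generalize hl : min (min (d 2 - a 2) (c 2 - a 2)) (min (c 0 - a 0) (d 1 - a 1)) = n at hx
      refine key (M - 1) (M - 1 + (n + 1 - M)) he.symm ?_ (by omega)
      · rw [show ϖ ^ (M - 1) - (x : O) * ϖ ^ (M - 1) = ϖ ^ (M - 1) * -((x : O) - 1) by ring]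
        exact pow_dvd_pow_mul (dvd_neg.2 hx) le_rfl
  · refine Or.inr (Or.inl ⟨h, ?_⟩)
    by_contra hn
    refine key _ _ rfl (dvd_sub (pow_dvd_pow ϖ (by omega)) (dvd_rfl.mul_left _)) ?_
    omega

/-- If one of the inequalities of the mixed condition fails, then a stabilizing pair of
`Admissible.evalChar_row_two` shows that `χ₂ χ₃⁻¹` is trivial on `1 + 𝔭^{N-1}`. -/
theorem mixedCond_of_row_two (hϖ : Irreducible ϖ) {χ₂ χ₃ : Oˣ →* ℂˣ} {M N : ℕ}
    (h₃ : HasConductor χ₃ N) (h₂₃ : HasConductor (χ₂ * χ₃⁻¹) N) {c d a : Fin 3 → ℕ}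
    (hc : Good M N c) (hd : Good M N d) {x : Oˣ} (h1 : 1 ≤ a 1)
    (h02 : a 0 ≤ a 2) (hk : Admissible χ₂ χ₃ ϖ c d (tRep ϖ (fun i => (a i : ℤ)) x))
    (hN1 : a 1 < N) :
    MixedCond (fun i => (c i : ℤ)) (fun i => (d i : ℤ)) (fun i => (a i : ℤ)) x N := by
  rw [tRep_eq, mul_pow_eq_mul h02] at hk
  rw [mixedCond_iff]
  obtain ⟨⟨c1, c2, c3⟩, hN, hcM, hcN⟩ := hc
  obtain ⟨⟨d1, d2, d3⟩, -, hdM, hdN⟩ := hd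
  -- violating one of the inequalities makes `χ₂ χ₃⁻¹` trivial on `1 + 𝔭^{N-1}`
  have key : ∀ e j : ℕ, e = a 2 - a 0 + (N - 1 - a 1) → ϖ ^ j ∣ ϖ ^ (N - 1) - x * ϖ ^ e →
      ((c 0 ≤ a 0 + j ∨ d 0 ≤ a 0 + e) ∨ 1 ≤ e ∧ (c 1 ≤ a 1 + e ∨ d 1 ≤ a 1 + j ∨ c 2 ≤ a 2 + j ∨
        d 2 ≤ a 2 + j)) → False := by
    intro e j he hj h
    have : N ≤ N - 1 := by
      refine h₂₃.le_of_eval hϖ fun s hs hu => ?_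
      rw [evalChar_mul_inv hu, mul_inv_eq_one₀ (evalChar_ne_zero _ _)]
      obtain ⟨y, rfl⟩ := hs
      have hτ : ϖ ^ (N - 1) * y = ϖ ^ a 1 * (ϖ ^ (N - 1 - a 1) * y) := by
        rw [← mul_assoc, ← pow_add]; congr 2; omega
      have hθ : x * ϖ ^ e * y = x * ϖ ^ (a 2 - a 0) * (ϖ ^ (N - 1 - a 1) * y) := by
        rw [he, pow_add]; ring
      have hj' : ϖ ^ j ∣ ϖ ^ (N - 1) * y - x * ϖ ^ e * y := by
        rw [← sub_mul]; exact hj.mul_right _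
      have he' : ϖ ^ e ∣ x * ϖ ^ e * y := Dvd.intro_left _ (by ring : x * y * ϖ ^ e = _)
      have hB : ϖ ∣ ϖ ^ a 1 := dvd_pow_self ϖ (by omega)
      have hττ : ϖ ^ N ∣ ϖ ^ (N - 1) * y * (ϖ ^ (N - 1) * y) := by
        rw [mul_assoc]
        exact pow_dvd_pow_mul (m := N - 1) ((dvd_mul_right _ _).mul_left y) (by omega)
      have hτθ : ϖ ∣ x * ϖ ^ e * y → ϖ ^ N ∣ ϖ ^ (N - 1) * y * (x * ϖ ^ e * y) := by
        intro hd
        rw [mul_assoc]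
        exact pow_dvd_pow_mul (m := 1) ((pow_one ϖ).symm ▸ hd.mul_left y) (by omega)
      refine hk.evalChar_row_two hϖ h₃ hτ hθ hB hττ hτθ ?_
      rw [← mul_pow_eq_mul h02, mul_assoc (x : O) (ϖ ^ a 2)]
      refine h.imp (Or.imp ?_ ?_) (And.imp ?_ (Or.imp ?_ (Or.imp ?_ (Or.imp ?_ ?_)))) <;> intro h
      · exact pow_dvd_pow_mul hj' h
      · exact pow_dvd_pow_mul he' h
      · exact dvd_of_pow_dvd_pos h he'
      · exact pow_dvd_pow_mul he' h
      · exact pow_dvd_pow_mul hj' h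
      · exact (pow_dvd_pow_mul hj' h).mul_left _
      · exact (pow_dvd_pow_mul hj' h).mul_left _
    omega
  rcases lt_trichotomy (a 0 + a 1) (a 2) with h | h | h
  · refine Or.inl ⟨h, ?_⟩
    by_contra hn
    refine key _ (N - 1) rfl (dvd_sub dvd_rfl ((pow_dvd_pow ϖ (by omega)).mul_left _)) ?_
    omega
  · refine Or.inr (Or.inr ⟨h, ?_⟩)
    have he : a 2 - a 0 + (N - 1 - a 1) = N - 1 := by omega
    refine ⟨?_, ?_⟩
    · by_contra hn
      refine key (N - 1) (N - 1) he.symm (dvd_sub dvd_rfl (dvd_rfl.mul_left _)) ?_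
      omega
    · by_contra hn
      have hx := dvd_of_not_val_add_le hϖ hn
      rw [level'_natCast] at hx
      generalize hl : min (min (d 2 - a 2) (c 2 - a 2)) (min (c 0 - a 0) (d 1 - a 1)) = n at hx
      refine key (N - 1) (N - 1 + (n + 1 - N)) he.symm ?_ (by omega)
      · rw [show ϖ ^ (N - 1) - (x : O) * ϖ ^ (N - 1) = ϖ ^ (N - 1) * -((x : O) - 1) by ring]
        exact pow_dvd_pow_mul (dvd_neg.2 hx) le_rfl
  · refine Or.inr (Or.inl ⟨h, ?_⟩)
    by_contra hn
    refine key _ _ rfl (dvd_sub (pow_dvd_pow ϖ (by omega)) (dvd_rfl.mul_left _)) ?_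
    omega

theorem isUnit_one_sub_or_one_add (h2 : IsUnit (2 : O)) (y : O) :
    IsUnit (1 - y) ∨ IsUnit (1 + y) := by
  apply IsLocalRing.isUnit_or_isUnit_of_isUnit_add
  convert h2 using 1; ring

/-- At least one of `a₁`, `a₂` is not below the conductor `N`, by the upper triangular stabilizing
pairs. This uses that `2` is a unit. -/
theorem le_max_of_admissible (hϖ : Irreducible ϖ) (h2 : IsUnit (2 : O)) {χ₂ χ₃ : Oˣ →* ℂˣ}
    {N : ℕ} (h₃ : HasConductor χ₃ N) {c d a : Fin 3 → ℕ} {x : Oˣ} (h0 : 1 ≤ a 0)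
    (h02 : a 0 ≤ a 2) (h12 : a 1 ≤ a 2)
    (hk : Admissible χ₂ χ₃ ϖ c d (tRep ϖ (fun i => (a i : ℤ)) x)) :
    N ≤ a 0 ∨ N ≤ a 1 := by
  by_contra! hlt
  rw [tRep_eq] at hk
  have hunit : ∀ y : O, IsUnit (1 - ϖ ^ (N - 1) * y) := fun y =>
    isUnit_one_sub hϖ ((dvd_pow_self ϖ (by omega)).mul_right _)
  have key : ∃ e : ℕ, ∀ y : O, IsUnit (1 - x * ϖ ^ e * y) →
      evalChar χ₃ (1 - ϖ ^ (N - 1) * y) = 1 := by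
    rcases le_total (a 0) (a 1) with h | h
    · refine ⟨a 2 - a 0 + (N - 1 - a 1), fun y hu => ?_⟩
      refine hk.evalChar_upper (t := ϖ ^ (N - 1 - a 0) * y) (v := ϖ ^ (N - 1 - a 1) * y)
        ?_ ?_ ?_ ?_ (hunit y) hu
      · rw [← mul_assoc, ← pow_add]; congr 2; omega
      · rw [← mul_assoc, ← pow_add]; congr 2; omega
      · rw [show ϖ ^ a 1 * (x * ϖ ^ (a 2 - a 0 + (N - 1 - a 1)) * y) =
          x * y * (ϖ ^ a 1 * ϖ ^ (a 2 - a 0 + (N - 1 - a 1))) by ring,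
          show x * ϖ ^ a 2 * (ϖ ^ (N - 1 - a 0) * y) = x * y * (ϖ ^ a 2 * ϖ ^ (N - 1 - a 0)) by ring,
          ← pow_add, ← pow_add]
        congr 2; omega
      · rw [show ϖ ^ a 0 * (x * ϖ ^ (a 2 - a 0 + (N - 1 - a 1)) * y) =
          x * y * (ϖ ^ a 0 * ϖ ^ (a 2 - a 0 + (N - 1 - a 1))) by ring,
          show x * ϖ ^ a 2 * (ϖ ^ (N - 1 - a 1) * y) = x * y * (ϖ ^ a 2 * ϖ ^ (N - 1 - a 1)) by ring,
          ← pow_add, ← pow_add]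
        congr 2; omega
    · refine ⟨a 2 - a 1 + (N - 1 - a 0), fun y hu => ?_⟩
      refine hk.evalChar_upper (t := ϖ ^ (N - 1 - a 0) * y) (v := ϖ ^ (N - 1 - a 1) * y)
        ?_ ?_ ?_ ?_ (hunit y) hu
      · rw [← mul_assoc, ← pow_add]; congr 2; omega
      · rw [← mul_assoc, ← pow_add]; congr 2; omega
      · rw [show ϖ ^ a 1 * (x * ϖ ^ (a 2 - a 1 + (N - 1 - a 0)) * y) =
          x * y * (ϖ ^ a 1 * ϖ ^ (a 2 - a 1 + (N - 1 - a 0))) by ring,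
          show x * ϖ ^ a 2 * (ϖ ^ (N - 1 - a 0) * y) = x * y * (ϖ ^ a 2 * ϖ ^ (N - 1 - a 0)) by ring,
          ← pow_add, ← pow_add]
        congr 2; omega
      · rw [show ϖ ^ a 0 * (x * ϖ ^ (a 2 - a 1 + (N - 1 - a 0)) * y) =
          x * y * (ϖ ^ a 0 * ϖ ^ (a 2 - a 1 + (N - 1 - a 0))) by ring,
          show x * ϖ ^ a 2 * (ϖ ^ (N - 1 - a 1) * y) = x * y * (ϖ ^ a 2 * ϖ ^ (N - 1 - a 1)) by ring,
          ← pow_add, ← pow_add]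
        congr 2; omega
  obtain ⟨e, key⟩ := key
  have : N ≤ N - 1 := by
    refine h₃.le_of_eval hϖ fun s hs hu => ?_
    obtain ⟨y, rfl⟩ := hs
    -- the pair for `y` or the pair for `-y` is invertible, since `2` is a unit
    rcases isUnit_one_sub_or_one_add h2 (x * ϖ ^ e * y) with h | h
    · have e1 := key y h
      have e2 := evalChar_mul χ₃ (hunit y) hu
      rw [e1, one_mul] at e2
      rw [← e2, ← evalChar_one χ₃]
      refine h₃.congr hϖ ((hunit y).mul hu) isUnit_one ?_
      rw [show (1 - ϖ ^ (N - 1) * y) * (1 + ϖ ^ (N - 1) * y) - 1 =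
        ϖ ^ (N - 1) * (ϖ ^ (N - 1) * -(y * y)) by ring]
      exact pow_dvd_pow_mul (m := N - 1) (dvd_mul_right _ _) (by omega)
    · have e1 := key (-y) (by rwa [mul_neg, sub_neg_eq_add])
      rwa [mul_neg, sub_neg_eq_add] at e1
  omega

/-- The conditions (1), (2), (3) describe the admissible `t_{a,x}`. If `a₁ ≥ M` and `a₂ ≥ N`, the
stabilizer equations give all congruences at once; otherwise `dvd_sub_of_mixedCond` supplies the
congruence of the middle diagonal entries. -/
theorem admissible_t_iff (hϖ : Irreducible ϖ) (h2 : IsUnit (2 : O)) {χ₂ χ₃ : Oˣ →* ℂˣ} {M N : ℕ}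
    (hMN : M ≤ N) (h₂ : HasConductor χ₂ M) (h₃ : HasConductor χ₃ N)
    (h₂₃ : HasConductor (χ₂ * χ₃⁻¹) N) {c d a : Fin 3 → ℕ} (hc : Good M N c) (hd : Good M N d)
    {x : Oˣ} (h0 : 1 ≤ a 0) (h1 : 1 ≤ a 1) (h02 : a 0 ≤ a 2) (h12 : a 1 ≤ a 2) :
    Admissible χ₂ χ₃ ϖ c d (tRep ϖ (fun i => (a i : ℤ)) x) ↔
      TCond M N (fun i => (c i : ℤ)) (fun i => (d i : ℤ)) (fun i => (a i : ℤ)) x := by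
  unfold TCond
  simp only [Nat.cast_le, Nat.cast_lt]
  constructor
  · intro hk
    rcases lt_or_ge (a 0) M with hM | hM
    · have hN : N ≤ a 1 := by
        rcases le_max_of_admissible hϖ h2 h₃ h0 h02 h12 hk with h | h
        · omega
        · exact h
      exact Or.inr (Or.inl ⟨hM, hN, mixedCond_of_row_one hϖ h₂ hc hd h0 h12 hk hM⟩)
    · rcases lt_or_ge (a 1) N with hN | hN
      · refine Or.inr (Or.inr ⟨?_, hN, mixedCond_of_row_two hϖ h₃ h₂₃ hc hd h1 h02 hk hN⟩)
        rcases le_max_of_admissible hϖ h2 h₃ h0 h02 h12 hk with h | h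
        · exact h
        · omega
      · exact Or.inl ⟨hM, hN⟩
  · intro h g g' hg hg' e
    obtain ⟨⟨c1, c2, c3⟩, hN, hcM, hcN⟩ := hc
    obtain ⟨⟨d1, d2, d3⟩, -, hdM, hdN⟩ := hd
    have ug := (Matrix.isUnit_iff_isUnit_det _).1 g.isUnit
    have ug' := (Matrix.isUnit_iff_isUnit_det _).1 g'.isUnit
    have u3 := isUnit_corner hϖ (by omega) (by omega) hg ug
    have u3' := isUnit_corner hϖ (by omega) (by omega) hg' ug'
    rw [tRep_eq] at e
    have e' := congrArg Units.val e
    have E := entries_of_mul_eq e'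
    simp only [val_lowerForm] at E
    have E01 := E 0 1
    have E02 := E 0 2
    have E11 := E 1 1
    have E12 := E 1 2
    have E22 := E 2 2
    simp at E01 E02 E11 E12 E22
    have key : (N ≤ a 1 ∧ ϖ ^ M ∣ g'.val 1 1 - g.val 1 1) ∨
        (N ≤ a 0 ∧ ϖ ^ N ∣ g'.val 1 1 - g.val 1 1) := by
      rcases h with ⟨hM, hN⟩ | ⟨-, hN, h⟩ | ⟨hN, -, h⟩
      · refine Or.inl ⟨hN, ?_⟩
        rw [show g'.val 1 1 - g.val 1 1 = ϖ ^ a 1 * g.val 1 2 - ϖ ^ a 0 * g'.val 0 1 by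
          linear_combination -E11]
        exact dvd_sub (pow_dvd_pow_mul_left (by omega)) (pow_dvd_pow_mul_left (by omega))
      · exact Or.inl ⟨hN, dvd_sub_of_mixedCond hϖ h h02 h12 hg hg' e'⟩
      · exact Or.inr ⟨hN, dvd_sub_of_mixedCond hϖ h h02 h12 hg hg' e'⟩
    have r2 : evalChar χ₂ (g.val 1 1) = evalChar χ₂ (g'.val 1 1) := by
      rcases Nat.eq_zero_or_pos M with rfl | hM
      · rw [evalChar_eq_one_of_zero h₂, evalChar_eq_one_of_zero h₂]
      refine (h₂.congr hϖ (isUnit_diag hϖ (by omega) (by omega) (by omega) hg' ug').2.1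
        (isUnit_diag hϖ (by omega) (by omega) (by omega) hg ug).2.1 ?_).symm
      rcases key with h | h
      · exact h.2
      · exact pow_dvd_of_le h.2 hMN
    have r3 : evalChar χ₃ (g.val 2 2) = evalChar χ₃ (g'.val 2 2) := by
      refine h₃.congr hϖ u3 u3' ?_
      rcases key with h | h
      · rw [show g.val 2 2 - g'.val 2 2 = ϖ ^ a 2 * (x * g'.val 0 2) + ϖ ^ a 1 * g'.val 1 2 by
          linear_combination E22]
        exact dvd_add (pow_dvd_pow_mul_left (by omega)) (pow_dvd_pow_mul_left h.1)
      · rw [show g.val 2 2 - g'.val 2 2 = ϖ ^ a 2 * (x * g'.val 0 2) + (g'.val 1 1 - g.val 1 1) +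
          ϖ ^ a 0 * (g'.val 0 1 - ϖ ^ a 1 * g'.val 0 2) by
          linear_combination E22 + E11 - ϖ ^ a 1 * E12]
        exact dvd_add (dvd_add (pow_dvd_pow_mul_left (by omega)) h.2)
          (pow_dvd_pow_mul_left (by omega))
    unfold chi
    rw [r2, r3]

/-! ### Bruhat decomposition -/

theorem isUnit_or_dvd (hϖ : Irreducible ϖ) (x : O) : IsUnit x ∨ ϖ ∣ x := by
  rw [isUnit_iff_not_dvd hϖ]; tauto

theorem Rel.isUnit_det {c d : Fin 3 → ℕ} {K K' : Matrix (Fin 3) (Fin 3) O}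
    (h : Rel ϖ c d K K') (hK : IsUnit K.det) : IsUnit K'.det := by
  obtain ⟨G, H, uG, uH, -, -, e⟩ := h
  have := congrArg Matrix.det e
  rw [Matrix.det_mul, Matrix.det_mul] at this
  exact isUnit_of_mul_isUnit_left (this ▸ uG.mul hK)

/-- Upper triangular matrices act on both sides, whatever `c` and `d` are. -/
theorem rel_of_upper (c d : Fin 3 → ℕ) {K K' : Matrix (Fin 3) (Fin 3) O}
    {u₁ u₂ u₃ v₁ v₂ v₃ x y z x' y' z' : O} (hu₁ : IsUnit u₁) (hu₂ : IsUnit u₂) (hu₃ : IsUnit u₃)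
    (hv₁ : IsUnit v₁) (hv₂ : IsUnit v₂) (hv₃ : IsUnit v₃)
    (e : !![u₁, x, y; 0, u₂, z; 0, 0, u₃] * K = K' * !![v₁, x', y'; 0, v₂, z'; 0, 0, v₃]) :
    Rel ϖ c d K K' := by
  refine ⟨_, _, ?_, ?_, inC_lit (by simp) (by simp) (by simp),
    inC_lit (by simp) (by simp) (by simp), e⟩
  · rw [det_lit]; convert (hu₁.mul hu₂).mul hu₃ using 1; ring
  · rw [det_lit]; convert (hv₁.mul hv₂).mul hv₃ using 1; ring

/-- The matrix underlying `lowerForm A B X`. -/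
def lowerMat (A B X : O) : Matrix (Fin 3) (Fin 3) O := !![1, 0, 0; A, 1, 0; X, B, 1]

theorem IsUnit.of_right_inv {x y : O} (h : x * y = 1) : IsUnit x ∧ IsUnit y :=
  ⟨IsUnit.of_mul_eq_one _ h, IsUnit.of_mul_eq_one _ (mul_comm x y ▸ h)⟩

/-- Matrices with a unit at the place `31`, by column operations with pivots from the bottom row. -/
theorem bruhat_of_isUnit_20 (hϖ : Irreducible ϖ) {c d : Fin 3 → ℕ} (hc : InT c) (hd : InT d)
    {a b e f g h i j k : O} (hK : IsUnit (!![a, b, e; f, g, h; i, j, k]).det) (hi : IsUnit i) :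
    (∃ z, Rel ϖ c d !![a, b, e; f, g, h; i, j, k] (s2s1Form z).val) ∨
      Rel ϖ c d !![a, b, e; f, g, h; i, j, k] (w0Rep O).val := by
  obtain ⟨v, hv⟩ := hi.exists_right_inv
  have hr : Rel ϖ c d !![a, b, e; f, g, h; i, j, k]
      !![0, b - a * v * j, e - a * v * k; 0, g - f * v * j, h - f * v * k; 1, 0, 0] := by
    refine rel_of_upper c d (u₁ := 1) (x := 0) (y := -(a * v)) (u₂ := 1) (z := -(f * v)) (u₃ := v)
      (v₁ := 1) (x' := v * j) (y' := v * k) (v₂ := 1) (z' := 0) (v₃ := 1)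
      isUnit_one isUnit_one (IsUnit.of_right_inv hv).2 isUnit_one isUnit_one isUnit_one ?_
    rw [Matrix.mul_fin_three, Matrix.mul_fin_three]
    apply mat3_ext <;> first | ring1 | linear_combination hv | linear_combination -a * hv |
      linear_combination -f * hv
  generalize b - a * v * j = b' at hr
  generalize e - a * v * k = e' at hr
  generalize g - f * v * j = g' at hr
  generalize h - f * v * k = h' at hr
  have hdet := hr.isUnit_det hK
  rw [det_lit] at hdet
  rcases isUnit_or_dvd hϖ g' with hg | hg
  · obtain ⟨w, hw⟩ := hg.exists_right_inv
    refine Or.inr (hr.trans hc hd ?_)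
    have hδ : IsUnit (e' - b' * w * h') := by
      apply isUnit_of_mul_isUnit_left (y := -g')
      convert hdet using 1
      linear_combination b' * h' * hw
    refine rel_of_upper c d (u₁ := 1) (x := -(b' * w)) (y := 0) (u₂ := w) (z := 0) (u₃ := 1)
      (v₁ := 1) (x' := 0) (y' := 0) (v₂ := 1) (z' := w * h') (v₃ := e' - b' * w * h')
      isUnit_one (IsUnit.of_right_inv hw).2 isUnit_one isUnit_one isUnit_one hδ ?_
    change _ = !![0, 0, 1; 0, 1, 0; 1, 0, 0] * _
    rw [Matrix.mul_fin_three, Matrix.mul_fin_three]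
    apply mat3_ext <;> first | ring1 | linear_combination hw | linear_combination -b' * hw
  · have hb : IsUnit (b' * h') := by
      have := IsUnit.add_dvd hϖ hdet (hg.mul_left e')
      convert this using 1; ring
    have hb' := isUnit_of_mul_isUnit_left hb
    have hh' := isUnit_of_mul_isUnit_right hb
    obtain ⟨w, hw⟩ := hb'.exists_right_inv
    refine Or.inl ⟨g' * w, hr.trans hc hd ?_⟩
    have hδ : IsUnit (h' - g' * w * e') := IsUnit.sub_dvd hϖ hh' ((hg.mul_right _).mul_right _)
    refine rel_of_upper c d (u₁ := 1) (x := 0) (y := 0) (u₂ := 1) (z := 0) (u₃ := 1)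
      (v₁ := 1) (x' := 0) (y' := 0) (v₂ := b') (z' := e') (v₃ := h' - g' * w * e')
      isUnit_one isUnit_one isUnit_one isUnit_one hb' hδ ?_
    change _ = !![0, 1, 0; 0, g' * w, 1; 1, 0, 0] * _
    rw [Matrix.mul_fin_three, Matrix.mul_fin_three]
    apply mat3_ext <;> first | ring1 | linear_combination -g' * hw

/-- Matrices whose last row has its first unit at the place `32`. -/
theorem bruhat_of_isUnit_21 (hϖ : Irreducible ϖ) {c d : Fin 3 → ℕ} (hc : InT c) (hd : InT d)
    {a b e f g h i j k : O} (hK : IsUnit (!![a, b, e; f, g, h; i, j, k]).det) (hj : IsUnit j)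
    (hi : ϖ ∣ i) :
    (∃ z, Rel ϖ c d !![a, b, e; f, g, h; i, j, k] (s1s2Form z).val) ∨
      ∃ Z Y, ϖ ∣ Z ∧ ϖ ∣ Y ∧ Rel ϖ c d !![a, b, e; f, g, h; i, j, k] (s2Form Z Y).val := by
  obtain ⟨v, hv⟩ := hj.exists_right_inv
  have hr : Rel ϖ c d !![a, b, e; f, g, h; i, j, k]
      !![a - b * v * i, 0, e - b * v * k; f - g * v * i, 0, h - g * v * k; v * i, 1, 0] := by
    refine rel_of_upper c d (u₁ := 1) (x := 0) (y := -(b * v)) (u₂ := 1) (z := -(g * v)) (u₃ := v)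
      (v₁ := 1) (x' := 0) (y' := 0) (v₂ := 1) (z' := v * k) (v₃ := 1)
      isUnit_one isUnit_one (IsUnit.of_right_inv hv).2 isUnit_one isUnit_one isUnit_one ?_
    rw [Matrix.mul_fin_three, Matrix.mul_fin_three]
    apply mat3_ext <;> first | ring1 | linear_combination hv | linear_combination -b * hv |
      linear_combination -g * hv
  have hi' : ϖ ∣ v * i := hi.mul_left v
  generalize a - b * v * i = a' at hr
  generalize e - b * v * k = e' at hr
  generalize f - g * v * i = f' at hr
  generalize h - g * v * k = h' at hr
  generalize v * i = i' at hr hi'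
  have hdet := hr.isUnit_det hK
  rw [det_lit] at hdet
  rcases isUnit_or_dvd hϖ f' with hf | hf
  · obtain ⟨w, hw⟩ := hf.exists_right_inv
    refine Or.inl ⟨i', hr.trans hc hd ?_⟩
    have hδ : IsUnit (e' - a' * w * h') := by
      apply isUnit_of_mul_isUnit_left (y := f')
      convert hdet using 1
      linear_combination -a' * h' * hw
    refine rel_of_upper c d (u₁ := 1) (x := -(a' * w)) (y := 0) (u₂ := w) (z := 0) (u₃ := 1)
      (v₁ := 1) (x' := 0) (y' := w * h') (v₂ := 1) (z' := -(i' * w * h'))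
      (v₃ := e' - a' * w * h')
      isUnit_one (IsUnit.of_right_inv hw).2 isUnit_one isUnit_one isUnit_one hδ ?_
    change _ = !![0, 0, 1; 1, 0, 0; i', 1, 0] * _
    rw [Matrix.mul_fin_three, Matrix.mul_fin_three]
    apply mat3_ext <;> first | ring1 | linear_combination hw | linear_combination -a' * hw
  · have ha : IsUnit (a' * h') := by
      have := (IsUnit.sub_dvd hϖ hdet (hf.mul_left e')).neg
      convert this using 1; ring
    have ha' := isUnit_of_mul_isUnit_left ha
    have hh' := isUnit_of_mul_isUnit_right ha
    obtain ⟨w, hw⟩ := hh'.exists_right_inv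
    have hδ : IsUnit (a' - e' * w * f') := IsUnit.sub_dvd hϖ ha' (hf.mul_left _)
    obtain ⟨y, hy⟩ := hδ.exists_right_inv
    refine Or.inr ⟨f' * y, i' * y, hf.mul_right _, hi'.mul_right _, hr.trans hc hd ?_⟩
    refine rel_of_upper c d (u₁ := 1) (x := -(e' * w)) (y := 0) (u₂ := 1) (z := 0) (u₃ := 1)
      (v₁ := a' - e' * w * f') (x' := 0) (y' := 0) (v₂ := 1) (z' := 0) (v₃ := h')
      isUnit_one isUnit_one isUnit_one hδ isUnit_one hh' ?_
    rw [val_s2Form, Matrix.mul_fin_three, Matrix.mul_fin_three]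
    apply mat3_ext <;> first | ring1 | linear_combination -e' * hw | linear_combination -f' * hy |
      linear_combination -i' * hy

/-- Matrices whose last row is `(0, 0, *)` modulo `𝔭`. -/
theorem bruhat_of_dvd_row (hϖ : Irreducible ϖ) {c d : Fin 3 → ℕ} (hc : InT c) (hd : InT d)
    {a b e f g h i j k : O} (hK : IsUnit (!![a, b, e; f, g, h; i, j, k]).det)
    (hi : ϖ ∣ i) (hj : ϖ ∣ j) :
    (∃ Z Y, ϖ ∣ Z ∧ ϖ ∣ Y ∧ Rel ϖ c d !![a, b, e; f, g, h; i, j, k] (s1Form Z Y).val) ∨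
      ∃ A B X, ϖ ∣ A ∧ ϖ ∣ B ∧ ϖ ∣ X ∧
        Rel ϖ c d !![a, b, e; f, g, h; i, j, k] (lowerMat A B X) := by
  have hk : IsUnit k := by
    rw [det_lit] at hK
    have := IsUnit.sub_dvd hϖ hK (dvd_add (hi.mul_right (b * h - e * g))
      (hj.mul_right (e * f - a * h)))
    apply isUnit_of_mul_isUnit_left (y := a * g - b * f)
    convert this using 1; ring
  obtain ⟨v, hv⟩ := hk.exists_right_inv
  have hr : Rel ϖ c d !![a, b, e; f, g, h; i, j, k]
      !![a - e * v * i, b - e * v * j, 0; f - h * v * i, g - h * v * j, 0; v * i, v * j, 1] := by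
    refine rel_of_upper c d (u₁ := 1) (x := 0) (y := -(e * v)) (u₂ := 1) (z := -(h * v)) (u₃ := v)
      (v₁ := 1) (x' := 0) (y' := 0) (v₂ := 1) (z' := 0) (v₃ := 1)
      isUnit_one isUnit_one (IsUnit.of_right_inv hv).2 isUnit_one isUnit_one isUnit_one ?_
    rw [Matrix.mul_fin_three, Matrix.mul_fin_three]
    apply mat3_ext <;> first | ring1 | linear_combination hv | linear_combination -e * hv |
      linear_combination -h * hv
  have hi' : ϖ ∣ v * i := hi.mul_left v
  have hj' : ϖ ∣ v * j := hj.mul_left v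
  generalize a - e * v * i = a' at hr
  generalize b - e * v * j = b' at hr
  generalize f - h * v * i = f' at hr
  generalize g - h * v * j = g' at hr
  generalize v * i = i' at hr hi'
  generalize v * j = j' at hr hj'
  have hdet := hr.isUnit_det hK
  rw [det_lit] at hdet
  rcases isUnit_or_dvd hϖ f' with hf | hf
  · obtain ⟨w, hw⟩ := hf.exists_right_inv
    have hδ : IsUnit (b' - a' * w * g') := by
      apply isUnit_of_mul_isUnit_left (y := -f')
      convert hdet using 1
      linear_combination a' * g' * hw
    obtain ⟨y, hy⟩ := hδ.exists_right_inv
    refine Or.inl ⟨i', (j' - i' * w * g') * y, hi',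
      (dvd_sub hj' ((hi'.mul_right _).mul_right _)).mul_right _, hr.trans hc hd ?_⟩
    refine rel_of_upper c d (u₁ := 1) (x := -(a' * w)) (y := 0) (u₂ := w) (z := 0) (u₃ := 1)
      (v₁ := 1) (x' := w * g') (y' := 0) (v₂ := b' - a' * w * g') (z' := 0)
      (v₃ := 1)
      isUnit_one (IsUnit.of_right_inv hw).2 isUnit_one isUnit_one hδ isUnit_one ?_
    rw [val_s1Form, Matrix.mul_fin_three, Matrix.mul_fin_three]
    apply mat3_ext <;> first | ring1 | linear_combination hw | linear_combination -a' * hw |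
      linear_combination -(j' - i' * w * g') * hy
  · have ha : IsUnit (a' * g') := by
      have := IsUnit.add_dvd hϖ hdet (hf.mul_left b')
      convert this using 1; ring
    have ha' := isUnit_of_mul_isUnit_left ha
    have hg' := isUnit_of_mul_isUnit_right ha
    obtain ⟨w, hw⟩ := hg'.exists_right_inv
    have hδ : IsUnit (a' - b' * w * f') := IsUnit.sub_dvd hϖ ha' (hf.mul_left _)
    obtain ⟨y, hy⟩ := hδ.exists_right_inv
    refine Or.inr ⟨f' * y, j' * w, i' * y, hf.mul_right _, hj'.mul_right _, hi'.mul_right _,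
      hr.trans hc hd ?_⟩
    refine rel_of_upper c d (u₁ := 1) (x := -(b' * w)) (y := 0) (u₂ := 1) (z := 0) (u₃ := 1)
      (v₁ := a' - b' * w * f') (x' := 0) (y' := 0) (v₂ := g') (z' := 0) (v₃ := 1)
      isUnit_one isUnit_one isUnit_one hδ hg' isUnit_one ?_
    rw [lowerMat, Matrix.mul_fin_three, Matrix.mul_fin_three]
    apply mat3_ext <;> first | ring1 | linear_combination -b' * hw | linear_combination -f' * hy |
      linear_combination -i' * hy | linear_combination -j' * hw

/-! ### Elementary moves on lower unipotent matrices -/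

section moves

variable {c d : Fin 3 → ℕ} {A B X Y : O}

/-- Diagonal matrices rescale `A` and `B` by independent units. -/
theorem rel_torus {α β : O} (hα : IsUnit α) (hβ : IsUnit β) :
    Rel ϖ c d (lowerMat (A * α) (B * β) (X * (α * β))) (lowerMat A B X) := by
  obtain ⟨α', hα'⟩ := hα.exists_right_inv
  obtain ⟨β', hβ'⟩ := hβ.exists_right_inv
  refine rel_of_upper c d (u₁ := α) (x := 0) (y := 0) (u₂ := 1) (z := 0) (u₃ := β')
      (v₁ := α) (x' := 0) (y' := 0) (v₂ := 1) (z' := 0) (v₃ := β')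
      hα isUnit_one (IsUnit.of_right_inv hβ').2 hα isUnit_one (IsUnit.of_right_inv hβ').2 ?_
  rw [lowerMat, lowerMat, Matrix.mul_fin_three, Matrix.mul_fin_three]
  apply mat3_ext <;> first | ring1 | linear_combination B * hβ' | linear_combination X * α * hβ'

theorem rel_left_21 {s : O} (hs : ϖ ^ c 0 ∣ s) :
    Rel ϖ c d (lowerMat A B X) (lowerMat (A + s) B X) := by
  refine ⟨!![1, 0, 0; s, 1, 0; 0, 0, 1], 1, by simp [det_lit], by simp,
    inC_lit hs (by simp) (by simp), InC.one _ _, ?_⟩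
  rw [mul_one, lowerMat, lowerMat, Matrix.mul_fin_three]
  apply mat3_ext <;> ring

theorem rel_left_32 {s : O} (hs : ϖ ^ c 1 ∣ s) :
    Rel ϖ c d (lowerMat A B X) (lowerMat A (B + s) (X + s * A)) := by
  refine ⟨!![1, 0, 0; 0, 1, 0; 0, s, 1], 1, by simp [det_lit], by simp,
    inC_lit (by simp) hs (by simp), InC.one _ _, ?_⟩
  rw [mul_one, lowerMat, lowerMat, Matrix.mul_fin_three]
  apply mat3_ext <;> ring

theorem rel_left_31 {s : O} (hs : ϖ ^ c 2 ∣ s) :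
    Rel ϖ c d (lowerMat A B X) (lowerMat A B (X + s)) := by
  refine ⟨!![1, 0, 0; 0, 1, 0; s, 0, 1], 1, by simp [det_lit], by simp,
    inC_lit (by simp) (by simp) hs, InC.one _ _, ?_⟩
  rw [mul_one, lowerMat, lowerMat, Matrix.mul_fin_three]
  apply mat3_ext <;> ring

theorem rel_right_21 {s : O} (hs : ϖ ^ d 0 ∣ s) :
    Rel ϖ c d (lowerMat A B X) (lowerMat (A + s) B (X + B * s)) := by
  refine ⟨1, !![1, 0, 0; -s, 1, 0; 0, 0, 1], by simp, by simp [det_lit], InC.one _ _,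
    inC_lit (dvd_neg.2 hs) (by simp) (by simp), ?_⟩
  rw [one_mul, lowerMat, lowerMat, Matrix.mul_fin_three]
  apply mat3_ext <;> ring

theorem rel_right_32 {s : O} (hs : ϖ ^ d 1 ∣ s) :
    Rel ϖ c d (lowerMat A B X) (lowerMat A (B + s) X) := by
  refine ⟨1, !![1, 0, 0; 0, 1, 0; 0, -s, 1], by simp, by simp [det_lit], InC.one _ _,
    inC_lit (by simp) (dvd_neg.2 hs) (by simp), ?_⟩
  rw [one_mul, lowerMat, lowerMat, Matrix.mul_fin_three]
  apply mat3_ext <;> ring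

theorem rel_right_31 {s : O} (hs : ϖ ^ d 2 ∣ s) :
    Rel ϖ c d (lowerMat A B X) (lowerMat A B (X + s)) := by
  refine ⟨1, !![1, 0, 0; 0, 1, 0; -s, 0, 1], by simp, by simp [det_lit], InC.one _ _,
    inC_lit (by simp) (by simp) (dvd_neg.2 hs), ?_⟩
  rw [one_mul, lowerMat, lowerMat, Matrix.mul_fin_three]
  apply mat3_ext <;> ring

/-- The effect of the upper unipotent elements in the place `12`. -/
theorem rel_upper_12 {t : O} (ht : IsUnit (1 + t * A)) :
    Rel ϖ c d (lowerMat A B X) (lowerMat A (B + t * (A * B - X)) X) := by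
  refine rel_of_upper c d (u₁ := 1) (x := t) (y := 0) (u₂ := 1 + t * A) (z := 0)
    (u₃ := 1 + t * A) (v₁ := 1 + t * A) (x' := t) (y' := 0) (v₂ := 1) (z' := 0) (v₃ := 1 + t * A)
    isUnit_one ht ht ht isUnit_one ht ?_
  rw [lowerMat, lowerMat, Matrix.mul_fin_three, Matrix.mul_fin_three]
  apply mat3_ext <;> ring

/-- The effect of the upper unipotent elements in the place `23`. -/
theorem rel_upper_23 {t : O} (ht : IsUnit (1 + t * B)) :
    Rel ϖ c d (lowerMat A B X) (lowerMat (A + t * X) B (X * (1 + t * B))) := by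
  refine rel_of_upper c d (u₁ := 1) (x := 0) (y := 0) (u₂ := 1) (z := t)
    (u₃ := 1 + t * B) (v₁ := 1) (x' := 0) (y' := 0) (v₂ := 1 + t * B) (z' := t) (v₃ := 1)
    isUnit_one isUnit_one ht isUnit_one ht isUnit_one ?_
  rw [lowerMat, lowerMat, Matrix.mul_fin_three, Matrix.mul_fin_three]
  apply mat3_ext <;> ring

end moves

/-! ### Equivalent parameters give the same double coset -/

section sameParam

variable {c d : Fin 3 → ℕ} {A B X Y : O}

theorem rel_torus' {α β A' B' X' : O} (hα : IsUnit α) (hβ : IsUnit β) (hA : A' = A * α)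
    (hB : B' = B * β) (hX : X' = X * (α * β)) :
    Rel ϖ c d (lowerMat A' B' X') (lowerMat A B X) := by
  subst hA hB hX
  exact rel_torus hα hβ

/-- Moves with the elementary subgroups at the place `31`, and at `21` on the left and `32` on the
right, change the parameter `x` by a small amount. -/
theorem rel_of_dvd_sub (hc : InT c) (hd : InT d) {p q r v : ℕ} (x y : Oˣ)
    (hv : ϖ ^ v ∣ (x : O) - y)
    (h : c 2 ≤ r + v ∨ d 2 ≤ r + v ∨ c 0 ≤ p + v ∨ d 1 ≤ q + v) :
    Rel ϖ c d (lowerMat (ϖ ^ p) (ϖ ^ q) (x * ϖ ^ r)) (lowerMat (ϖ ^ p) (ϖ ^ q) (y * ϖ ^ r)) := by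
  obtain ⟨s, hs⟩ := hv
  obtain ⟨y', hy'⟩ := y.isUnit.exists_right_inv
  have hxy : IsUnit ((x : O) * y') := x.isUnit.mul (IsUnit.of_right_inv hy').2
  have h31 : ∀ n, n ≤ r + v → ϖ ^ n ∣ -(ϖ ^ r * (x - y : O)) := by
    intro n hn
    rw [hs, ← mul_assoc, ← pow_add]
    exact ((pow_dvd_pow ϖ hn).mul_right _).neg_right
  have h1 : ∀ k n, n ≤ k + v → ϖ ^ n ∣ ϖ ^ k * (x * y' - 1 : O) := by
    intro k n hn
    have : ϖ ^ k * (x * y' - 1 : O) = ϖ ^ (k + v) * (s * y') := by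
      rw [pow_add]
      linear_combination ϖ ^ k * y' * hs + ϖ ^ k * hy'
    rw [this]
    exact (pow_dvd_pow ϖ hn).mul_right _
  rcases h with h | h | h | h
  · convert rel_left_31 (A := ϖ ^ p) (B := ϖ ^ q) (X := x * ϖ ^ r) (d := d) (h31 _ h) using 2
    ring
  · convert rel_right_31 (A := ϖ ^ p) (B := ϖ ^ q) (X := x * ϖ ^ r) (c := c) (h31 _ h) using 2
    ring
  · refine (rel_left_21 (h1 _ _ h)).trans hc hd (rel_torus' hxy isUnit_one ?_ ?_ ?_)
    · ring
    · ring
    · linear_combination -(x * ϖ ^ r : O) * hy'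
  · refine (rel_right_32 (h1 _ _ h)).trans hc hd (rel_torus' isUnit_one hxy ?_ ?_ ?_)
    · ring
    · ring
    · linear_combination -(x * ϖ ^ r : O) * hy'

/-- The moves whose effect on `x` depends on the valuation `e` of `A B - X`: those with upper
unipotent elements, and those at the place `32` on the left and `21` on the right. -/
theorem rel_of_dvd_sub' (hϖ : Irreducible ϖ) (hc : InT c) (hd : InT d) {p q r v e : ℕ}
    (hp : 1 ≤ p) (hq : 1 ≤ q) (x y : Oˣ) {u w : O} (hu : IsUnit u) (hw : IsUnit w)
    (hx : ϖ ^ p * ϖ ^ q - x * ϖ ^ r = ϖ ^ e * u) (hy : ϖ ^ p * ϖ ^ q - y * ϖ ^ r = ϖ ^ e * w)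
    (hv : ϖ ^ v ∣ (x : O) - y)
    (h : e ≤ q + v ∨ e ≤ p + v ∨ c 1 + e ≤ r + q + v ∨ d 0 + e ≤ p + r + v) :
    Rel ϖ c d (lowerMat (ϖ ^ p) (ϖ ^ q) (x * ϖ ^ r)) (lowerMat (ϖ ^ p) (ϖ ^ q) (y * ϖ ^ r)) := by
  obtain ⟨s, hs⟩ := hv
  obtain ⟨x', hx'⟩ := x.isUnit.exists_right_inv
  obtain ⟨y', hy'⟩ := y.isUnit.exists_right_inv
  obtain ⟨u', hu'⟩ := hu.exists_right_inv
  obtain ⟨w', hw'⟩ := hw.exists_right_inv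
  have hxy : IsUnit ((x : O) * y') := x.isUnit.mul (IsUnit.of_right_inv hy').2
  have huw : IsUnit (u * w') := hu.mul (IsUnit.of_right_inv hw').2
  have hp' : ϖ ∣ ϖ ^ p := dvd_pow_self _ (by omega)
  have hq' : ϖ ∣ ϖ ^ q := dvd_pow_self _ (by omega)
  have h1 : ∀ k n, n + e ≤ k + r + v → ϖ ^ n ∣ ϖ ^ k * (u * w' - 1) := by
    intro k n hn
    apply pow_dvd_cancel hϖ (a := e)
    have : ϖ ^ e * (ϖ ^ k * (u * w' - 1)) = ϖ ^ (k + r + v) * (-(s * w')) := by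
      rw [pow_add, pow_add]
      linear_combination - ϖ ^ k * w' * hx + ϖ ^ k * w' * hy - ϖ ^ k * ϖ ^ r * w' * hs +
        ϖ ^ k * ϖ ^ e * hw'
    rw [this]
    exact (pow_dvd_pow ϖ (by omega)).mul_right _
  rcases h with h | h | h | h
  · obtain ⟨n, hn⟩ := Nat.exists_eq_add_of_le h
    have hn' : ϖ ^ q * ϖ ^ v = ϖ ^ e * ϖ ^ n := by rw [← pow_add, hn, pow_add]
    refine (rel_upper_12 (t := ϖ ^ n * s * y' * u') (isUnit_one_add hϖ (hp'.mul_left _))).trans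
      hc hd (rel_torus' isUnit_one hxy ?_ ?_ ?_)
    · ring
    · rw [hx]
      linear_combination ϖ ^ e * ϖ ^ n * s * y' * hu' - s * y' * hn' - ϖ ^ q * y' * hs
        - ϖ ^ q * hy'
    · linear_combination -(x * ϖ ^ r : O) * hy'
  · obtain ⟨n, hn⟩ := Nat.exists_eq_add_of_le h
    have hn' : ϖ ^ p * ϖ ^ v = ϖ ^ e * ϖ ^ n := by rw [← pow_add, hn, pow_add]
    have ht : IsUnit (1 + -(ϖ ^ n * s * x' * w') * ϖ ^ q) :=
      isUnit_one_add hϖ (hq'.mul_left _)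
    refine (rel_upper_23 ht).trans hc hd (rel_torus' (hxy.mul ht) isUnit_one ?_ ?_ ?_)
    · apply mul_left_cancel₀ y.isUnit.ne_zero
      have e1 : (y : O) * (ϖ ^ p * (x * y' * (1 + -(ϖ ^ n * s * x' * w') * ϖ ^ q))) =
        ϖ ^ p * x + -(ϖ ^ n * s * x' * w') * x * (ϖ ^ p * ϖ ^ q) := by
        linear_combination (ϖ ^ p * (x * (1 + -(ϖ ^ n * s * x' * w') * ϖ ^ q))) * hy'
      have e2 : (ϖ ^ n * s * x' * w') * x * (ϖ ^ p * ϖ ^ q - y * ϖ ^ r) = ϖ ^ p * (x - y) := by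
        rw [hy]
        linear_combination (ϖ ^ n * s * w') * (ϖ ^ e * w) * hx' + ϖ ^ n * s * ϖ ^ e * hw'
          - s * hn' - ϖ ^ p * hs
      rw [e1]
      linear_combination e2
    · ring
    · linear_combination -(x * ϖ ^ r * (1 + -(ϖ ^ n * s * x' * w') * ϖ ^ q) : O) * hy'
  · refine (rel_left_32 (h1 q _ (by omega))).trans hc hd (rel_torus' isUnit_one huw ?_ ?_ ?_)
    · ring
    · ring
    · linear_combination u * w' * hy - hx + u * ϖ ^ e * hw'
  · refine (rel_right_21 (h1 p _ (by omega))).trans hc hd (rel_torus' huw isUnit_one ?_ ?_ ?_)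
    · ring
    · ring
    · linear_combination u * w' * hy - hx + u * ϖ ^ e * hw'

/-- Some term of the minimum defining `a(c,d)'` is at most its value. -/
theorem le_of_level'_eq {c d a : Fin 3 → ℕ} {l : ℕ}
    (h : level' (fun i => (c i : ℤ)) (fun i => (d i : ℤ)) (fun i => (a i : ℤ)) = l) :
    c 2 ≤ a 2 + l ∨ d 2 ≤ a 2 + l ∨ c 0 ≤ a 0 + l ∨ d 1 ≤ a 1 + l := by
  have := h.le
  rw [level'_natCast] at this
  simp only [min_le_iff] at this
  omega

/-- Some term of the minimum defining `a(c,d)` is at most its value. -/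
theorem le_of_level_eq {c d a : Fin 3 → ℕ} {l : ℕ}
    (h : level (fun i => (c i : ℤ)) (fun i => (d i : ℤ)) (fun i => (a i : ℤ)) = l) :
    (a 0 ≤ l ∨ a 1 ≤ l ∨ a 2 ≤ a 0 + l ∨ a 2 ≤ a 1 + l) ∨
    (c 0 ≤ a 0 + l ∨ c 1 ≤ a 1 + l ∨ c 2 ≤ a 2 + l) ∨
    (d 0 ≤ a 0 + l ∨ d 1 ≤ a 1 + l ∨ d 2 ≤ a 2 + l) ∨
    a 0 + c 1 ≤ a 2 + l ∨ d 0 + a 1 ≤ a 2 + l := by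
  have := Int.toNat_le.1 h.le
  simp only [minEntry, Pi.sub_apply, min_le_iff] at this
  omega

/-- Every term in the minimum defining the level `a(c,d)` belongs to a move that absorbs changes of
`x` of that size. If `a₁ + a₂ = a₃`, then `A B - X = ϖ ^ a₃ (1 - x)`, which shifts the effect of the
moves by the valuation of `x - 1`. -/
theorem rel_of_sameParam (hϖ : Irreducible ϖ) (hc : InT c) (hd : InT d) {a : Fin 3 → ℕ}
    (h0 : 1 ≤ a 0) (h1 : 1 ≤ a 1) {x y : Oˣ}
    (h : SameParam (fun i => (c i : ℤ)) (fun i => (d i : ℤ)) (fun i => (a i : ℤ)) x y) :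
    Rel ϖ c d (tRep ϖ (fun i => (a i : ℤ)) x).val (tRep ϖ (fun i => (a i : ℤ)) y).val := by
  change Rel ϖ c d (lowerMat _ _ _) (lowerMat _ _ _)
  simp only [Int.toNat_natCast]
  unfold SameParam at h
  split_ifs at h with ha
  · replace ha : (a 0 : ℤ) + a 1 = a 2 := ha
    norm_cast at ha
    obtain ⟨hi, hv⟩ := h
    generalize hl' : level' (fun i => (c i : ℤ)) (fun i => (d i : ℤ)) (fun i => (a i : ℤ)) = l'
      at hi hv
    generalize hl : level (fun i => (c i : ℤ)) (fun i => (d i : ℤ)) (fun i => (a i : ℤ)) = l at hv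
    have hle := le_of_level'_eq hl'
    have hll := le_of_level_eq hl
    have hsimple : ϖ ^ l' ∣ (x : O) - y → _ := fun hv =>
      rel_of_dvd_sub (p := a 0) (q := a 1) (r := a 2) hc hd x y hv hle
    clear hl hl'
    rcases eq_or_ne (x : O) 1 with hx1 | hx1
    · have : (l' : ℕ∞) ≤ val ((x : O) - y) := by
        have : val ((x : O) - 1) = ⊤ := by simp [hx1, val]
        rw [this, min_eq_right le_top] at hv
        exact le_trans (by simp) hv
      exact hsimple ((natCast_le_val_iff hϖ).1 this)
    obtain ⟨i, u, hu⟩ := IsDiscreteValuationRing.eq_unit_mul_pow_irreducible (sub_ne_zero.2 hx1) hϖ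
    have hvx : val ((x : O) - 1) = i := by
      rw [hu, val, IsDiscreteValuationRing.addVal_def' u hϖ]
    rw [hvx] at hi hv
    have hv' : ϖ ^ (min (min i l' + l) l') ∣ (x : O) - y := by
      rw [← natCast_le_val_iff hϖ]
      exact_mod_cast hv
    by_cases hil : l' ≤ min i l' + l
    · rw [min_eq_right hil] at hv'
      exact hsimple hv'
    have hil' : i < l' := by omega
    have hvy : ∃ w : Oˣ, (y : O) - 1 = w * ϖ ^ i := by
      have hi' : (i : ℕ∞) = min (val ((y : O) - 1)) l' := by
        rw [← hi, min_eq_left]; exact_mod_cast hil'.le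
      rcases eq_or_ne (y : O) 1 with hy1 | hy1
      · have : val ((y : O) - 1) = ⊤ := by simp [hy1, val]
        rw [this, min_eq_right le_top] at hi'
        exact absurd (by exact_mod_cast hi') hil'.ne
      obtain ⟨j, w, hw⟩ :=
        IsDiscreteValuationRing.eq_unit_mul_pow_irreducible (sub_ne_zero.2 hy1) hϖ
      have : val ((y : O) - 1) = j := by
        rw [hw, val, IsDiscreteValuationRing.addVal_def' w hϖ]
      rw [this] at hi'
      have : i = j := by
        rcases min_choice (j : ℕ∞) l' with hm | hm <;> rw [hm] at hi'
        · exact_mod_cast hi'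
        · exact absurd (by exact_mod_cast hi') hil'.ne
      exact ⟨w, by rw [hw, this]⟩
    obtain ⟨w, hw⟩ := hvy
    rw [min_eq_left hil'.le, min_eq_left (by omega)] at hv'
    by_cases hcase : c 2 ≤ a 2 + (i + l) ∨ d 2 ≤ a 2 + (i + l) ∨ c 0 ≤ a 0 + (i + l) ∨
        d 1 ≤ a 1 + (i + l)
    · exact rel_of_dvd_sub hc hd x y hv' hcase
    · refine rel_of_dvd_sub' (e := a 2 + i) (u := -u) (w := -w) hϖ hc hd h0 h1 x y u.isUnit.neg
        w.isUnit.neg ?_ ?_ hv' (by omega)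
      · rw [← pow_add, ha, pow_add]; linear_combination -ϖ ^ a 2 * hu
      · rw [← pow_add, ha, pow_add]; linear_combination -ϖ ^ a 2 * hw
  · replace ha : ¬ (a 0 : ℤ) + a 1 = a 2 := ha
    norm_cast at ha
    generalize hl : level (fun i => (c i : ℤ)) (fun i => (d i : ℤ)) (fun i => (a i : ℤ)) = l at h
    have hll := le_of_level_eq hl
    have hv' := (natCast_le_val_iff hϖ).1 h
    by_cases hcase : c 2 ≤ a 2 + l ∨ d 2 ≤ a 2 + l ∨ c 0 ≤ a 0 + l ∨
        d 1 ≤ a 1 + l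
    · exact rel_of_dvd_sub hc hd x y hv' hcase
    rcases lt_or_gt_of_ne ha with ha | ha
    · obtain ⟨n, hn⟩ := Nat.exists_eq_add_of_lt ha
      have hz : ∀ z : Oˣ, ϖ ^ a 0 * ϖ ^ a 1 - z * ϖ ^ a 2 =
          ϖ ^ (a 0 + a 1) * (1 - z * ϖ ^ (n + 1)) := by
        intro z; rw [hn]; ring
      have hz' : ∀ z : Oˣ, IsUnit (1 - z * ϖ ^ (n + 1)) := fun z =>
        isUnit_one_sub hϖ ((dvd_pow_self _ (by omega)).mul_left _)
      exact rel_of_dvd_sub' hϖ hc hd h0 h1 x y (hz' x) (hz' y) (hz x) (hz y) hv' (by omega)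
    · obtain ⟨n, hn⟩ := Nat.exists_eq_add_of_lt ha
      have hz : ∀ z : Oˣ, ϖ ^ a 0 * ϖ ^ a 1 - z * ϖ ^ a 2 =
          ϖ ^ (a 2) * (-z + ϖ ^ (n + 1)) := by
        intro z; rw [← pow_add, hn]; ring
      have hz' : ∀ z : Oˣ, IsUnit (-z + ϖ ^ (n + 1)) := fun z =>
        IsUnit.add_dvd hϖ z.isUnit.neg (dvd_pow_self _ (by omega))
      exact rel_of_dvd_sub' hϖ hc hd h0 h1 x y (hz' x) (hz' y) (hz x) (hz y) hv' (by omega)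

end sameParam

/-! ### Reduction of lower unipotent matrices -/

theorem exists_unit_add (hϖ : Irreducible ϖ) {a b : ℕ} (h : a ≠ b) {x y : O} (hx : IsUnit x)
    (hy : IsUnit y) : ∃ u : Oˣ, ϖ ^ a * x + ϖ ^ b * y = ϖ ^ min a b * u := by
  rcases lt_or_gt_of_ne h with h | h
  · obtain ⟨n, rfl⟩ := Nat.exists_eq_add_of_lt h
    obtain ⟨u, hu⟩ := IsUnit.add_dvd hϖ hx (y := ϖ ^ (n + 1) * y)
      ((dvd_pow_self _ (by omega)).mul_right _)
    refine ⟨u, ?_⟩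
    rw [hu, min_eq_left h.le]; ring
  · obtain ⟨n, rfl⟩ := Nat.exists_eq_add_of_lt h
    obtain ⟨u, hu⟩ := IsUnit.add_dvd hϖ hy (y := ϖ ^ (n + 1) * x)
      ((dvd_pow_self _ (by omega)).mul_right _)
    refine ⟨u, ?_⟩
    rw [hu, min_eq_right h.le]; ring

/-- No cancellation occurs after multiplying the second summand by a suitable unit. This uses that
`2` is a unit. -/
theorem exists_unit_mul_add (hϖ : Irreducible ϖ) (h2 : IsUnit (2 : O)) (a b : ℕ) {x y : O}
    (hx : IsUnit x) (hy : IsUnit y) :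
    ∃ e : O, IsUnit e ∧ ∃ u : Oˣ, ϖ ^ a * x + ϖ ^ b * (e * y) = ϖ ^ min a b * u := by
  rcases eq_or_ne a b with rfl | h
  · obtain ⟨y', hy'⟩ := hy.exists_right_inv
    obtain ⟨u, hu⟩ := h2.mul hx
    refine ⟨x * y', hx.mul (IsUnit.of_right_inv hy').2, u, ?_⟩
    rw [hu, min_self]
    linear_combination ϖ ^ a * x * hy'
  · refine ⟨1, isUnit_one, ?_⟩
    rw [one_mul]
    exact exists_unit_add hϖ h hx hy

section reduction

variable {c d : Fin 3 → ℕ}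

/-- The unit parts of `A` and `B` are removed by the torus. -/
theorem exists_rel_pow {A B X : O} (hc : InT c) (hd : InT d) {p q r : ℕ} {α β ξ : O}
    (hα : IsUnit α) (hβ : IsUnit β) (hξ : IsUnit ξ)
    (hA : A = ϖ ^ p * α) (hB : B = ϖ ^ q * β) (hX : X = ϖ ^ r * ξ) {K : Matrix (Fin 3) (Fin 3) O}
    (h : Rel ϖ c d K (lowerMat A B X)) :
    ∃ x : Oˣ, Rel ϖ c d K (lowerMat (ϖ ^ p) (ϖ ^ q) (x * ϖ ^ r)) := by
  obtain ⟨γ, hγ⟩ := (hα.mul hβ).exists_right_inv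
  refine ⟨(hξ.mul (IsUnit.of_right_inv hγ).2).unit, h.trans hc hd (rel_torus' hα hβ hA hB ?_)⟩
  rw [hX, IsUnit.unit_spec]
  linear_combination -(ϖ ^ r * ξ) * hγ

/-- The conditions on the exponents `p`, `q`, `r` of a reduced lower unipotent matrix. -/
structure Reduced (c d : Fin 3 → ℕ) (p q r : ℕ) : Prop where
  p_pos : 1 ≤ p
  q_pos : 1 ≤ q
  p_le : p ≤ r
  q_le : q ≤ r
  p_le_c : p ≤ max (c 0) 1
  p_le_d : p ≤ max (d 0) 1
  q_le_c : q ≤ c 1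
  q_le_d : q ≤ d 1
  r_le_c : r ≤ c 2
  r_le_d : r ≤ d 2
  r_le_add : r ≤ p + c 1
  r_le_add' : r ≤ max (d 0) 1 + q

/-- Every violated condition of `Reduced` allows a move that lowers `r`, or keeps `r` and lowers
`p + q`. -/
theorem exists_rel_lt (hϖ : Irreducible ϖ) (h2 : IsUnit (2 : O)) (hc : InT c) (hd : InT d)
    (hc1 : 1 ≤ c 1) (hd1 : 1 ≤ d 1) {p q r : ℕ} (hp : 1 ≤ p) (hq : 1 ≤ q) (hr : 1 ≤ r) (x : Oˣ)
    (h : ¬ Reduced c d p q r) :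
    ∃ p' q' r' : ℕ, (1 ≤ p' ∧ 1 ≤ q' ∧ 1 ≤ r') ∧ (r' < r ∨ r' = r ∧ p' + q' < p + q) ∧
      ∃ x' : Oˣ, Rel ϖ c d (lowerMat (ϖ ^ p) (ϖ ^ q) (x * ϖ ^ r))
        (lowerMat (ϖ ^ p') (ϖ ^ q') (x' * ϖ ^ r')) := by
  have hC : ϖ ^ c 0 ∣ ϖ ^ (max (c 0) 1) := pow_dvd_pow _ (le_max_left _ _)
  have hD : ϖ ^ d 0 ∣ ϖ ^ (max (d 0) 1) := pow_dvd_pow _ (le_max_left _ _)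
  have hC1 : 1 ≤ max (c 0) 1 := le_max_right _ _
  have hD1 : 1 ≤ max (d 0) 1 := le_max_right _ _
  obtain ⟨C, hCe⟩ : ∃ C, C = max (c 0) 1 := ⟨_, rfl⟩
  obtain ⟨D, hDe⟩ : ∃ D, D = max (d 0) 1 := ⟨_, rfl⟩
  rw [← hCe] at hC hC1
  rw [← hDe] at hD hD1
  obtain ⟨hc0, hc2, -⟩ := id hc
  obtain ⟨hd0, hd2, -⟩ := id hd
  have hϖp : ∀ n : ℕ, 1 ≤ n → ϖ ∣ ϖ ^ n := fun n hn => dvd_pow_self _ (by omega)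
  have hx := x.isUnit
  have one := isUnit_one (M := O)
  by_cases h1 : r < p
  · obtain ⟨u, hu⟩ := exists_unit_add hϖ (by omega : p ≠ r) one hx
    obtain ht := isUnit_one_add hϖ ((hϖp q hq).mul_left 1)
    refine ⟨r, q, r, ⟨by omega, by omega, by omega⟩, Or.inr ⟨rfl, by omega⟩,
      exists_rel_pow hc hd u.isUnit one (hx.mul ht) ?_ (by ring) ?_ (rel_upper_23 (t := 1) ht)⟩
    · rw [min_eq_right h1.le] at hu; linear_combination hu
    · ring
  by_cases h2' : r < q
  · have ht := isUnit_one_add hϖ ((hϖp p hp).mul_left 1)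
    have hu : IsUnit (-(x : O) + ϖ ^ (q - r) * (1 + 1 * ϖ ^ p)) :=
      IsUnit.add_dvd hϖ hx.neg ((hϖp _ (by omega)).mul_right _)
    refine ⟨p, r, r, ⟨by omega, by omega, by omega⟩, Or.inr ⟨rfl, by omega⟩,
      exists_rel_pow hc hd one hu hx (by ring) ?_ (by ring) (rel_upper_12 (t := 1) ht)⟩
    have e : ϖ ^ q = ϖ ^ r * ϖ ^ (q - r) := by rw [← pow_add]; congr 1; omega
    rw [e]; ring
  by_cases h3 : C < p
  · obtain ⟨u, hu⟩ := exists_unit_add hϖ (by omega : p ≠ C) one one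
    rw [min_eq_right h3.le] at hu
    exact ⟨C, q, r, ⟨by omega, by omega, by omega⟩, Or.inr ⟨rfl, by omega⟩,
      exists_rel_pow hc hd u.isUnit one hx (by linear_combination hu) (by ring) (by ring)
        (rel_left_21 hC)⟩
  by_cases h4 : d 1 < q
  · obtain ⟨u, hu⟩ := exists_unit_add hϖ (by omega : q ≠ d 1) one one
    rw [min_eq_right h4.le] at hu
    exact ⟨p, d 1, r, ⟨by omega, by omega, by omega⟩, Or.inr ⟨rfl, by omega⟩,
      exists_rel_pow hc hd one u.isUnit hx (by ring) (by linear_combination hu) (by ring)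
        (rel_right_32 dvd_rfl)⟩
  by_cases h5 : c 2 < r
  · obtain ⟨u, hu⟩ := exists_unit_add hϖ (by omega : r ≠ c 2) hx one
    rw [min_eq_right h5.le] at hu
    exact ⟨p, q, c 2, ⟨by omega, by omega, by omega⟩, Or.inl h5,
      exists_rel_pow hc hd one one u.isUnit (by ring) (by ring) (by linear_combination hu)
        (rel_left_31 dvd_rfl)⟩
  by_cases h6 : d 2 < r
  · obtain ⟨u, hu⟩ := exists_unit_add hϖ (by omega : r ≠ d 2) hx one
    rw [min_eq_right h6.le] at hu
    exact ⟨p, q, d 2, ⟨by omega, by omega, by omega⟩, Or.inl h6,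
      exists_rel_pow hc hd one one u.isUnit (by ring) (by ring) (by linear_combination hu)
        (rel_right_31 dvd_rfl)⟩
  by_cases h7 : c 1 < q
  · obtain ⟨e, he, w, hw⟩ := exists_unit_mul_add hϖ h2 r (p + c 1) hx one
    obtain ⟨u, hu⟩ := exists_unit_add hϖ (by omega : q ≠ c 1) one he
    rw [min_eq_right h7.le] at hu
    exact ⟨p, c 1, min r (p + c 1), ⟨by omega, by omega, by omega⟩, by omega,
      exists_rel_pow hc hd one u.isUnit w.isUnit (by ring) (by linear_combination hu)
        (by rw [← hw]; ring) (rel_left_32 (Dvd.intro e rfl))⟩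
  by_cases h8 : D < p
  · obtain ⟨e, he, w, hw⟩ := exists_unit_mul_add hϖ h2 r (q + D) hx one
    obtain ⟨u, hu⟩ := exists_unit_add hϖ (by omega : p ≠ D) one he
    rw [min_eq_right h8.le] at hu
    exact ⟨D, q, min r (q + D), ⟨by omega, by omega, by omega⟩, by omega,
      exists_rel_pow hc hd u.isUnit one w.isUnit (by linear_combination hu) (by ring)
        (by rw [← hw]; ring) (rel_right_21 (hD.mul_right e))⟩
  by_cases h9 : p + c 1 < r
  · obtain ⟨e, he, w, hw⟩ := exists_unit_mul_add hϖ h2 q (c 1) one one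
    obtain ⟨u, hu⟩ := exists_unit_add hϖ (by omega : r ≠ p + c 1) hx he
    rw [min_eq_right h9.le] at hu
    exact ⟨p, min q (c 1), p + c 1, ⟨by omega, by omega, by omega⟩, Or.inl h9,
      exists_rel_pow hc hd one w.isUnit u.isUnit (by ring) (by rw [← hw]; ring)
        (by rw [← hu]; ring) (rel_left_32 (Dvd.intro e rfl))⟩
  by_cases h10 : D + q < r
  · obtain ⟨e, he, w, hw⟩ := exists_unit_mul_add hϖ h2 p D one one
    obtain ⟨u, hu⟩ := exists_unit_add hϖ (by omega : r ≠ D + q) hx he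
    rw [min_eq_right h10.le] at hu
    exact ⟨min p D, q, D + q, ⟨by omega, by omega, by omega⟩, Or.inl h10,
      exists_rel_pow hc hd w.isUnit one u.isUnit (by rw [← hw]; ring) (by ring)
        (by rw [← hu]; ring) (rel_right_21 (hD.mul_right e))⟩
  exact absurd ⟨hp, hq, by omega, by omega, by omega, by omega, by omega, by omega, by omega,
    by omega, by omega, by omega⟩ h

theorem exists_rel_reduced_of_pow (hϖ : Irreducible ϖ) (h2 : IsUnit (2 : O)) (hc : InT c)
    (hd : InT d) (hc1 : 1 ≤ c 1) (hd1 : 1 ≤ d 1) (p q r : ℕ) (hp : 1 ≤ p) (hq : 1 ≤ q)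
    (hr : 1 ≤ r) (x : Oˣ) :
    ∃ p' q' r' : ℕ, Reduced c d p' q' r' ∧
      ∃ x' : Oˣ, Rel ϖ c d (lowerMat (ϖ ^ p) (ϖ ^ q) (x * ϖ ^ r))
        (lowerMat (ϖ ^ p') (ϖ ^ q') (x' * ϖ ^ r')) := by
  by_cases h : Reduced c d p q r
  · exact ⟨p, q, r, h, x, Rel.refl _ _ _ _⟩
  · obtain ⟨p', q', r', ⟨hp', hq', hr'⟩, hlt, x', hx'⟩ :=
      exists_rel_lt hϖ h2 hc hd hc1 hd1 hp hq hr x h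
    obtain ⟨p₁, q₁, r₁, h₁, x₁, hx₁⟩ :=
      exists_rel_reduced_of_pow hϖ h2 hc hd hc1 hd1 p' q' r' hp' hq' hr' x'
    exact ⟨p₁, q₁, r₁, h₁, x₁, hx'.trans hc hd hx₁⟩
termination_by (r, p + q)
decreasing_by
  rw [Prod.lex_def]
  exact hlt

theorem exists_pow_mul_unit (hϖ : Irreducible ϖ) {z : O} (h0 : z ≠ 0) (hz : ϖ ∣ z) :
    ∃ n : ℕ, 1 ≤ n ∧ ∃ u : Oˣ, z = ϖ ^ n * u := by
  obtain ⟨n, u, rfl⟩ := IsDiscreteValuationRing.eq_unit_mul_pow_irreducible h0 hϖ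
  refine ⟨n, ?_, u, mul_comm _ _⟩
  by_contra hn
  have hn : n = 0 := by omega
  subst hn
  exact (isUnit_iff_not_dvd hϖ).1 (u.isUnit.mul (by simp)) hz

/-- Every lower unipotent matrix with entries in `𝔭` reduces to some `t_{a,x}`. -/
theorem exists_rel_reduced (hϖ : Irreducible ϖ) (h2 : IsUnit (2 : O)) (hc : InT c) (hd : InT d)
    (hc1 : 1 ≤ c 1) (hd1 : 1 ≤ d 1) {A B X : O} (hA : ϖ ∣ A) (hB : ϖ ∣ B) (hX : ϖ ∣ X) :
    ∃ p q r : ℕ, Reduced c d p q r ∧ ∃ x : Oˣ, Rel ϖ c d (lowerMat A B X)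
        (lowerMat (ϖ ^ p) (ϖ ^ q) (x * ϖ ^ r)) := by
  have hc2 : 1 ≤ c 2 := hc1.trans hc.2.1
  -- first all three entries are made nonzero
  obtain ⟨A₁, B₁, X₁, hA₁, hB₁, hX₁, hX0, h₁⟩ : ∃ A₁ B₁ X₁, ϖ ∣ A₁ ∧ ϖ ∣ B₁ ∧ ϖ ∣ X₁ ∧ X₁ ≠ 0 ∧
      Rel ϖ c d (lowerMat A B X) (lowerMat A₁ B₁ X₁) := by
    rcases eq_or_ne X 0 with rfl | h0
    · exact ⟨A, B, _, hA, hB, dvd_add hX (dvd_pow_self _ (by omega)),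
        by rw [zero_add]; exact pow_ne_zero _ hϖ.ne_zero, rel_left_31 (dvd_refl (ϖ ^ c 2))⟩
    · exact ⟨A, B, X, hA, hB, hX, h0, Rel.refl _ _ _ _⟩
  obtain ⟨A₂, X₂, hA₂, hX₂, hX0, hA0, h₂⟩ : ∃ A₂ X₂, ϖ ∣ A₂ ∧ ϖ ∣ X₂ ∧ X₂ ≠ 0 ∧ A₂ ≠ 0 ∧
      Rel ϖ c d (lowerMat A₁ B₁ X₁) (lowerMat A₂ B₁ X₂) := by
    rcases eq_or_ne A₁ 0 with rfl | h0
    · have ht := isUnit_one_add hϖ (hB₁.mul_left 1)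
      exact ⟨_, _, dvd_add hA₁ (hX₁.mul_left 1), hX₁.mul_right _, mul_ne_zero hX0 ht.ne_zero,
        by rwa [zero_add, one_mul], rel_upper_23 ht⟩
    · exact ⟨A₁, X₁, hA₁, hX₁, hX0, h0, Rel.refl _ _ _ _⟩
  obtain ⟨B₂, hB₂, hB0, h₃⟩ : ∃ B₂, ϖ ∣ B₂ ∧ B₂ ≠ 0 ∧
      Rel ϖ c d (lowerMat A₂ B₁ X₂) (lowerMat A₂ B₂ X₂) := by
    rcases eq_or_ne B₁ 0 with rfl | h0
    · have ht := isUnit_one_add hϖ (hA₂.mul_left 1)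
      refine ⟨_, ?_, ?_, rel_upper_12 ht⟩
      · simpa using hX₂
      · simpa using hX0
    · exact ⟨B₁, hB₁, h0, Rel.refl _ _ _ _⟩
  obtain ⟨p, hp, α, hα⟩ := exists_pow_mul_unit hϖ hA0 hA₂
  obtain ⟨q, hq, β, hβ⟩ := exists_pow_mul_unit hϖ hB0 hB₂
  obtain ⟨r, hr, ξ, hξ⟩ := exists_pow_mul_unit hϖ hX0 hX₂
  obtain ⟨x, hx⟩ := exists_rel_pow hc hd α.isUnit β.isUnit ξ.isUnit hα hβ hξ
    (((h₁.trans hc hd h₂).trans hc hd h₃))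
  obtain ⟨p', q', r', h', x', hx'⟩ :=
    exists_rel_reduced_of_pow hϖ h2 hc hd hc1 hd1 p q r hp hq hr x
  exact ⟨p', q', r', h', x', hx.trans hc hd hx'⟩

/-- If `c₁ = d₁ = 0`, then the exponents can be brought to the form `(1, k, k)`. -/
theorem Reduced.exists_rel_of_zero (hϖ : Irreducible ϖ) (hc : InT c) (hd : InT d) {p q r : ℕ}
    (h : Reduced c d p q r) (hc0 : c 0 = 0) (hd0 : d 0 = 0) (x : Oˣ) :
    ∃ x' : Oˣ, Rel ϖ c d (lowerMat (ϖ ^ p) (ϖ ^ q) (x * ϖ ^ r))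
      (lowerMat (ϖ ^ 1) (ϖ ^ q) (x' * ϖ ^ q)) := by
  obtain ⟨hp, hq, hpr, hqr, hpc, hpd, -, -, -, -, -, hrd⟩ := h
  rw [hd0] at hpd hrd
  have hp1 : p = 1 := by simp only [zero_le, sup_of_le_right] at hpd; omega
  have hr : r = q ∨ r = q + 1 := by simp only [zero_le, sup_of_le_right] at hrd; omega
  subst hp1
  rcases hr with rfl | rfl
  · exact ⟨x, Rel.refl _ _ _ _⟩
  · have hu : IsUnit (1 + x * ϖ) := isUnit_one_add hϖ (dvd_mul_left _ _)
    have h₁ := (rel_right_21 (c := c) (A := ϖ ^ 1) (B := ϖ ^ q) (X := x * ϖ ^ (q + 1)) (s := 1)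
      (by simp [hd0] : ϖ ^ d 0 ∣ 1)).trans hc hd (rel_left_21 (s := -1) (by simp [hc0]))
    exact exists_rel_pow hc hd isUnit_one isUnit_one hu (by ring) (by ring) (by ring) h₁

end reduction

/-! ### Reduction in the cells of the simple reflections -/

section reduction

variable {c d : Fin 3 → ℕ}

/-- A common reduction for the cells of `s₁` and `s₂`: if `Z` may be changed by `ϖ ^ z₁`, `ϖ ^ z₂`,
`ϖ ^ n * Y`, and `Y` by `ϖ ^ y₁`, `ϖ ^ y₂`, `ϖ ^ m * Z`, up to units, then both become powers of
`ϖ` with bounded exponents. -/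
theorem exists_rel_of_moves (hϖ : Irreducible ϖ) (hc : InT c) (hd : InT d)
    (form : O → O → Matrix (Fin 3) (Fin 3) O) {z₁ z₂ n y₁ y₂ m : ℕ}
    (hz₁ : 1 ≤ z₁) (hz₂ : 1 ≤ z₂) (hy₁ : 1 ≤ y₁) (hy₂ : 1 ≤ y₂)
    (hT : ∀ Z Y {α β : O}, IsUnit α → IsUnit β → Rel ϖ c d (form (Z * α) (Y * β)) (form Z Y))
    (hZ₁ : ∀ Z Y, Rel ϖ c d (form Z Y) (form (Z + ϖ ^ z₁) Y))
    (hZ₂ : ∀ Z Y, Rel ϖ c d (form Z Y) (form (Z + ϖ ^ z₂) Y))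
    (hZ₃ : ∀ Z Y, Rel ϖ c d (form Z Y) (form (Z + ϖ ^ n * Y) Y))
    (hY₁ : ∀ Z Y, Rel ϖ c d (form Z Y) (form Z (Y + ϖ ^ y₁)))
    (hY₂ : ∀ Z Y, Rel ϖ c d (form Z Y) (form Z (Y + ϖ ^ y₂)))
    (hY₃ : ∀ Z Y, Rel ϖ c d (form Z Y) (form Z (Y + ϖ ^ m * Z)))
    {Z Y : O} (hZ : ϖ ∣ Z) (hY : ϖ ∣ Y) :
    ∃ α β : ℕ, (1 ≤ α ∧ 1 ≤ β) ∧ (β ≤ z₁ ∧ β ≤ z₂ ∧ β ≤ α + n) ∧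
      (α ≤ y₁ ∧ α ≤ y₂ ∧ α ≤ β + m) ∧ Rel ϖ c d (form Z Y) (form (ϖ ^ β) (ϖ ^ α)) := by
  have one := isUnit_one (M := O)
  have norm : ∀ {k l : ℕ} {u v : O}, IsUnit u → IsUnit v →
      Rel ϖ c d (form (ϖ ^ k * u) (ϖ ^ l * v)) (form (ϖ ^ k) (ϖ ^ l)) := fun hu hv => hT _ _ hu hv
  have pows : ∀ s k l : ℕ, k + l = s → 1 ≤ k → 1 ≤ l →
      ∃ α β : ℕ, (1 ≤ α ∧ 1 ≤ β) ∧ (β ≤ z₁ ∧ β ≤ z₂ ∧ β ≤ α + n) ∧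
      (α ≤ y₁ ∧ α ≤ y₂ ∧ α ≤ β + m) ∧ Rel ϖ c d (form (ϖ ^ k) (ϖ ^ l)) (form (ϖ ^ β) (ϖ ^ α)) := by
    intro s
    induction s using Nat.strong_induction_on with
    | _ s ih =>
    intro k l hs hk hl
    -- it suffices to lower one of the exponents
    have stepZ : ∀ k', k' < k → 1 ≤ k' →
        Rel ϖ c d (form (ϖ ^ k) (ϖ ^ l)) (form (ϖ ^ k + ϖ ^ k') (ϖ ^ l)) → ∃ α β : ℕ,
        (1 ≤ α ∧ 1 ≤ β) ∧ (β ≤ z₁ ∧ β ≤ z₂ ∧ β ≤ α + n) ∧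
        (α ≤ y₁ ∧ α ≤ y₂ ∧ α ≤ β + m) ∧
        Rel ϖ c d (form (ϖ ^ k) (ϖ ^ l)) (form (ϖ ^ β) (ϖ ^ α)) := by
      intro k' hk' h1 h
      obtain ⟨u, hu⟩ := exists_unit_add hϖ (by omega : k ≠ k') one one
      rw [min_eq_right hk'.le, mul_one, mul_one] at hu
      obtain ⟨α, β, h₁, h₂, h₃, h₄⟩ := ih (k' + l) (by omega) k' l rfl h1 hl
      rw [hu, ← mul_one (ϖ ^ l)] at h
      refine ⟨α, β, h₁, h₂, h₃, ?_⟩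
      have := (h.trans hc hd (norm u.isUnit one)).trans hc hd h₄
      rwa [mul_one] at this
    have stepY : ∀ l', l' < l → 1 ≤ l' →
        Rel ϖ c d (form (ϖ ^ k) (ϖ ^ l)) (form (ϖ ^ k) (ϖ ^ l + ϖ ^ l')) → ∃ α β : ℕ,
        (1 ≤ α ∧ 1 ≤ β) ∧ (β ≤ z₁ ∧ β ≤ z₂ ∧ β ≤ α + n) ∧
        (α ≤ y₁ ∧ α ≤ y₂ ∧ α ≤ β + m) ∧
        Rel ϖ c d (form (ϖ ^ k) (ϖ ^ l)) (form (ϖ ^ β) (ϖ ^ α)) := by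
      intro l' hl' h1 h
      obtain ⟨u, hu⟩ := exists_unit_add hϖ (by omega : l ≠ l') one one
      rw [min_eq_right hl'.le, mul_one, mul_one] at hu
      obtain ⟨α, β, h₁, h₂, h₃, h₄⟩ := ih (k + l') (by omega) k l' rfl hk h1
      rw [hu, ← mul_one (ϖ ^ k)] at h
      refine ⟨α, β, h₁, h₂, h₃, ?_⟩
      have := (h.trans hc hd (norm one u.isUnit)).trans hc hd h₄
      rwa [mul_one] at this
    by_cases g1 : z₁ < k
    · exact stepZ _ g1 hz₁ (hZ₁ _ _)
    by_cases g2 : z₂ < k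
    · exact stepZ _ g2 hz₂ (hZ₂ _ _)
    by_cases g3 : n + l < k
    · exact stepZ _ g3 (by omega) (by rw [pow_add]; exact hZ₃ _ _)
    by_cases g4 : y₁ < l
    · exact stepY _ g4 hy₁ (hY₁ _ _)
    by_cases g5 : y₂ < l
    · exact stepY _ g5 hy₂ (hY₂ _ _)
    by_cases g6 : m + k < l
    · exact stepY _ g6 (by omega) (by rw [pow_add]; exact hY₃ _ _)
    exact ⟨l, k, by omega, by omega, by omega, Rel.refl _ _ _ _⟩
  obtain ⟨Z₁, hZ₁', hZ0, r₁⟩ : ∃ Z₁, ϖ ∣ Z₁ ∧ Z₁ ≠ 0 ∧ Rel ϖ c d (form Z Y) (form Z₁ Y) := by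
    rcases eq_or_ne Z 0 with rfl | h0
    · refine ⟨_, ?_, ?_, hZ₁ _ _⟩
      · rw [zero_add]; exact dvd_pow_self _ (by omega)
      · rw [zero_add]; exact pow_ne_zero _ hϖ.ne_zero
    · exact ⟨Z, hZ, h0, Rel.refl _ _ _ _⟩
  obtain ⟨Y₁, hY₁', hY0, r₂⟩ : ∃ Y₁, ϖ ∣ Y₁ ∧ Y₁ ≠ 0 ∧ Rel ϖ c d (form Z₁ Y) (form Z₁ Y₁) := by
    rcases eq_or_ne Y 0 with rfl | h0
    · refine ⟨_, ?_, ?_, hY₁ _ _⟩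
      · rw [zero_add]; exact dvd_pow_self _ (by omega)
      · rw [zero_add]; exact pow_ne_zero _ hϖ.ne_zero
    · exact ⟨Y, hY, h0, Rel.refl _ _ _ _⟩
  obtain ⟨k, hk, u, rfl⟩ := exists_pow_mul_unit hϖ hZ0 hZ₁'
  obtain ⟨l, hl, v, rfl⟩ := exists_pow_mul_unit hϖ hY0 hY₁'
  obtain ⟨α, β, h₁, h₂, h₃, h₄⟩ := pows _ k l rfl hk hl
  exact ⟨α, β, h₁, h₂, h₃, ((r₁.trans hc hd r₂).trans hc hd (norm u.isUnit v.isUnit)).trans hc hd h₄⟩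

theorem exists_rel_s1Rep (hϖ : Irreducible ϖ) (hc : InT c) (hd : InT d) (hc1 : 1 ≤ c 1)
    (hd1 : 1 ≤ d 1) {Z Y : O} (hZ : ϖ ∣ Z) (hY : ϖ ∣ Y) :
    ∃ α β : ℕ, (1 ≤ α ∧ 1 ≤ β) ∧ (β ≤ c 1 ∧ β ≤ d 2 ∧ β ≤ α + d 0) ∧
      (α ≤ d 1 ∧ α ≤ c 2 ∧ α ≤ β + c 0) ∧
      Rel ϖ c d (s1Form Z Y).val (s1Rep ϖ α β).val := by
  refine exists_rel_of_moves hϖ hc hd (fun Z Y => (s1Form Z Y).val) hc1 (hd1.trans hd.2.1) hd1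
    (hc1.trans hc.2.1) ?_ ?_ ?_ ?_ ?_ ?_ ?_ hZ hY <;> intro Z Y
  · intro α β hα hβ
    refine rel_of_upper c d (u₁ := β) (x := 0) (y := 0) (u₂ := α) (z := 0) (u₃ := 1)
      (v₁ := α) (x' := 0) (y' := 0) (v₂ := β) (z' := 0) (v₃ := 1)
      hβ hα isUnit_one hα hβ isUnit_one ?_
    rw [val_s1Form, val_s1Form, Matrix.mul_fin_three, Matrix.mul_fin_three]
    apply mat3_ext <;> ring
  · refine ⟨!![1, 0, 0; 0, 1, 0; 0, ϖ ^ c 1, 1], 1, by simp [det_lit], by simp,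
      inC_lit (by simp) dvd_rfl (by simp), InC.one _ _, ?_⟩
    rw [mul_one, val_s1Form, val_s1Form, Matrix.mul_fin_three]
    apply mat3_ext <;> ring
  · refine ⟨1, !![1, 0, 0; 0, 1, 0; -ϖ ^ d 2, 0, 1], by simp, by simp [det_lit], InC.one _ _,
      inC_lit (by simp) (by simp) (by simp), ?_⟩
    rw [one_mul, val_s1Form, val_s1Form, Matrix.mul_fin_three]
    apply mat3_ext <;> ring
  · refine ⟨!![1, -ϖ ^ d 0, 0; 0, 1, 0; 0, 0, 1], !![1, 0, 0; -ϖ ^ d 0, 1, 0; 0, 0, 1],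
      by simp [det_lit], by simp [det_lit], inC_lit (by simp) (by simp) (by simp),
      inC_lit (by simp) (by simp) (by simp), ?_⟩
    rw [val_s1Form, val_s1Form, Matrix.mul_fin_three, Matrix.mul_fin_three]
    apply mat3_ext <;> ring
  · refine ⟨1, !![1, 0, 0; 0, 1, 0; 0, -ϖ ^ d 1, 1], by simp, by simp [det_lit], InC.one _ _,
      inC_lit (by simp) (by simp) (by simp), ?_⟩
    rw [one_mul, val_s1Form, val_s1Form, Matrix.mul_fin_three]
    apply mat3_ext <;> ring
  · refine ⟨!![1, 0, 0; 0, 1, 0; ϖ ^ c 2, 0, 1], 1, by simp [det_lit], by simp,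
      inC_lit (by simp) (by simp) dvd_rfl, InC.one _ _, ?_⟩
    rw [mul_one, val_s1Form, val_s1Form, Matrix.mul_fin_three]
    apply mat3_ext <;> ring
  · refine ⟨!![1, 0, 0; -ϖ ^ c 0, 1, 0; 0, 0, 1], !![1, -ϖ ^ c 0, 0; 0, 1, 0; 0, 0, 1],
      by simp [det_lit], by simp [det_lit], inC_lit (by simp) (by simp) (by simp),
      inC_lit (by simp) (by simp) (by simp), ?_⟩
    rw [val_s1Form, val_s1Form, Matrix.mul_fin_three, Matrix.mul_fin_three]
    apply mat3_ext <;> ring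

theorem exists_rel_s2Rep (hϖ : Irreducible ϖ) (hc : InT c) (hd : InT d) (hc0 : 1 ≤ c 0)
    (hd0 : 1 ≤ d 0) {Z Y : O} (hZ : ϖ ∣ Z) (hY : ϖ ∣ Y) :
    ∃ α β : ℕ, (1 ≤ α ∧ 1 ≤ β) ∧ (β ≤ c 0 ∧ β ≤ d 2 ∧ β ≤ α + d 1) ∧
      (α ≤ d 0 ∧ α ≤ c 2 ∧ α ≤ β + c 1) ∧
      Rel ϖ c d (s2Form Z Y).val (s2Rep ϖ α β).val := by
  refine exists_rel_of_moves hϖ hc hd (fun Z Y => (s2Form Z Y).val) hc0 (hd0.trans hd.1) hd0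
    (hc0.trans hc.1) ?_ ?_ ?_ ?_ ?_ ?_ ?_ hZ hY <;> intro Z Y
  · intro α β hα hβ
    obtain ⟨α', hα'⟩ := hα.exists_right_inv
    obtain ⟨β', hβ'⟩ := hβ.exists_right_inv
    refine rel_of_upper c d (u₁ := 1) (x := 0) (y := 0) (u₂ := α') (z := 0) (u₃ := β')
      (v₁ := 1) (x' := 0) (y' := 0) (v₂ := β') (z' := 0) (v₃ := α')
      isUnit_one (IsUnit.of_right_inv hα').2 (IsUnit.of_right_inv hβ').2 isUnit_one
      (IsUnit.of_right_inv hβ').2 (IsUnit.of_right_inv hα').2 ?_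
    rw [val_s2Form, val_s2Form, Matrix.mul_fin_three, Matrix.mul_fin_three]
    apply mat3_ext <;> first | ring1 | linear_combination Z * hα' | linear_combination Y * hβ'
  · refine ⟨!![1, 0, 0; ϖ ^ c 0, 1, 0; 0, 0, 1], 1, by simp [det_lit], by simp,
      inC_lit dvd_rfl (by simp) (by simp), InC.one _ _, ?_⟩
    rw [mul_one, val_s2Form, val_s2Form, Matrix.mul_fin_three]
    apply mat3_ext <;> ring
  · refine ⟨1, !![1, 0, 0; 0, 1, 0; -ϖ ^ d 2, 0, 1], by simp, by simp [det_lit], InC.one _ _,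
      inC_lit (by simp) (by simp) (by simp), ?_⟩
    rw [one_mul, val_s2Form, val_s2Form, Matrix.mul_fin_three]
    apply mat3_ext <;> ring
  · refine ⟨!![1, 0, 0; 0, 1, ϖ ^ d 1; 0, 0, 1], !![1, 0, 0; 0, 1, 0; 0, ϖ ^ d 1, 1],
      by simp [det_lit], by simp [det_lit], inC_lit (by simp) (by simp) (by simp),
      inC_lit (by simp) dvd_rfl (by simp), ?_⟩
    rw [val_s2Form, val_s2Form, Matrix.mul_fin_three, Matrix.mul_fin_three]
    apply mat3_ext <;> ring
  · refine ⟨1, !![1, 0, 0; -ϖ ^ d 0, 1, 0; 0, 0, 1], by simp, by simp [det_lit], InC.one _ _,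
      inC_lit (by simp) (by simp) (by simp), ?_⟩
    rw [one_mul, val_s2Form, val_s2Form, Matrix.mul_fin_three]
    apply mat3_ext <;> ring
  · refine ⟨!![1, 0, 0; 0, 1, 0; ϖ ^ c 2, 0, 1], 1, by simp [det_lit], by simp,
      inC_lit (by simp) (by simp) dvd_rfl, InC.one _ _, ?_⟩
    rw [mul_one, val_s2Form, val_s2Form, Matrix.mul_fin_three]
    apply mat3_ext <;> ring
  · refine ⟨!![1, 0, 0; 0, 1, 0; 0, ϖ ^ c 1, 1], !![1, 0, 0; 0, 1, ϖ ^ c 1; 0, 0, 1],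
      by simp [det_lit], by simp [det_lit], inC_lit (by simp) dvd_rfl (by simp),
      inC_lit (by simp) (by simp) (by simp), ?_⟩
    rw [val_s2Form, val_s2Form, Matrix.mul_fin_three, Matrix.mul_fin_three]
    apply mat3_ext <;> ring

/-- If `c₁ = 0`, the reflection `s₁` belongs to `C_c`. -/
theorem rel_s1Form_of_left_zero (hc0 : c 0 = 0) (Z Y : O) :
    Rel ϖ c d (s1Form Z Y).val (lowerMat 0 Y Z) := by
  refine ⟨!![0, 1, 0; 1, 0, 0; 0, 0, 1], 1, by simp [det_lit], by simp,
      inC_lit (by simp [hc0]) (by simp) (by simp), InC.one _ _, ?_⟩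
  rw [mul_one, val_s1Form, lowerMat, Matrix.mul_fin_three]
  apply mat3_ext <;> ring

theorem rel_s1Form_of_right_zero (hd0 : d 0 = 0) (Z Y : O) :
    Rel ϖ c d (s1Form Z Y).val (lowerMat 0 Z Y) := by
  refine ⟨1, !![0, 1, 0; 1, 0, 0; 0, 0, 1], by simp, by simp [det_lit], InC.one _ _,
      inC_lit (by simp [hd0]) (by simp) (by simp), ?_⟩
  rw [one_mul, val_s1Form, lowerMat, Matrix.mul_fin_three]
  apply mat3_ext <;> ring

/-- If `c₁ = 0`, the cell of `s₂` merges with that of `s₁s₂`, which supports nothing. -/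
theorem rel_s2Form_of_left_zero (hc0 : c 0 = 0) (Z Y : O) :
    Rel ϖ c d (s2Form Z Y).val (s1s2Form Y).val := by
  refine ⟨!![-Z, 1, 0; 1, 0, 0; 0, 0, 1], 1, by simp [det_lit], by simp,
      inC_lit (by simp [hc0]) (by simp) (by simp), InC.one _ _, ?_⟩
  change _ = !![0, 0, 1; 1, 0, 0; Y, 1, 0] * _
  rw [mul_one, val_s2Form, Matrix.mul_fin_three]
  apply mat3_ext <;> ring

/-- If `d₁ = 0`, the cell of `s₂` merges with that of `s₂s₁`, which supports nothing. -/
theorem rel_s2Form_of_right_zero (hd0 : d 0 = 0) (Z Y : O) :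
    Rel ϖ c d (s2Form Z Y).val (s2s1Form Z).val := by
  refine ⟨1, !![Y, 1, 0; 1, 0, 0; 0, 0, 1], by simp, by simp [det_lit], InC.one _ _,
      inC_lit (by simp [hd0]) (by simp) (by simp), ?_⟩
  change _ = !![0, 1, 0; 0, Z, 1; 1, 0, 0] * _
  rw [one_mul, val_s2Form, Matrix.mul_fin_three]
  apply mat3_ext <;> ring

/-- Every double coset contains one of the representatives; those in the three cells that support
nothing need not be reduced. -/
theorem exists_rel_rep (hϖ : Irreducible ϖ) (h2 : IsUnit (2 : O)) (hc : InT c) (hd : InT d)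
    (hc1 : 1 ≤ c 1) (hd1 : 1 ≤ d 1) (k : GL (Fin 3) O) :
    ((∃ z, Rel ϖ c d k.val (s1s2Form z).val) ∨ (∃ z, Rel ϖ c d k.val (s2s1Form z).val) ∨
      Rel ϖ c d k.val (w0Rep O).val) ∨
    (∃ p q r : ℕ, Reduced c d p q r ∧ ∃ x : Oˣ, Rel ϖ c d k.val
        (lowerMat (ϖ ^ p) (ϖ ^ q) (x * ϖ ^ r))) ∨
    (1 ≤ c 0 ∧ 1 ≤ d 0) ∧
    ((∃ α β : ℕ, (1 ≤ α ∧ 1 ≤ β) ∧ (β ≤ c 1 ∧ β ≤ d 2 ∧ β ≤ α + d 0) ∧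
      (α ≤ d 1 ∧ α ≤ c 2 ∧ α ≤ β + c 0) ∧ Rel ϖ c d k.val (s1Rep ϖ α β).val) ∨
    (∃ α β : ℕ, (1 ≤ α ∧ 1 ≤ β) ∧ (β ≤ c 0 ∧ β ≤ d 2 ∧ β ≤ α + d 1) ∧
      (α ≤ d 0 ∧ α ≤ c 2 ∧ α ≤ β + c 1) ∧ Rel ϖ c d k.val (s2Rep ϖ α β).val)) := by
  have hk : IsUnit k.val.det := (Matrix.isUnit_iff_isUnit_det _).1 k.isUnit
  generalize k.val = K at hk ⊢
  rw [Matrix.eta_fin_three K] at hk ⊢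
  generalize K 0 0 = a₀₀ at *
  generalize K 0 1 = a₀₁ at *
  generalize K 0 2 = a₀₂ at *
  generalize K 1 0 = a₁₀ at *
  generalize K 1 1 = a₁₁ at *
  generalize K 1 2 = a₁₂ at *
  generalize K 2 0 = a₂₀ at *
  generalize K 2 1 = a₂₁ at *
  generalize K 2 2 = a₂₂ at *
  have lower : ∀ {A B X : O}, ϖ ∣ A → ϖ ∣ B → ϖ ∣ X →
      Rel ϖ c d !![a₀₀, a₀₁, a₀₂; a₁₀, a₁₁, a₁₂; a₂₀, a₂₁, a₂₂] (lowerMat A B X) →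
      ∃ p q r : ℕ, Reduced c d p q r ∧ ∃ x : Oˣ,
        Rel ϖ c d !![a₀₀, a₀₁, a₀₂; a₁₀, a₁₁, a₁₂; a₂₀, a₂₁, a₂₂]
        (lowerMat (ϖ ^ p) (ϖ ^ q) (x * ϖ ^ r)) := by
    intro A B X hA hB hX h
    obtain ⟨p, q, r, hr, x, hx⟩ := exists_rel_reduced hϖ h2 hc hd hc1 hd1 hA hB hX
    exact ⟨p, q, r, hr, x, h.trans hc hd hx⟩
  rcases isUnit_or_dvd hϖ a₂₀ with h20 | h20
  · rcases bruhat_of_isUnit_20 hϖ hc hd hk h20 with h | h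
    · exact Or.inl (Or.inr (Or.inl h))
    · exact Or.inl (Or.inr (Or.inr h))
  rcases isUnit_or_dvd hϖ a₂₁ with h21 | h21
  · rcases bruhat_of_isUnit_21 hϖ hc hd hk h21 h20 with h | ⟨Z, Y, hZ, hY, h⟩
    · exact Or.inl (Or.inl h)
    · rcases Nat.eq_zero_or_pos (c 0) with hc0 | hc0
      · exact Or.inl (Or.inl ⟨_, h.trans hc hd (rel_s2Form_of_left_zero hc0 Z Y)⟩)
      rcases Nat.eq_zero_or_pos (d 0) with hd0 | hd0
      · exact Or.inl (Or.inr (Or.inl ⟨_, h.trans hc hd (rel_s2Form_of_right_zero hd0 Z Y)⟩))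
      obtain ⟨α, β, h₁, h₂, h₃, h₄⟩ := exists_rel_s2Rep hϖ hc hd hc0 hd0 hZ hY
      exact Or.inr (Or.inr ⟨⟨hc0, hd0⟩, Or.inr ⟨α, β, h₁, h₂, h₃, h.trans hc hd h₄⟩⟩)
  rcases bruhat_of_dvd_row hϖ hc hd hk h20 h21 with ⟨Z, Y, hZ, hY, h⟩ | ⟨A, B, X, hA, hB, hX, h⟩
  · rcases Nat.eq_zero_or_pos (c 0) with hc0 | hc0
    · exact Or.inr (Or.inl (lower (dvd_zero _) hY hZ
        (h.trans hc hd (rel_s1Form_of_left_zero hc0 Z Y))))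
    rcases Nat.eq_zero_or_pos (d 0) with hd0 | hd0
    · exact Or.inr (Or.inl (lower (dvd_zero _) hZ hY
        (h.trans hc hd (rel_s1Form_of_right_zero hd0 Z Y))))
    obtain ⟨α, β, h₁, h₂, h₃, h₄⟩ := exists_rel_s1Rep hϖ hc hd hc1 hd1 hZ hY
    exact Or.inr (Or.inr ⟨⟨hc0, hd0⟩, Or.inl ⟨α, β, h₁, h₂, h₃, h.trans hc hd h₄⟩⟩)
  · exact Or.inr (Or.inl (lower hA hB hX h))

end reduction

/-! ### Divisibility invariants of double cosets -/

section invariants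

variable {c d : Fin 3 → ℕ} {G K H : Matrix (Fin 3) (Fin 3) O} {n : ℕ}

/-- Divisibility of the entry `31` by `ϖ ^ n` is invariant if `n` is so small that the contributions
of all other entries are divisible as well. -/
theorem dvd_entry_31 (hG : InC ϖ c G) (hH : InC ϖ d H) (hc : n ≤ c 2) (hd : n ≤ d 2)
    (hcd : n ≤ c 1 + d 0) (h21 : ϖ ^ n ∣ ϖ ^ c 1 * K 1 0) (h32 : ϖ ^ n ∣ ϖ ^ d 0 * K 2 1)
    (h31 : ϖ ^ n ∣ K 2 0) : ϖ ^ n ∣ (G * K * H) 2 0 := by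
  obtain ⟨-, ⟨g32, hg32⟩, hg31⟩ := hG
  obtain ⟨⟨k21, hk21⟩, -, hk31⟩ := hH
  replace hg31 := (pow_dvd_pow ϖ hc).trans hg31
  replace hk31 := (pow_dvd_pow ϖ hd).trans hk31
  have e : (G * K * H) 2 0 = G 2 0 * (K 0 0 * H 0 0 + K 0 1 * H 1 0 + K 0 2 * H 2 0) +
      H 2 0 * (G 2 1 * K 1 2 + G 2 2 * K 2 2) + ϖ ^ c 1 * K 1 0 * (g32 * H 0 0) +
      ϖ ^ (c 1 + d 0) * (g32 * k21 * K 1 1) + ϖ ^ d 0 * K 2 1 * (k21 * G 2 2) +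
      K 2 0 * (G 2 2 * H 0 0) := by
    simp only [Matrix.mul_apply, Fin.sum_univ_three]
    rw [hg32, hk21]
    ring
  rw [e]
  exact dvd_add (dvd_add (dvd_add (dvd_add (dvd_add (hg31.mul_right _) (hk31.mul_right _))
    (h21.mul_right _)) ((pow_dvd_pow ϖ hcd).mul_right _)) (h32.mul_right _)) (h31.mul_right _)

theorem dvd_entry_21 (hG : InC ϖ c G) (hH : InC ϖ d H) (hc : n ≤ c 0) (hd : n ≤ d 0)
    (hd' : n ≤ d 2) (h21 : ϖ ^ n ∣ K 1 0) (h31 : ϖ ^ n ∣ K 2 0) : ϖ ^ n ∣ (G * K * H) 1 0 := by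
  have hg21 := (pow_dvd_pow ϖ hc).trans hG.1
  have hk21 := (pow_dvd_pow ϖ hd).trans hH.1
  have hk31 := (pow_dvd_pow ϖ hd').trans hH.2.2
  have e : (G * K * H) 1 0 = G 1 0 * (K 0 0 * H 0 0 + K 0 1 * H 1 0 + K 0 2 * H 2 0) +
      H 1 0 * (G 1 1 * K 1 1 + G 1 2 * K 2 1) + H 2 0 * (G 1 1 * K 1 2 + G 1 2 * K 2 2) +
      K 1 0 * (G 1 1 * H 0 0) + K 2 0 * (G 1 2 * H 0 0) := by
    simp only [Matrix.mul_apply, Fin.sum_univ_three]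
    ring
  rw [e]
  exact dvd_add (dvd_add (dvd_add (dvd_add (hg21.mul_right _) (hk21.mul_right _))
    (hk31.mul_right _)) (h21.mul_right _)) (h31.mul_right _)

theorem dvd_entry_32 (hG : InC ϖ c G) (hH : InC ϖ d H) (hc : n ≤ c 1) (hc' : n ≤ c 2)
    (hd : n ≤ d 1) (h32 : ϖ ^ n ∣ K 2 1) (h31 : ϖ ^ n ∣ K 2 0) : ϖ ^ n ∣ (G * K * H) 2 1 := by
  have hg32 := (pow_dvd_pow ϖ hc).trans hG.2.1
  have hg31 := (pow_dvd_pow ϖ hc').trans hG.2.2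
  have hk32 := (pow_dvd_pow ϖ hd).trans hH.2.1
  have e : (G * K * H) 2 1 = G 2 1 * (K 1 0 * H 0 1 + K 1 1 * H 1 1 + K 1 2 * H 2 1) +
      G 2 0 * (K 0 0 * H 0 1 + K 0 1 * H 1 1 + K 0 2 * H 2 1) + H 2 1 * (G 2 2 * K 2 2) +
      K 2 1 * (G 2 2 * H 1 1) + K 2 0 * (G 2 2 * H 0 1) := by
    simp only [Matrix.mul_apply, Fin.sum_univ_three]
    ring
  rw [e]
  exact dvd_add (dvd_add (dvd_add (dvd_add (hg32.mul_right _) (hg31.mul_right _))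
    (hk32.mul_right _)) (h32.mul_right _)) (h31.mul_right _)

end invariants

/-- Two elements of `GL₃(O)` in the same double coset of `C_c` and `C_d`. -/
def SameCoset (ϖ : O) (c d : Fin 3 → ℕ) (k k' : GL (Fin 3) O) : Prop :=
  ∃ g h : GL (Fin 3) O, InC ϖ c g.val ∧ InC ϖ d h.val ∧ g * k = k' * h

section sameCoset

variable {c d : Fin 3 → ℕ} {k k' : GL (Fin 3) O}

theorem SameCoset.symm (hc : InT c) (hd : InT d) (h : SameCoset ϖ c d k k') :
    SameCoset ϖ c d k' k := by
  obtain ⟨g, h, hg, hh, e⟩ := h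
  refine ⟨g⁻¹, h⁻¹, hg.inv hc, hh.inv hd, ?_⟩
  rw [inv_mul_eq_iff_eq_mul, ← mul_assoc, e, mul_assoc, mul_inv_cancel, mul_one]

theorem SameCoset.inv (h : SameCoset ϖ c d k k') :
    SameCoset ϖ d c k⁻¹ k'⁻¹ := by
  obtain ⟨g, h, hg, hh, e⟩ := h
  refine ⟨h, g, hh, hg, ?_⟩
  rw [mul_inv_eq_iff_eq_mul, mul_assoc, e, inv_mul_cancel_left]

theorem SameCoset.exists_eq (hd : InT d) (h : SameCoset ϖ c d k k') :
    ∃ G H : Matrix (Fin 3) (Fin 3) O, InC ϖ c G ∧ InC ϖ d H ∧ k'.val = G * k.val * H := by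
  obtain ⟨g, h, hg, hh, e⟩ := h
  refine ⟨g.val, h⁻¹.val, hg, hh.inv hd, ?_⟩
  rw [← Units.val_mul, ← Units.val_mul, e, mul_inv_cancel_right]

variable {Z Y Z' Y' A B X A' B' X' : O}

theorem inv_lowerForm (A B X : O) :
    (lowerForm A B X)⁻¹ = lowerForm (-A) (-B) (A * B - X) := by
  rw [inv_eq_iff_mul_eq_one]
  apply Units.ext
  rw [Units.val_mul, val_lowerForm, val_lowerForm, Matrix.mul_fin_three, Units.val_one,
    Matrix.one_fin_three]
  apply mat3_ext <;> ring

theorem inv_s1Form (Z Y : O) : (s1Form Z Y)⁻¹ = s1Form (-Y) (-Z) := by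
  rw [inv_eq_iff_mul_eq_one]
  apply Units.ext
  rw [Units.val_mul, val_s1Form, val_s1Form, Matrix.mul_fin_three, Units.val_one,
    Matrix.one_fin_three]
  apply mat3_ext <;> ring

theorem inv_s2Form (Z Y : O) : (s2Form Z Y)⁻¹ = s2Form (-Y) (-Z) := by
  rw [inv_eq_iff_mul_eq_one]
  apply Units.ext
  rw [Units.val_mul, val_s2Form, val_s2Form, Matrix.mul_fin_three, Units.val_one,
    Matrix.one_fin_three]
  apply mat3_ext <;> ring

theorem SameCoset.dvd_31 (hd : InT d) (h : SameCoset ϖ c d k k') {n : ℕ}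
    {a b e f g i j l m a' b' e' f' g' i' j' l' m' : O}
    (hk : k.val = !![a, b, e; f, g, i; j, l, m])
    (hk' : k'.val = !![a', b', e'; f', g', i'; j', l', m'])
    (h₁ : n ≤ c 2) (h₂ : n ≤ d 2) (h₃ : n ≤ c 1 + d 0) (h₄ : ϖ ^ n ∣ ϖ ^ c 1 * f)
    (h₅ : ϖ ^ n ∣ ϖ ^ d 0 * l) (h₆ : ϖ ^ n ∣ j) : ϖ ^ n ∣ j' := by
  obtain ⟨G, H, hG, hH, e⟩ := h.exists_eq hd
  have := dvd_entry_31 (K := k.val) (n := n) hG hH h₁ h₂ h₃ (by rw [hk]; exact h₄)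
    (by rw [hk]; exact h₅) (by rw [hk]; exact h₆)
  rwa [← e, hk'] at this

theorem SameCoset.dvd_21 (hd : InT d) (h : SameCoset ϖ c d k k') {n : ℕ}
    {a b e f g i j l m a' b' e' f' g' i' j' l' m' : O}
    (hk : k.val = !![a, b, e; f, g, i; j, l, m])
    (hk' : k'.val = !![a', b', e'; f', g', i'; j', l', m'])
    (h₁ : n ≤ c 0) (h₂ : n ≤ d 0) (h₄ : ϖ ^ n ∣ f) (h₆ : ϖ ^ n ∣ j) : ϖ ^ n ∣ f' := by
  obtain ⟨G, H, hG, hH, e⟩ := h.exists_eq hd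
  have := dvd_entry_21 (K := k.val) (n := n) hG hH h₁ h₂ (h₂.trans hd.1)
    (by rw [hk]; exact h₄) (by rw [hk]; exact h₆)
  rwa [← e, hk'] at this

theorem SameCoset.dvd_32 (hc : InT c) (hd : InT d) (h : SameCoset ϖ c d k k') {n : ℕ}
    {a b e f g i j l m a' b' e' f' g' i' j' l' m' : O}
    (hk : k.val = !![a, b, e; f, g, i; j, l, m])
    (hk' : k'.val = !![a', b', e'; f', g', i'; j', l', m'])
    (h₁ : n ≤ c 1) (h₂ : n ≤ d 1) (h₅ : ϖ ^ n ∣ l) (h₆ : ϖ ^ n ∣ j) : ϖ ^ n ∣ l' := by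
  obtain ⟨G, H, hG, hH, e⟩ := h.exists_eq hd
  have := dvd_entry_32 (K := k.val) (n := n) hG hH h₁ (h₁.trans hc.2.1) h₂
    (by rw [hk]; exact h₅) (by rw [hk]; exact h₆)
  rwa [← e, hk'] at this

/-! ### Distinct representatives lie in distinct double cosets -/

theorem le_of_pow_dvd_pow_mul (hϖ : Irreducible ϖ) {m n : ℕ} {u : O} (hu : IsUnit u)
    (h : ϖ ^ m ∣ u * ϖ ^ n) : m ≤ n :=
  (pow_dvd_pow_iff hϖ.ne_zero hϖ.not_isUnit).1 ((hu.dvd_mul_left).1 h)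

theorem le_of_pow_dvd_pow (hϖ : Irreducible ϖ) {m n : ℕ} (h : ϖ ^ m ∣ ϖ ^ n) : m ≤ n :=
  (pow_dvd_pow_iff hϖ.ne_zero hϖ.not_isUnit).1 h

/-- The exponent `β` is read off from the entry `31`, and `α` from the entry `31` of the inverse. -/
theorem SameCoset.le_s1 (hϖ : Irreducible ϖ) (hc : InT c) (hd : InT d) {α β α' β' : ℕ}
    (h : SameCoset ϖ c d (s1Rep ϖ α β) (s1Rep ϖ α' β')) (hβ : β ≤ c 1 ∧ β ≤ d 2 ∧ β ≤ α + d 0)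
    (hα : α ≤ d 1 ∧ α ≤ c 2 ∧ α ≤ β + c 0) : α ≤ α' ∧ β ≤ β' := by
  obtain ⟨c1, c2, c3⟩ := id hc
  obtain ⟨d1, d2, d3⟩ := id hd
  rw [s1Rep_eq, s1Rep_eq] at h
  refine ⟨?_, ?_⟩
  · have h' := h.inv
    rw [inv_s1Form, inv_s1Form] at h'
    have := h'.dvd_31 (n := α) hc (val_s1Form _ _) (val_s1Form _ _) (by omega) (by omega)
      (by omega) (by rw [mul_one]; exact pow_dvd_pow _ (by omega))
      (by rw [mul_neg, ← pow_add]; exact (pow_dvd_pow _ (by omega)).neg_right) dvd_rfl.neg_right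
    exact le_of_pow_dvd_pow hϖ ((dvd_neg).1 this)
  · have := h.dvd_31 (n := β) hd (val_s1Form _ _) (val_s1Form _ _) (by omega) (by omega)
      (by omega) (by rw [mul_one]; exact pow_dvd_pow _ (by omega))
      (by rw [← pow_add]; exact pow_dvd_pow _ (by omega)) dvd_rfl
    exact le_of_pow_dvd_pow hϖ this

theorem SameCoset.le_s2 (hϖ : Irreducible ϖ) (hc : InT c) (hd : InT d) {α β α' β' : ℕ}
    (h : SameCoset ϖ c d (s2Rep ϖ α β) (s2Rep ϖ α' β')) (hβ : β ≤ c 0 ∧ β ≤ d 2 ∧ β ≤ α + d 1)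
    (hα : α ≤ d 0 ∧ α ≤ c 2 ∧ α ≤ β + c 1) : α ≤ α' ∧ β ≤ β' := by
  obtain ⟨c1, c2, c3⟩ := id hc
  obtain ⟨d1, d2, d3⟩ := id hd
  rw [s2Rep_eq, s2Rep_eq] at h
  refine ⟨?_, ?_⟩
  · have := h.dvd_31 (n := α) hd (val_s2Form _ _) (val_s2Form _ _) (by omega) (by omega)
      (by omega) (by rw [← pow_add]; exact pow_dvd_pow _ (by omega))
      (by rw [mul_one]; exact pow_dvd_pow _ (by omega)) dvd_rfl
    exact le_of_pow_dvd_pow hϖ this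
  · have h' := h.inv
    rw [inv_s2Form, inv_s2Form] at h'
    have := h'.dvd_31 (n := β) hc (val_s2Form _ _) (val_s2Form _ _) (by omega) (by omega)
      (by omega) (by rw [mul_neg, ← pow_add]; exact (pow_dvd_pow _ (by omega)).neg_right)
      (by rw [mul_one]; exact pow_dvd_pow _ (by omega)) dvd_rfl.neg_right
    exact le_of_pow_dvd_pow hϖ ((dvd_neg).1 this)

theorem not_sameCoset_lower_s1 (hϖ : Irreducible ϖ) (hd : InT d) (hc0 : 1 ≤ c 0)
    (hd0 : 1 ≤ d 0) (hA : ϖ ∣ A) (hX : ϖ ∣ X) :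
    ¬ SameCoset ϖ c d (lowerForm A B X) (s1Form Z Y) := by
  intro h
  have := h.dvd_21 (n := 1) hd (val_lowerForm _ _ _) (val_s1Form _ _) hc0 hd0
    (by rwa [pow_one]) (by rwa [pow_one])
  rw [pow_one] at this
  exact hϖ.not_isUnit (isUnit_of_dvd_one this)

theorem not_sameCoset_lower_s2 (hϖ : Irreducible ϖ) (hc : InT c) (hd : InT d) (hc1 : 1 ≤ c 1)
    (hd1 : 1 ≤ d 1) (hB : ϖ ∣ B) (hX : ϖ ∣ X) :
    ¬ SameCoset ϖ c d (lowerForm A B X) (s2Form Z Y) := by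
  intro h
  have := h.dvd_32 (n := 1) hc hd (val_lowerForm _ _ _) (val_s2Form _ _) hc1 hd1
    (by rwa [pow_one]) (by rwa [pow_one])
  rw [pow_one] at this
  exact hϖ.not_isUnit (isUnit_of_dvd_one this)

theorem not_sameCoset_s1_s2 (hϖ : Irreducible ϖ) (hc : InT c) (hd : InT d) (hc1 : 1 ≤ c 1)
    (hd1 : 1 ≤ d 1) (hZ : ϖ ∣ Z) (hY : ϖ ∣ Y) :
    ¬ SameCoset ϖ c d (s1Form Z Y) (s2Form Z' Y') := by
  intro h
  have := h.dvd_32 (n := 1) hc hd (val_s1Form _ _) (val_s2Form _ _) hc1 hd1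
    (by rwa [pow_one]) (by rwa [pow_one])
  rw [pow_one] at this
  exact hϖ.not_isUnit (isUnit_of_dvd_one this)

/-- The exponents are read off from the entries below the diagonal. If `d₁ = 0`, then `a₃` is `a₂` or
`a₂ + 1`, and the two cases are distinguished by the entry `31` of the inverse. -/
theorem SameCoset.exponents_le (hϖ : Irreducible ϖ) (hc : InT c) (hd : InT d)
    {p q r p' q' r' : ℕ} {x y : Oˣ}
    (h : SameCoset ϖ c d (lowerForm (ϖ ^ p) (ϖ ^ q) (x * ϖ ^ r))
      (lowerForm (ϖ ^ p') (ϖ ^ q') (y * ϖ ^ r')))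
    (hr : Reduced c d p q r) (hr' : Reduced c d p' q' r')
    (h0 : c 0 = 0 → d 0 = 0 → r = q ∧ r' = q') : p ≤ p' ∧ q ≤ q' ∧ r ≤ r' := by
  obtain ⟨c1, c2, c3⟩ := id hc
  obtain ⟨d1, d2, d3⟩ := id hd
  obtain ⟨a1, a2, a3, a4, a5, a6, a7, a8, a9, a10, a11, a12⟩ := hr
  obtain ⟨b1, b2, b3, b4, b5, b6, b7, b8, b9, b10, b11, b12⟩ := hr'
  have hp : p ≤ p' := by
    by_cases h1 : 1 ≤ c 0 ∧ 1 ≤ d 0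
    · have := h.dvd_21 (n := p) hd (val_lowerForm _ _ _) (val_lowerForm _ _ _) (by omega)
        (by omega) dvd_rfl ((pow_dvd_pow _ a3).mul_left _)
      exact le_of_pow_dvd_pow hϖ this
    · omega
  have hq : q ≤ q' := by
    have := h.dvd_32 (n := q) hc hd (val_lowerForm _ _ _) (val_lowerForm _ _ _) (by omega)
        (by omega) dvd_rfl ((pow_dvd_pow _ a4).mul_left _)
    exact le_of_pow_dvd_pow hϖ this
  refine ⟨hp, hq, ?_⟩
  by_cases h1 : 1 ≤ d 0
  · have := h.dvd_31 (n := r) hd (val_lowerForm _ _ _) (val_lowerForm _ _ _) (by omega)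
        (by omega) (by omega) (by rw [← pow_add]; exact pow_dvd_pow _ (by omega))
        (by rw [← pow_add]; exact pow_dvd_pow _ (by omega)) (dvd_mul_left _ _)
    exact le_of_pow_dvd_pow_mul hϖ y.isUnit this
  · by_cases h2 : r = q
    · omega
    by_contra hlt
    have hr1 : r = q + 1 := by omega
    have hp1 : p = 1 := by omega
    have hp1' : p' = 1 := by omega
    have hq' : r' = q := by omega
    subst hr1 hp1 hp1' hq'
    have h' := h.inv
    rw [inv_lowerForm, inv_lowerForm] at h'
    have := h'.dvd_31 (n := r' + 1) hc (val_lowerForm _ _ _) (val_lowerForm _ _ _) (by omega)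
        (by omega) (by omega)
        (by rw [mul_neg, ← pow_add]; exact (pow_dvd_pow _ (by omega)).neg_right)
        (by rw [mul_neg, ← pow_add]; exact (pow_dvd_pow _ (by omega)).neg_right)
        (dvd_sub (by rw [← pow_add, add_comm]) (dvd_mul_left _ _))
    rw [dvd_sub_right (by rw [← pow_add]; exact pow_dvd_pow _ (by omega))] at this
    have := le_of_pow_dvd_pow_mul hϖ y.isUnit this
    omega

end sameCoset

section params

variable {c d : Fin 3 → ℕ}

/-- In a double coset the diagonal entries of the two factors agree modulo the level. -/
theorem pow_dvd_sub_of_mul_eq (hϖ : Irreducible ϖ) {p q r l : ℕ} {x y : O}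
    {g₁ g₂ g₃ g₄ g₅ g₆ g₇ g₈ g₉ h₁ h₂ h₃ h₄ h₅ h₆ h₇ h₈ h₉ : O}
    (e : !![g₁, g₂, g₃; g₄, g₅, g₆; g₇, g₈, g₉] * !![1, 0, 0; ϖ ^ p, 1, 0; x * ϖ ^ r, ϖ ^ q, 1] =
      !![1, 0, 0; ϖ ^ p, 1, 0; y * ϖ ^ r, ϖ ^ q, 1] * !![h₁, h₂, h₃; h₄, h₅, h₆; h₇, h₈, h₉])
    (g4 : ϖ ^ (p + l) ∣ g₄) (g8 : ϖ ^ (q + l) ∣ g₈) (h4 : ϖ ^ (p + l) ∣ h₄)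
    (h8 : ϖ ^ (q + l) ∣ h₈) (hp : l ≤ p) (hq : l ≤ q) (hpr : p + l ≤ r) (hqr : q + l ≤ r) :
    ϖ ^ l ∣ g₉ - g₁ ∧ ϖ ^ l ∣ h₁ - g₁ := by
  rw [Matrix.mul_fin_three, Matrix.mul_fin_three] at e
  have e00 := congrFun (congrFun e 0) 0
  have e10 := congrFun (congrFun e 1) 0
  have e11 := congrFun (congrFun e 1) 1
  have e21 := congrFun (congrFun e 2) 1
  simp only [Matrix.of_apply, Matrix.cons_val] at e00 e10 e11 e21
  have a1 : ϖ ^ l ∣ g₅ - h₁ := by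
    apply pow_dvd_cancel hϖ (a := p)
    have : ϖ ^ p * (g₅ - h₁) = h₄ - g₄ - g₆ * x * ϖ ^ r := by linear_combination e10
    rw [this]
    exact dvd_sub (dvd_sub h4 g4) ((pow_dvd_pow ϖ hpr).mul_left _)
  have a2 : ϖ ^ l ∣ g₉ - h₅ := by
    apply pow_dvd_cancel hϖ (a := q)
    have : ϖ ^ q * (g₉ - h₅) = h₈ - g₈ + y * h₂ * ϖ ^ r := by linear_combination e21
    rw [this]
    exact dvd_add (dvd_sub h8 g8) ((pow_dvd_pow ϖ hqr).mul_left _)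
  have a3 : ϖ ^ l ∣ h₅ - g₅ := by
    have : h₅ - g₅ = g₆ * ϖ ^ q - h₂ * ϖ ^ p := by linear_combination -e11
    rw [this]
    exact dvd_sub ((pow_dvd_pow ϖ hq).mul_left _) ((pow_dvd_pow ϖ hp).mul_left _)
  have a4 : ϖ ^ l ∣ h₁ - g₁ := by
    have : h₁ - g₁ = g₂ * ϖ ^ p + g₃ * x * ϖ ^ r := by linear_combination -e00
    rw [this]
    exact dvd_add ((pow_dvd_pow ϖ hp).mul_left _) ((pow_dvd_pow ϖ (by omega)).mul_left _)
  refine ⟨?_, a4⟩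
  have : g₉ - g₁ = (g₉ - h₅) + (h₅ - g₅) + (g₅ - h₁) + (h₁ - g₁) := by ring
  rw [this]
  exact dvd_add (dvd_add (dvd_add a2 a3) a1) a4

theorem val_form (g : GL (Fin 3) O) : g.val = !![g 0 0, g 0 1, g 0 2; g 1 0, g 1 1, g 1 2;
    g 2 0, g 2 1, g 2 2] := Matrix.eta_fin_three g.val

/-- The bounds encoded in a level `l`, if `l ≠ 0`. -/
theorem le_of_level_eq' {c d a : Fin 3 → ℕ} {l : ℕ}
    (h : level (fun i => (c i : ℤ)) (fun i => (d i : ℤ)) (fun i => (a i : ℤ)) = l) :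
    l = 0 ∨ ((l ≤ a 0 ∧ l ≤ a 1 ∧ a 0 + l ≤ a 2 ∧ a 1 + l ≤ a 2) ∧
    (a 0 + l ≤ c 0 ∧ a 1 + l ≤ c 1 ∧ a 2 + l ≤ c 2) ∧
    (a 0 + l ≤ d 0 ∧ a 1 + l ≤ d 1 ∧ a 2 + l ≤ d 2) ∧
    a 2 + l ≤ a 0 + c 1 ∧ a 2 + l ≤ d 0 + a 1) := by
  rcases Nat.eq_zero_or_pos l with h0 | h0
  · exact Or.inl h0
  right
  have aux : ∀ z : ℤ, z.toNat = l → (l : ℤ) ≤ z := fun z hz => by omega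
  have := aux _ h
  simp only [minEntry, Pi.sub_apply, le_min_iff] at this
  omega

/-- The bounds encoded in a positive integer that is at most the level `a(c,d)'`. -/
theorem le_of_le_level' {c d a : Fin 3 → ℕ} {i : ℕ}
    (h : i ≤ level' (fun i => (c i : ℤ)) (fun i => (d i : ℤ)) (fun i => (a i : ℤ))) (hi : i ≠ 0) :
    a 2 + i ≤ c 2 ∧ a 2 + i ≤ d 2 ∧ a 0 + i ≤ c 0 ∧ a 1 + i ≤ d 1 := by
  rw [level'_natCast] at h
  simp only [le_min_iff] at h
  omega

/-- If `a₁ + a₂ = a₃`, the truncated valuation of `x - 1` is an invariant of the double coset,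
because it is read off from the inverse matrix. -/
theorem SameCoset.pow_dvd_sub_one (hϖ : Irreducible ϖ) (hc : InT c) {a : Fin 3 → ℕ}
    (ha : a 0 + a 1 = a 2) {x y : Oˣ}
    (h : SameCoset ϖ c d (tRep ϖ (fun i => (a i : ℤ)) x) (tRep ϖ (fun i => (a i : ℤ)) y)) {i : ℕ}
    (hi : i ≤ level' (fun i => (c i : ℤ)) (fun i => (d i : ℤ)) (fun i => (a i : ℤ)))
    (hx : ϖ ^ i ∣ (x : O) - 1) : ϖ ^ i ∣ (y : O) - 1 := by
  rcases eq_or_ne i 0 with rfl | h0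
  · simp
  obtain ⟨i1, i2, i3, i4⟩ := le_of_le_level' hi h0
  rw [tRep_eq, tRep_eq] at h
  have h' := h.inv
  rw [inv_lowerForm, inv_lowerForm] at h'
  have e : ∀ z : O, ϖ ^ a 0 * ϖ ^ a 1 - z * ϖ ^ a 2 = ϖ ^ a 2 * -(z - 1) := by
    intro z; rw [← pow_add, ha]; ring
  have := h'.dvd_31 (n := a 2 + i) hc (val_lowerForm _ _ _) (val_lowerForm _ _ _) (by omega)
    (by omega) (by omega)
    (by rw [mul_neg, ← pow_add]; exact (pow_dvd_pow _ (by omega)).neg_right)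
    (by rw [mul_neg, ← pow_add]; exact (pow_dvd_pow _ (by omega)).neg_right)
    (by rw [e, pow_add]; exact mul_dvd_mul_left _ hx.neg_right)
  rw [e] at this
  exact (dvd_neg).1 (pow_dvd_cancel hϖ this)

theorem le_min_val_iff (hϖ : Irreducible ϖ) {n m : ℕ} {z : O} :
    (n : ℕ∞) ≤ min (val z) m ↔ ϖ ^ n ∣ z ∧ n ≤ m := by
  rw [le_min_iff, natCast_le_val_iff hϖ, Nat.cast_le]

theorem exists_min_val_eq (z : O) (m : ℕ) : ∃ i : ℕ, min (val z) m = i :=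
  ⟨_, (ENat.natCast_toNat (ne_top_of_le_ne_top (ENat.natCast_ne_top m) (min_le_right _ _))).symm⟩

/-- Units `x` and `y` for which `t_{a,x}` and `t_{a,y}` lie in the same double coset represent the
same element of `X^a_{c,d}`. -/
theorem SameCoset.sameParam (hϖ : Irreducible ϖ) (hc : InT c) (hd : InT d) {a : Fin 3 → ℕ}
    (hr : Reduced c d (a 0) (a 1) (a 2)) {x y : Oˣ}
    (h : SameCoset ϖ c d (tRep ϖ (fun i => (a i : ℤ)) x) (tRep ϖ (fun i => (a i : ℤ)) y)) :
    SameParam (fun i => (c i : ℤ)) (fun i => (d i : ℤ)) (fun i => (a i : ℤ)) x y := by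
  obtain ⟨c1, c2, c3⟩ := id hc
  obtain ⟨d1, d2, d3⟩ := id hd
  obtain ⟨a1, a2, a3, a4, a5, a6, a7, a8, a9, a10, a11, a12⟩ := hr
  have hsymm := h.symm hc hd
  obtain ⟨g, k, hg, hk, e⟩ := id h
  have hu9 : IsUnit (g 2 2) := isUnit_corner hϖ (by omega) (by omega) hg
    ((Matrix.isUnit_iff_isUnit_det _).1 g.isUnit)
  have e' := congrArg Units.val e
  rw [Units.val_mul, Units.val_mul, tRep_eq, tRep_eq, val_lowerForm, val_lowerForm,
    val_form g, val_form k] at e'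
  obtain ⟨g10, g21, g20⟩ := hg
  obtain ⟨k10, k21, k20⟩ := hk
  change ϖ ^ c 0 ∣ g 1 0 at g10
  change ϖ ^ c 1 ∣ g 2 1 at g21
  change ϖ ^ c 2 ∣ g 2 0 at g20
  change ϖ ^ d 0 ∣ k 1 0 at k10
  change ϖ ^ d 1 ∣ k 2 1 at k21
  change ϖ ^ d 2 ∣ k 2 0 at k20
  generalize g 0 0 = g₁ at *
  generalize g 0 1 = g₂ at *
  generalize g 0 2 = g₃ at *
  generalize g 1 0 = g₄ at *
  generalize g 1 1 = g₅ at *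
  generalize g 1 2 = g₆ at *
  generalize g 2 0 = g₇ at *
  generalize g 2 1 = g₈ at *
  generalize g 2 2 = g₉ at *
  generalize k 0 0 = h₁ at *
  generalize k 0 1 = h₂ at *
  generalize k 0 2 = h₃ at *
  generalize k 1 0 = h₄ at *
  generalize k 1 1 = h₅ at *
  generalize k 1 2 = h₆ at *
  generalize k 2 0 = h₇ at *
  generalize k 2 1 = h₈ at *
  generalize k 2 2 = h₉ at *
  obtain ⟨l, hl⟩ : ∃ l, level (fun i => (c i : ℤ)) (fun i => (d i : ℤ)) (fun i => (a i : ℤ)) = l :=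
    ⟨_, rfl⟩
  have hll := le_of_level_eq' hl
  have hdiag : l = 0 ∨ ϖ ^ l ∣ g₉ - g₁ ∧ ϖ ^ l ∣ h₁ - g₁ := by
    rcases hll with h0 | ⟨l1, l2, l3, -⟩
    · exact Or.inl h0
    · exact Or.inr (pow_dvd_sub_of_mul_eq hϖ e' (pow_dvd_of_le g10 (by omega))
        (pow_dvd_of_le g21 (by omega)) (pow_dvd_of_le k10 (by omega))
        (pow_dvd_of_le k21 (by omega)) (by omega) (by omega) (by omega) (by omega))
  rw [Matrix.mul_fin_three, Matrix.mul_fin_three] at e'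
  have e00 := congrFun (congrFun e' 0) 0
  have e01 := congrFun (congrFun e' 0) 1
  have e10 := congrFun (congrFun e' 1) 0
  have e11 := congrFun (congrFun e' 1) 1
  have e20 := congrFun (congrFun e' 2) 0
  have e21 := congrFun (congrFun e' 2) 1
  simp only [Matrix.of_apply, Matrix.cons_val] at e00 e01 e10 e11 e20 e21
  clear e'
  unfold SameParam
  rw [hl]
  split_ifs with ha
  · replace ha : (a 0 : ℤ) + a 1 = a 2 := ha
    norm_cast at ha
    obtain ⟨l', hl'⟩ : ∃ l', level' (fun i => (c i : ℤ)) (fun i => (d i : ℤ))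
      (fun i => (a i : ℤ)) = l' := ⟨_, rfl⟩
    have hi₁ := fun i => h.pow_dvd_sub_one (i := i) hϖ hc ha
    have hi₂ := fun i => hsymm.pow_dvd_sub_one (i := i) hϖ hc ha
    have hl₁ := fun i => le_of_le_level' (c := c) (d := d) (a := a) (i := i)
    simp only [hl'] at hi₁ hi₂ hl₁ ⊢
    obtain ⟨i, hi⟩ := exists_min_val_eq ((x : O) - 1) l'
    obtain ⟨j, hj⟩ := exists_min_val_eq ((y : O) - 1) l'
    obtain ⟨xi, il⟩ := (le_min_val_iff hϖ).1 hi.ge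
    obtain ⟨yj, jl⟩ := (le_min_val_iff hϖ).1 hj.ge
    have hij : i ≤ j := by
      have := hj ▸ (le_min_val_iff hϖ).2 ⟨hi₁ i il xi, il⟩
      exact_mod_cast this
    have hji : j ≤ i := by
      have := hi ▸ (le_min_val_iff hϖ).2 ⟨hi₂ j jl yj, jl⟩
      exact_mod_cast this
    obtain rfl : i = j := le_antisymm hij hji
    refine ⟨hi.trans hj.symm, ?_⟩
    rw [hi]
    have goal : ϖ ^ (min (i + l) l') ∣ (x : O) - y := by
      rcases Nat.eq_zero_or_pos (min (i + l) l') with h0 | h0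
      · rw [h0]; simp
      obtain ⟨m1, m2, m3, m4⟩ := hl₁ l' le_rfl (by omega)
      have key : ϖ ^ l' ∣ (x - 1) * g₉ - (y - 1) * g₁ +
          (1 - y) * (x - 1) * g₃ * (ϖ ^ a 0 * ϖ ^ a 1) + (1 - x) * g₆ * ϖ ^ a 1 := by
        apply pow_dvd_cancel hϖ (a := a 2)
        have : ϖ ^ a 2 * ((x - 1) * g₉ - (y - 1) * g₁ +
            (1 - y) * (x - 1) * g₃ * (ϖ ^ a 0 * ϖ ^ a 1) + (1 - x) * g₆ * ϖ ^ a 1) =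
            h₇ - g₇ - ϖ ^ a 0 * h₈ + ϖ ^ a 1 * g₄ := by
          rw [← ha, pow_add] at e00 e10 e20 e21 ⊢
          linear_combination e20 - ϖ ^ a 0 * e21 - ϖ ^ a 1 * e10 + ϖ ^ a 0 * ϖ ^ a 1 *
            (e11 + (1 - y) * (e00 - ϖ ^ a 0 * e01))
        rw [this]
        exact dvd_add (dvd_sub (dvd_sub (pow_dvd_of_le k20 (by omega))
          (pow_dvd_of_le g20 (by omega))) (pow_dvd_pow_mul k21 (by omega)))
          (pow_dvd_pow_mul g10 (by omega))
      have hlq : l ≤ a 0 ∧ l ≤ a 1 := by omega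
      have y1 : ϖ ^ i * ϖ ^ l ∣ (y - 1) * (g₉ - g₁) := by
        rcases hdiag with rfl | ⟨k1, -⟩
        · simpa using yj.mul_right _
        · exact mul_dvd_mul yj k1
      have y2 : ϖ ^ i * ϖ ^ l ∣ (1 - y) * (x - 1) * g₃ * (ϖ ^ a 0 * ϖ ^ a 1) := by
        rw [mul_assoc, mul_comm (1 - (y : O)), mul_assoc]
        refine mul_dvd_mul xi (Dvd.dvd.mul_left ?_ _)
        exact ((pow_dvd_pow_mul_left hlq.1).mul_left _)
      have y3 : ϖ ^ i * ϖ ^ l ∣ (1 - x) * g₆ * ϖ ^ a 1 := by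
        rw [mul_assoc]
        refine mul_dvd_mul ?_ ((pow_dvd_pow ϖ hlq.2).mul_left _)
        rw [← neg_sub]
        exact xi.neg_right
      have hmin : ϖ ^ min (i + l) l' ∣ ϖ ^ i * ϖ ^ l := by
        rw [← pow_add]; exact pow_dvd_pow _ (min_le_left _ _)
      apply dvd_of_dvd_mul_unit hu9
      have : (x - y : O) * g₉ = ((x - 1) * g₉ - (y - 1) * g₁ +
          (1 - y) * (x - 1) * g₃ * (ϖ ^ a 0 * ϖ ^ a 1) + (1 - x) * g₆ * ϖ ^ a 1) -
          (y - 1) * (g₉ - g₁) - (1 - y) * (x - 1) * g₃ * (ϖ ^ a 0 * ϖ ^ a 1) -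
          (1 - x) * g₆ * ϖ ^ a 1 := by ring
      rw [this]
      exact dvd_sub (dvd_sub (dvd_sub ((pow_dvd_pow _ (min_le_right _ _)).trans key)
        (hmin.trans y1)) (hmin.trans y2)) (hmin.trans y3)
    have := (natCast_le_val_iff hϖ).2 goal
    exact_mod_cast this
  · rw [natCast_le_val_iff hϖ]
    rcases hll with rfl | ⟨l1, l2, l3, l4, l5⟩
    · simp
    rcases hdiag with rfl | ⟨k1, k2⟩
    · simp
    have k3 : ϖ ^ l ∣ x * g₉ - y * h₁ := by
      apply pow_dvd_cancel hϖ (a := a 2)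
      have : ϖ ^ a 2 * (x * g₉ - y * h₁) = h₄ * ϖ ^ a 1 + h₇ - g₇ - g₈ * ϖ ^ a 0 := by
        linear_combination e20
      rw [this]
      exact dvd_sub (dvd_sub (dvd_add
        ((pow_dvd_pow_mul k10 (by omega)).trans (mul_comm _ _).dvd) (pow_dvd_of_le k20 (by omega)))
        (pow_dvd_of_le g20 (by omega)))
        ((pow_dvd_pow_mul g21 (by omega)).trans (mul_comm _ _).dvd)
    apply dvd_of_dvd_mul_unit hu9
    have : (x - y : O) * g₉ = (x * g₉ - y * h₁) - y * (g₉ - g₁) + y * (h₁ - g₁) := by ring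
    rw [this]
    exact dvd_add (dvd_sub k3 (k1.mul_left _)) (k2.mul_left _)

end params

/-! ### The index sets for exponents in `ℕ` -/

section index

variable {c d : Fin 3 → ℕ}

/-- The set `𝒯_{c,d}` in terms of `Reduced`. As `c₂, d₂ ≥ 1`, only two of the cases in its definition
occur. -/
theorem mem_tripleSet_iff (hc : InT c) (hd : InT d) (hc1 : 1 ≤ c 1) (hd1 : 1 ≤ d 1)
    (a : Fin 3 → ℕ) :
    (fun i => (a i : ℤ)) ∈ tripleSet (fun i => (c i : ℤ)) (fun i => (d i : ℤ)) ↔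
      Reduced c d (a 0) (a 1) (a 2) ∧ (c 0 = 0 → d 0 = 0 → a 0 = 1 ∧ a 2 = a 1) := by
  obtain ⟨c1, c2, c3⟩ := id hc
  obtain ⟨d1, d2, d3⟩ := id hd
  have n1 : ¬ ((fun i => (c i : ℤ)) = 0 ∨ (fun i => (d i : ℤ)) = 0) := by
    rintro (h | h)
    · have := congrFun h 1; simp only [Pi.zero_apply] at this; omega
    · have := congrFun h 1; simp only [Pi.zero_apply] at this; omega
  have n2 : ¬ (0 < (c 0 : ℤ) * d 0 ∧ (c 1 : ℤ) = 0 ∧ (d 1 : ℤ) = 0) := by omega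
  have n3 : (0 < (c 1 : ℤ) * d 1 ∧ (c 0 : ℤ) = 0 ∧ (d 0 : ℤ) = 0) ↔ c 0 = 0 ∧ d 0 = 0 := by
    have : 0 < (c 1 : ℤ) * d 1 := mul_pos (by omega) (by omega)
    simp [this]
  unfold tripleSet
  rw [if_neg n1]
  simp only [n3, if_neg n2]
  split_ifs with h0
  · simp only [Set.mem_ofPred_eq, le_min_iff]
    constructor
    · rintro ⟨k, hk1, hk2, e⟩
      have e0 := congrFun e 0
      have e1 := congrFun e 1
      have e2 := congrFun e 2
      simp only [Matrix.cons_val] at e0 e1 e2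
      exact ⟨⟨by omega, by omega, by omega, by omega, by omega, by omega, by omega, by omega,
        by omega, by omega, by omega, by omega⟩, by omega⟩
    · rintro ⟨⟨b1, b2, b3, b4, b5, b6, b7, b8, b9, b10, b11, b12⟩, h⟩
      obtain ⟨h1, h2⟩ := h h0.1 h0.2
      refine ⟨a 1, by omega, by omega, ?_⟩
      funext i
      fin_cases i
      · simp [h1]
      · simp
      · simp [h2]
  · simp only [posetT1, under, Set.mem_ofPred_eq, Pi.le_def, Fin.forall_fin_succ, le_min_iff,
      Fin.isValue, Fin.succ_zero_eq_one, Fin.succ_one_eq_two, IsEmpty.forall_iff, and_true]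
    constructor
    · rintro ⟨b1, b2, b3, b4⟩
      exact ⟨⟨by omega, by omega, by omega, by omega, by omega, by omega, by omega, by omega,
        by omega, by omega, by omega, by omega⟩, by omega⟩
    · rintro ⟨⟨b1, b2, b3, b4, b5, b6, b7, b8, b9, b10, b11, b12⟩, h⟩
      refine ⟨by omega, by omega, by omega, by omega⟩

theorem exists_natCast_of_mem_tripleSet {c d a : Triple} (h : a ∈ tripleSet c d) :
    ∃ a' : Fin 3 → ℕ, a = fun i => (a' i : ℤ) := by
  have h3 : 0 ≤ a 0 ∧ 0 ≤ a 1 ∧ 0 ≤ a 2 := by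
    unfold tripleSet at h
    split_ifs at h
    · rw [Set.mem_singleton_iff] at h
      subst h
      simp
    · obtain ⟨k, h1, -, rfl⟩ := h
      simp only [Matrix.cons_val]; omega
    · obtain ⟨k, h1, -, rfl⟩ := h
      simp only [Matrix.cons_val]; omega
    · obtain ⟨⟨h0, h1, h2, -⟩, -⟩ := h
      omega
  refine ⟨fun i => (a i).toNat, funext fun i => ?_⟩
  fin_cases i
  · exact (Int.toNat_of_nonneg h3.1).symm
  · exact (Int.toNat_of_nonneg h3.2.1).symm
  · exact (Int.toNat_of_nonneg h3.2.2).symm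

theorem weylSet_of_pos (hc : InT c) (hd : InT d) (hc1 : 1 ≤ c 1) (hd1 : 1 ≤ d 1)
    (hc0 : 1 ≤ c 0) (hd0 : 1 ≤ d 0) :
    weylSet (fun i => (c i : ℤ)) (fun i => (d i : ℤ)) = Set.univ := by
  obtain ⟨c1, c2, c3⟩ := id hc
  obtain ⟨d1, d2, d3⟩ := id hd
  have hc' : ∀ i, (1 : ℤ) ≤ c i := by
    intro i; fin_cases i <;> dsimp <;> omega
  have hd' : ∀ i, (1 : ℤ) ≤ d i := by
    intro i; fin_cases i <;> dsimp <;> omega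
  unfold weylSet
  rw [if_pos ⟨hc', hd'⟩]

theorem one_mem_weylSet (c d : Triple) : Weyl.one ∈ weylSet c d := by
  unfold weylSet
  split_ifs <;> simp

theorem pos_of_s1_mem_weylSet (hc1 : 1 ≤ c 1) (hd1 : 1 ≤ d 1)
    (h : Weyl.s1 ∈ weylSet (fun i => (c i : ℤ)) (fun i => (d i : ℤ))) : 1 ≤ c 0 ∧ 1 ≤ d 0 := by
  unfold weylSet at h
  split_ifs at h with h1 h2
  · exact ⟨Int.ofNat_le.1 (h1.1 0), Int.ofNat_le.1 (h1.2 0)⟩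
  · have : (c 1 : ℤ) * d 1 ≠ 0 := mul_ne_zero (by omega) (by omega)
    exact absurd h2.2 this
  all_goals simp at h

end index

/-! ### The double cosets supporting intertwining operators -/

section main

variable {χ₂ χ₃ : Oˣ →* ℂˣ} {M N : ℕ} {c d : Fin 3 → ℕ}

/-- The sets `S^w` collect the admissible elements of the sets `R^w`. -/
theorem suppSet_eq (hϖ : Irreducible ϖ) (h2 : IsUnit (2 : O)) (hMN : M ≤ N)
    (h₂ : HasConductor χ₂ M) (h₃ : HasConductor χ₃ N) (h₂₃ : HasConductor (χ₂ * χ₃⁻¹) N)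
    (hc : Good M N c) (hd : Good M N d)
    (σ : ∀ a : Triple, Param O (fun i => (c i : ℤ)) (fun i => (d i : ℤ)) a → Oˣ) (w : Weyl)
    (hw : w ∈ weylSet (fun i => (c i : ℤ)) (fun i => (d i : ℤ))) :
    suppSet ϖ M N (fun i => (c i : ℤ)) (fun i => (d i : ℤ)) σ w =
      {r ∈ repSet ϖ (fun i => (c i : ℤ)) (fun i => (d i : ℤ)) σ w |
        Admissible χ₂ χ₃ ϖ c d r} := by
  obtain ⟨hcT, hN, hcM, hcN⟩ := id hc
  obtain ⟨hdT, -, hdM, hdN⟩ := id hd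
  obtain ⟨c1, c2, c3⟩ := id hcT
  obtain ⟨d1, d2, d3⟩ := id hdT
  have hc1 : 1 ≤ c 1 := hN.trans hcN
  have hd1 : 1 ≤ d 1 := hN.trans hdN
  ext g
  rw [Set.mem_sep_iff]
  cases w with
  | one =>
    have key : ∀ a ∈ tripleSet (fun i => (c i : ℤ)) (fun i => (d i : ℤ)), ∀ x : Oˣ,
        Admissible χ₂ χ₃ ϖ c d (tRep ϖ a x) ↔
          TCond M N (fun i => (c i : ℤ)) (fun i => (d i : ℤ)) a x := by
      intro a ha x
      obtain ⟨a, rfl⟩ := exists_natCast_of_mem_tripleSet ha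
      have hr := ((mem_tripleSet_iff hcT hdT hc1 hd1 a).1 ha).1
      exact admissible_t_iff hϖ h2 hMN h₂ h₃ h₂₃ hc hd hr.p_pos hr.q_pos hr.p_le hr.q_le
    constructor
    · rintro ⟨a, ha, ξ, hT, rfl⟩
      exact ⟨⟨a, ha, ξ, rfl⟩, (key a ha _).2 hT⟩
    · rintro ⟨⟨a, ha, ξ, rfl⟩, hA⟩
      exact ⟨a, ha, ξ, (key a ha _).1 hA, rfl⟩
  | s1 =>
    obtain ⟨hc0, hd0⟩ := pos_of_s1_mem_weylSet hc1 hd1 hw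
    simp only [suppSet, repSet, under, Set.mem_ofPred_eq, le_min_iff, le_sub_iff_add_le]
    constructor
    · rintro ⟨α, β, ⟨h1, h3⟩, ⟨h4, h5⟩, ⟨h6, h7⟩, rfl⟩
      have := (admissible_s1_iff hϖ hMN h₂ h₃ hc hd hc0 hd0 (α := α) (β := β) (by omega)
        (by omega) (by omega) (by omega) (by omega) (by omega)).2
      exact ⟨⟨α, β, by omega, by omega, by omega, rfl⟩, this (by omega)⟩
    · rintro ⟨⟨α, β, ⟨h1, h3⟩, ⟨h4, h5⟩, ⟨h6, h7⟩, rfl⟩, h⟩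
      have := (admissible_s1_iff hϖ hMN h₂ h₃ hc hd hc0 hd0 (α := α) (β := β) (by omega)
        (by omega) (by omega) (by omega) (by omega) (by omega)).1 h
      exact ⟨α, β, by omega, by omega, by omega, rfl⟩
  | s2 =>
    simp only [suppSet, repSet, under, Set.mem_ofPred_eq, le_min_iff, le_sub_iff_add_le]
    constructor
    · rintro ⟨α, β, ⟨h1, h3⟩, ⟨h4, h5⟩, ⟨h6, h7⟩, rfl⟩
      have := (admissible_s2_iff hϖ hMN h₂ h₃ h₂₃ hc hd (α := α) (β := β) (by omega)
        (by omega)).2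
      exact ⟨⟨α, β, by omega, by omega, by omega, rfl⟩, this (by omega)⟩
    · rintro ⟨⟨α, β, ⟨h1, h3⟩, ⟨h4, h5⟩, ⟨h6, h7⟩, rfl⟩, h⟩
      have := (admissible_s2_iff hϖ hMN h₂ h₃ h₂₃ hc hd (α := α) (β := β) (by omega)
        (by omega)).1 h
      exact ⟨α, β, by omega, by omega, by omega, rfl⟩
  | s1s2 =>
    refine iff_of_false (Set.notMem_empty g) ?_
    rintro ⟨⟨α, -, -, rfl⟩, h⟩
    exact not_admissible_s1s2 hN h₃ _ h
  | s2s1 =>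
    refine iff_of_false (Set.notMem_empty g) ?_
    rintro ⟨⟨α, -, -, rfl⟩, h⟩
    exact not_admissible_s2s1 hN h₃ _ h
  | w0 =>
    refine iff_of_false (Set.notMem_empty g) ?_
    rintro ⟨rfl, h⟩
    exact not_admissible_w0 hN h₃ h

/-- The elements of the sets `S^w` in explicit form. -/
theorem exists_of_mem_suppSet (hc : Good M N c) (hd : Good M N d)
    {σ : ∀ a : Triple, Param O (fun i => (c i : ℤ)) (fun i => (d i : ℤ)) a → Oˣ} {w : Weyl}
    (hw : w ∈ weylSet (fun i => (c i : ℤ)) (fun i => (d i : ℤ))) {r : GL (Fin 3) O}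
    (hr : r ∈ suppSet ϖ M N (fun i => (c i : ℤ)) (fun i => (d i : ℤ)) σ w) :
    (∃ a : Fin 3 → ℕ, (Reduced c d (a 0) (a 1) (a 2) ∧
      (c 0 = 0 → d 0 = 0 → a 0 = 1 ∧ a 2 = a 1)) ∧
      ∃ ξ, r = tRep ϖ (fun i => (a i : ℤ)) (σ (fun i => (a i : ℤ)) ξ)) ∨
    (1 ≤ c 0 ∧ 1 ≤ d 0) ∧
    ((∃ α β : ℕ, (1 ≤ α ∧ 1 ≤ β) ∧ (β ≤ c 1 ∧ β ≤ d 2 ∧ β ≤ α + d 0) ∧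
      (α ≤ d 1 ∧ α ≤ c 2 ∧ α ≤ β + c 0) ∧ r = s1Rep ϖ α β) ∨
    (∃ α β : ℕ, (1 ≤ α ∧ 1 ≤ β) ∧ (β ≤ c 0 ∧ β ≤ d 2 ∧ β ≤ α + d 1) ∧
      (α ≤ d 0 ∧ α ≤ c 2 ∧ α ≤ β + c 1) ∧ r = s2Rep ϖ α β)) := by
  obtain ⟨hcT, hN, hcM, hcN⟩ := hc
  obtain ⟨hdT, -, hdM, hdN⟩ := hd
  have hc1 : 1 ≤ c 1 := hN.trans hcN
  have hd1 : 1 ≤ d 1 := hN.trans hdN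
  cases w with
  | one =>
    obtain ⟨a, ha, ξ, -, rfl⟩ := hr
    obtain ⟨a, rfl⟩ := exists_natCast_of_mem_tripleSet ha
    exact Or.inl ⟨a, (mem_tripleSet_iff hcT hdT hc1 hd1 a).1 ha, ξ, rfl⟩
  | s1 =>
    simp only [suppSet, Set.mem_ofPred_eq, le_min_iff, le_sub_iff_add_le] at hr
    obtain ⟨α, β, ⟨h1, h3⟩, ⟨h4, h5⟩, ⟨h6, h7⟩, rfl⟩ := hr
    exact Or.inr ⟨pos_of_s1_mem_weylSet hc1 hd1 hw,
      Or.inl ⟨α, β, by omega, by omega, by omega, rfl⟩⟩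
  | s2 =>
    simp only [suppSet, Set.mem_ofPred_eq, le_min_iff, le_sub_iff_add_le] at hr
    obtain ⟨α, β, ⟨h1, h3⟩, ⟨h4, h5⟩, ⟨h6, h7⟩, rfl⟩ := hr
    exact Or.inr ⟨by omega, Or.inr ⟨α, β, by omega, by omega, by omega, rfl⟩⟩
  | s1s2 => exact hr.elim
  | s2s1 => exact hr.elim
  | w0 => exact hr.elim

/-- Distinct elements of the union of the sets `S^w` lie in distinct double cosets. -/
theorem eq_of_sameCoset (hϖ : Irreducible ϖ) (hc : Good M N c) (hd : Good M N d)
    {σ : ∀ a : Triple, Param O (fun i => (c i : ℤ)) (fun i => (d i : ℤ)) a → Oˣ}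
    (hσ : ∀ (a : Triple) (ξ), Quotient.mk (paramSetoid O _ _ a) (σ a ξ) = ξ) {w w' : Weyl}
    (hw : w ∈ weylSet (fun i => (c i : ℤ)) (fun i => (d i : ℤ)))
    (hw' : w' ∈ weylSet (fun i => (c i : ℤ)) (fun i => (d i : ℤ))) {r r' : GL (Fin 3) O}
    (hr : r ∈ suppSet ϖ M N (fun i => (c i : ℤ)) (fun i => (d i : ℤ)) σ w)
    (hr' : r' ∈ suppSet ϖ M N (fun i => (c i : ℤ)) (fun i => (d i : ℤ)) σ w')
    (h : SameCoset ϖ c d r r') : r = r' := by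
  have hcT := hc.inT
  have hdT := hd.inT
  have hc1 : 1 ≤ c 1 := hc.one_le.trans hc.le1
  have hd1 : 1 ≤ d 1 := hd.one_le.trans hd.le1
  have h' := h.symm hcT hdT
  have hdvd : ∀ n : ℕ, 1 ≤ n → ϖ ∣ ϖ ^ n := fun n hn => dvd_pow_self _ (by omega)
  rcases exists_of_mem_suppSet hc hd hw hr with ⟨a, ⟨ha, ha0⟩, ξ, rfl⟩ | ⟨⟨hc0, hd0⟩,
    ⟨α, β, ⟨hα, hβ⟩, hb₁, hb₂, rfl⟩ | ⟨α, β, ⟨hα, hβ⟩, hb₁, hb₂, rfl⟩⟩ <;>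
  rcases exists_of_mem_suppSet hc hd hw' hr' with ⟨b, ⟨hb, hb0⟩, η, rfl⟩ | ⟨⟨hc0, hd0⟩,
    ⟨α', β', ⟨hα', hβ'⟩, hb₁', hb₂', rfl⟩ | ⟨α', β', ⟨hα', hβ'⟩, hb₁', hb₂', rfl⟩⟩
  · have hab : a = b := by
      obtain ⟨p1, p2, p3⟩ := SameCoset.exponents_le hϖ hcT hdT h ha hb
        fun k1 k2 => ⟨(ha0 k1 k2).2, (hb0 k1 k2).2⟩
      obtain ⟨q1, q2, q3⟩ := SameCoset.exponents_le hϖ hcT hdT h' hb ha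
        fun k1 k2 => ⟨(hb0 k1 k2).2, (ha0 k1 k2).2⟩
      funext i
      fin_cases i
      · exact le_antisymm p1 q1
      · exact le_antisymm p2 q2
      · exact le_antisymm p3 q3
    subst hab
    have hs := h.sameParam hϖ hcT hdT ha
    have : ξ = η := by
      rw [← hσ _ ξ, ← hσ _ η]
      exact Quotient.sound hs
    rw [this]
  · exact (not_sameCoset_lower_s1 hϖ hdT hc0 hd0 (hdvd _ ha.p_pos)
      ((hdvd _ (ha.p_pos.trans ha.p_le)).mul_left _) h).elim
  · exact (not_sameCoset_lower_s2 hϖ hcT hdT hc1 hd1 (hdvd _ ha.q_pos)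
      ((hdvd _ (ha.p_pos.trans ha.p_le)).mul_left _) h).elim
  · exact (not_sameCoset_lower_s1 hϖ hdT hc0 hd0 (hdvd _ hb.p_pos)
      ((hdvd _ (hb.p_pos.trans hb.p_le)).mul_left _) h').elim
  · obtain ⟨p1, p2⟩ := h.le_s1 hϖ hcT hdT hb₁ hb₂
    obtain ⟨q1, q2⟩ := h'.le_s1 hϖ hcT hdT hb₁' hb₂'
    rw [le_antisymm p1 q1, le_antisymm p2 q2]
  · exact (not_sameCoset_s1_s2 hϖ hcT hdT hc1 hd1 (hdvd _ hβ) (hdvd _ hα) h).elim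
  · exact (not_sameCoset_lower_s2 hϖ hcT hdT hc1 hd1 (hdvd _ hb.q_pos)
      ((hdvd _ (hb.p_pos.trans hb.p_le)).mul_left _) h').elim
  · exact (not_sameCoset_s1_s2 hϖ hcT hdT hc1 hd1 (hdvd _ hβ') (hdvd _ hα') h').elim
  · obtain ⟨p1, p2⟩ := h.le_s2 hϖ hcT hdT hb₁ hb₂
    obtain ⟨q1, q2⟩ := h'.le_s2 hϖ hcT hdT hb₁' hb₂'
    rw [le_antisymm p1 q1, le_antisymm p2 q2]

theorem Admissible.of_rel (hϖ : Irreducible ϖ) (hMN : M ≤ N) (h₂ : HasConductor χ₂ M)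
    (h₃ : HasConductor χ₃ N) (hc : Good M N c) (hd : Good M N d) {k k' : GL (Fin 3) O}
    (hk : Admissible χ₂ χ₃ ϖ c d k) (h : Rel ϖ c d k.val k'.val) :
    Admissible χ₂ χ₃ ϖ c d k' := by
  rw [← mem_supportingCosets_iff hϖ hMN h₂ h₃ hc hd] at hk ⊢
  rwa [← doubleCoset_eq_of_rel hϖ hc.inT hd.inT h]

/-- Every admissible double coset contains an element of one of the sets `R^w`. -/
theorem exists_rel_repSet (hϖ : Irreducible ϖ) (h2 : IsUnit (2 : O)) (hMN : M ≤ N)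
    (h₂ : HasConductor χ₂ M) (h₃ : HasConductor χ₃ N) (hc : Good M N c) (hd : Good M N d)
    {σ : ∀ a : Triple, Param O (fun i => (c i : ℤ)) (fun i => (d i : ℤ)) a → Oˣ}
    (hσ : ∀ (a : Triple) (ξ), Quotient.mk (paramSetoid O _ _ a) (σ a ξ) = ξ)
    {k : GL (Fin 3) O} (hk : Admissible χ₂ χ₃ ϖ c d k) :
    ∃ w ∈ weylSet (fun i => (c i : ℤ)) (fun i => (d i : ℤ)),
      ∃ r ∈ repSet ϖ (fun i => (c i : ℤ)) (fun i => (d i : ℤ)) σ w,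
        Rel ϖ c d k.val r.val := by
  have hN := hc.one_le
  have hcT := hc.inT
  have hdT := hd.inT
  have hc1 : 1 ≤ c 1 := hc.one_le.trans hc.le1
  have hd1 : 1 ≤ d 1 := hd.one_le.trans hd.le1
  rcases exists_rel_rep hϖ h2 hcT hdT hc1 hd1 k with
    (⟨z, hz⟩ | ⟨z, hz⟩ | hz) | ⟨p, q, r, hr, x, hx⟩ | ⟨⟨hc0, hd0⟩,
    ⟨α, β, hαβ, hβ, hα, hx⟩ | ⟨α, β, hαβ, hβ, hα, hx⟩⟩
  · exact (not_admissible_s1s2 hN h₃ _ (hk.of_rel hϖ hMN h₂ h₃ hc hd hz)).elim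
  · exact (not_admissible_s2s1 hN h₃ _ (hk.of_rel hϖ hMN h₂ h₃ hc hd hz)).elim
  · exact (not_admissible_w0 hN h₃ (hk.of_rel hϖ hMN h₂ h₃ hc hd hz)).elim
  · refine ⟨Weyl.one, one_mem_weylSet _ _, ?_⟩
    obtain ⟨a, ⟨ha, ha0⟩, x, hx⟩ : ∃ a : Fin 3 → ℕ, (Reduced c d (a 0) (a 1) (a 2) ∧
        (c 0 = 0 → d 0 = 0 → a 0 = 1 ∧ a 2 = a 1)) ∧ ∃ x : Oˣ, Rel ϖ c d k.val
          (tRep ϖ (fun i => (a i : ℤ)) x).val := by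
      by_cases h0 : c 0 = 0 ∧ d 0 = 0
      · obtain ⟨x', hx'⟩ := hr.exists_rel_of_zero hϖ hcT hdT h0.1 h0.2 x
        obtain ⟨b1, b2, b3, b4, b5, b6, b7, b8, b9, b10, b11, b12⟩ := hr
        refine ⟨![1, q, q], ⟨⟨le_rfl, b2, b2, le_rfl, le_max_right _ _, le_max_right _ _, b7, b8,
          b7.trans hcT.2.1, b8.trans hdT.2.1, ?_, ?_⟩, fun _ _ => ⟨rfl, rfl⟩⟩, x',
          hx.trans hcT hdT hx'⟩
        · simp only [Matrix.cons_val]; omega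
        · simp only [Matrix.cons_val]; omega
      · exact ⟨![p, q, r], ⟨hr, fun h h' => (h0 ⟨h, h'⟩).elim⟩, x, hx⟩
    refine ⟨_, ⟨_, (mem_tripleSet_iff hcT hdT hc1 hd1 a).2 ⟨ha, ha0⟩, Quotient.mk _ x, rfl⟩,
      hx.trans hcT hdT (rel_of_sameParam hϖ hcT hdT ha.p_pos ha.q_pos ?_)⟩
    exact Quotient.exact (hσ _ (Quotient.mk _ x)).symm
  · refine ⟨Weyl.s1, by simp [weylSet_of_pos hcT hdT hc1 hd1 hc0 hd0], _, ⟨α, β, ?_⟩, hx⟩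
    simp only [under, le_min_iff, and_true]
    omega
  · refine ⟨Weyl.s2, by simp [weylSet_of_pos hcT hdT hc1 hd1 hc0 hd0], _, ⟨α, β, ?_⟩, hx⟩
    simp only [under, le_min_iff, and_true]
    omega

/-- The classification over a discrete valuation ring in which `2` is a unit. -/
theorem classification (hϖ : Irreducible ϖ) (h2 : IsUnit (2 : O)) (hMN : M ≤ N)
    (h₂ : HasConductor χ₂ M) (h₃ : HasConductor χ₃ N) (h₂₃ : HasConductor (χ₂ * χ₃⁻¹) N)
    (hc : Good M N c) (hd : Good M N d)
    (σ : ∀ a : Triple, Param O (fun i => (c i : ℤ)) (fun i => (d i : ℤ)) a → Oˣ)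
    (hσ : ∀ (a : Triple) (ξ), Quotient.mk (paramSetoid O _ _ a) (σ a ξ) = ξ) :
    (∀ w ∈ weylSet (fun i => (c i : ℤ)) (fun i => (d i : ℤ)),
      suppSet ϖ M N (fun i => (c i : ℤ)) (fun i => (d i : ℤ)) σ w =
      {r ∈ repSet ϖ (fun i => (c i : ℤ)) (fun i => (d i : ℤ)) σ w |
        DoubleCoset.doubleCoset r (groupC O (fun i => (c i : ℤ))) (groupC O (fun i => (d i : ℤ))) ∈
        supportingCosets χ₂ χ₃ (fun i => (c i : ℤ)) (fun i => (d i : ℤ))}) ∧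
    Set.BijOn (fun r => DoubleCoset.doubleCoset r (groupC O (fun i => (c i : ℤ)))
        (groupC O (fun i => (d i : ℤ))))
      (⋃ w ∈ weylSet (fun i => (c i : ℤ)) (fun i => (d i : ℤ)),
        suppSet ϖ M N (fun i => (c i : ℤ)) (fun i => (d i : ℤ)) σ w)
      (supportingCosets χ₂ χ₃ (fun i => (c i : ℤ)) (fun i => (d i : ℤ))) := by
  have hS := suppSet_eq (ϖ := ϖ) hϖ h2 hMN h₂ h₃ h₂₃ hc hd σ
  have hmem := mem_supportingCosets_iff hϖ hMN h₂ h₃ hc hd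
  refine ⟨fun w hw => ?_, ?_, ?_, ?_⟩
  · rw [hS w hw]
    simp only [hmem]
  · intro r hr
    simp only [Set.mem_iUnion] at hr
    obtain ⟨w, hw, hr⟩ := hr
    rw [hS w hw] at hr
    exact (hmem r).2 hr.2
  · intro r hr r' hr' h
    simp only [Set.mem_iUnion] at hr hr'
    obtain ⟨w, hw, hr⟩ := hr
    obtain ⟨w', hw', hr'⟩ := hr'
    exact eq_of_sameCoset hϖ hc hd hσ hw hw' hr hr' (rel_of_doubleCoset_eq hϖ hc.inT hd.inT h)
  · intro D hD
    obtain ⟨k, rfl⟩ := hD.1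
    have hk := (hmem k).1 hD
    obtain ⟨w, hw, r, hr, h⟩ := exists_rel_repSet hϖ h2 hMN h₂ h₃ hc hd hσ hk
    refine ⟨r, ?_, (doubleCoset_eq_of_rel hϖ hc.inT hd.inT h).symm⟩
    simp only [Set.mem_iUnion]
    refine ⟨w, hw, ?_⟩
    rw [hS w hw]
    exact ⟨hr, hk.of_rel hϖ hMN h₂ h₃ hc hd h⟩

/-- Triples above `(M, N, N)` come from exponents in `ℕ`. -/
theorem exists_good_of_mem {M N : ℕ} (hN : 0 < N) {c : Triple}
    (hc : c ∈ posetTAbove ![(M : ℤ), N, N]) :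
    ∃ c' : Fin 3 → ℕ, c = (fun i => (c' i : ℤ)) ∧ Good M N c' := by
  obtain ⟨⟨h0, h1, h2, h3, h4⟩, hm⟩ := hc
  have m0 : (M : ℤ) ≤ c 0 := hm 0
  have m1 : (N : ℤ) ≤ c 1 := hm 1
  have e : c = fun i => ((c i).toNat : ℤ) := by
    funext i
    fin_cases i
    · exact (Int.toNat_of_nonneg h0).symm
    · exact (Int.toNat_of_nonneg h1).symm
    · exact (Int.toNat_of_nonneg (h0.trans h2)).symm
  refine ⟨_, e, ⟨?_, ?_, ?_⟩, hN, ?_, ?_⟩ <;> beta_reduce <;> omega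

end main

end BranchGL3

open BranchGL3
theorem theoremT {F : Type*} [Field F] [ValuativeRel F] [TopologicalSpace F]
    [IsNonarchimedeanLocalField F] [CharZero F]
    (hp : ringChar 𝓀[F] ≠ 2) (hq : 3 < Nat.card 𝓀[F])
    (ϖ : 𝒪[F]) (hϖ : Irreducible ϖ)
    (χ₂ χ₃ : (𝒪[F])ˣ →* ℂˣ) (M N : ℕ) (hMN : M ≤ N) (hN : 0 < N)
    (h₂ : HasConductor χ₂ M) (h₃ : HasConductor χ₃ N) (h₂₃ : HasConductor (χ₂ * χ₃⁻¹) N)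
    (c d : Triple) (hc : c ∈ posetTAbove ![(M : ℤ), N, N]) (hd : d ∈ posetTAbove ![(M : ℤ), N, N])
    (σ : ∀ a : Triple, Param 𝒪[F] c d a → (𝒪[F])ˣ)
    (hσ : ∀ (a : Triple) (ξ : Param 𝒪[F] c d a), Quotient.mk (paramSetoid 𝒪[F] c d a) (σ a ξ) = ξ) :
    (∀ w ∈ weylSet c d, suppSet ϖ M N c d σ w =
      {r ∈ repSet ϖ c d σ w | DoubleCoset.doubleCoset r (groupC 𝒪[F] c) (groupC 𝒪[F] d) ∈
        supportingCosets χ₂ χ₃ c d}) ∧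
    Set.BijOn (fun r => DoubleCoset.doubleCoset r (groupC 𝒪[F] c) (groupC 𝒪[F] d))
      (⋃ w ∈ weylSet c d, suppSet ϖ M N c d σ w) (supportingCosets χ₂ χ₃ c d) := by
  have h2 : IsUnit (2 : 𝒪[F]) := by
    by_contra h
    have h' := (IsLocalRing.residue_eq_zero_iff (2 : 𝒪[F])).2 h
    rw [map_ofNat] at h'
    exact Ring.two_ne_zero hp h'
  obtain ⟨c, rfl, hc'⟩ := exists_good_of_mem hN hc
  obtain ⟨d, rfl, hd'⟩ := exists_good_of_mem hN hd
  exact classification hϖ h2 hMN h₂ h₃ h₂₃ hc' hd' σ hσ
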